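/- Let $k$ be a field, $n\ge 1$ and $\Lambda_n=k[x]/\langle x^n\rangle$. Let $\mathcal S(n)$ be the category of pairs $(X,Y)$, where $Y$ is a $\Lambda_n$-module of finite length and $X\subseteq Y$ is a submodule; morphisms $(X,Y)\to(X',Y')$ are the $\Lambda_n$-linear maps $Y\to Y'$ which map $X$ into $X'$. Let $[j]$ be the indecomposable $\Lambda_n$-module of length $j$ (with $[0]=0$), and for $0\le i\le j\le n$ let $([i],[j])$ be the pair given by $[j]$ and its submodule of length $i$. For a class $\mathcal K$ of objects of an additive category $\mathcal A$, let $\langle\mathcal K\rangle$ be the ideal of all morphisms which factor through a finite direct sum of objects in $\mathcal K$, and $\mathcal A/\mathcal K=\mathcal A/\langle\mathcal K\rangle$ the factor category. Let $\Pi_{m}$ be the preprojective algebra of type $\mathbb A_{m}$ over $k$ (with $\Pi_0=0$) and $\operatorname{mod}\Pi_m$ the category of $\Pi_m$-modules of finite length. (a) With the conflations $(X_1,Y_1)\to(X_2,Y_2)\to(X_3,Y_3)$ such that both $0\to X_1\to X_2\to X_3\to0$ and $0\to Y_1\to Y_2\to Y_3\to 0$ are exact, $\mathcal S(n)$ is a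 Frobenius category, and $([0],[n])$ and $([n],[n])$ are, up to isomorphism, its only indecomposable projective-injective objects. The stable category $\mathcal T=\underline{\mathcal S}(n)=\mathcal S(n)/\{([0],[n]),([n],[n])\}$ is a triangulated category, in such a way that every conflation induces a distinguished triangle in $\mathcal T$. (b) Let $\mathcal I$ be the ideal of $\mathcal T$ generated by the objects $([i],[j])$ with $1\le i\le n-1$ and ($i=j$ or $j=n$). These are $2n-2$ pairwise non-isomorphic indecomposable objects of $\mathcal T$. Let $\mathcal U$ be the set of objects $([i],[j])$ of $\mathcal S(n)$ with $i=j$ or $j=n$. There are equivalences of additive categories $$\mathcal T/\mathcal I\simeq\mathcal S(n)/\mathcal U\simeq\operatorname{mod}\Pi_{n-1},$$ and hence $\mathcal T/\mathcal I$ is an abelian category. (c) Let $\mathcal J$ be the ideal of $\mathcal T$ generated by the objects $([i],[j])$ with $1\le j\le n-1$ and ($i=j$ or $i=0$). These are $2n-2$ pairwise non-isomorphic indecomposable objects of $\mathcal T$. Let $\mathcal V$ be the set of objects $([i],[j])$ of $\mathcal S(n)$ with $i=j$ or $i=0$. There are equivalences of additive categories $$\mathcal T/\mathcal J\simeq\mathcal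 S(n)/\mathcal V\simeq\operatorname{mod}\Pi_{n-1},$$ and hence $\mathcal T/\mathcal J$ is an abelian category. -/

import Mathlib

open CategoryTheory CategoryTheory.Limits

universe u

/-! ### Ideals of additive categories generated by objects, and factor categories -/

section Ideals

variable {C : Type*} [Category C] [Preadditive C]

/-- The ideal of `C` generated by the class `K` of objects: on each group of morphisms, the
subgroup generated by the morphisms which factor through an object of `K`.  In an additive category
it consists of the morphisms which factor through a finite direct sum of objects of `K`, see
`mem_objIdeal_iff`. -/
def objIdeal (K : ObjectProperty C) (X Y : C) : AddSubgroup (X ⟶ Y) :=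
  AddSubgroup.closure {f | ∃ (Z : C) (_ : K Z) (g : X ⟶ Z) (h : Z ⟶ Y), g ≫ h = f}

theorem objIdeal_comp_left (K : ObjectProperty C) {X Y Z : C} (f : X ⟶ Y) {g : Y ⟶ Z}
    (hg : g ∈ objIdeal K Y Z) : f ≫ g ∈ objIdeal K X Z := by
  induction hg using AddSubgroup.closure_induction with
  | mem g hg =>
    obtain ⟨W, hW, a, b, rfl⟩ := hg
    exact AddSubgroup.subset_closure ⟨W, hW, f ≫ a, b, by simp⟩
  | zero => rw [comp_zero]; exact zero_mem _
  | add a b _ _ ha hb => rw [Preadditive.comp_add]; exact add_mem ha hb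
  | neg a _ ha => rw [Preadditive.comp_neg]; exact neg_mem ha

theorem objIdeal_comp_right (K : ObjectProperty C) {X Y Z : C} {f : X ⟶ Y} (g : Y ⟶ Z)
    (hf : f ∈ objIdeal K X Y) : f ≫ g ∈ objIdeal K X Z := by
  induction hf using AddSubgroup.closure_induction with
  | mem f hf =>
    obtain ⟨W, hW, a, b, rfl⟩ := hf
    exact AddSubgroup.subset_closure ⟨W, hW, a, b ≫ g, by simp⟩
  | zero => rw [zero_comp]; exact zero_mem _
  | add a b _ _ ha hb => rw [Preadditive.add_comp]; exact add_mem ha hb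
  | neg a _ ha => rw [Preadditive.neg_comp]; exact neg_mem ha

/-- In an additive category, the ideal generated by `K` consists of the morphisms which factor
through a finite direct sum of objects of `K`. -/
theorem mem_objIdeal_iff [HasFiniteBiproducts C] (K : ObjectProperty C) {X Y : C} (f : X ⟶ Y) :
    f ∈ objIdeal K X Y ↔
      ∃ (m : ℕ) (Z : Fin m → C) (_ : ∀ i, K (Z i)) (g : X ⟶ ⨁ Z) (h : ⨁ Z ⟶ Y), g ≫ h = f := by
  constructor
  · intro hf
    have key : ∃ (m : ℕ) (Z : Fin m → C) (_ : ∀ i, K (Z i)) (g : ∀ i, X ⟶ Z i)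
        (h : ∀ i, Z i ⟶ Y), ∑ i, g i ≫ h i = f := by
      induction hf using AddSubgroup.closure_induction with
      | mem f hf =>
        obtain ⟨W, hW, a, b, rfl⟩ := hf
        exact ⟨1, fun _ => W, fun _ => hW, fun _ => a, fun _ => b, by simp⟩
      | zero =>
        exact ⟨0, fun i => i.elim0, fun i => i.elim0, fun i => i.elim0, fun i => i.elim0, by simp⟩
      | add a b _ _ ha hb =>
        obtain ⟨m, Z, hZ, g, h, rfl⟩ := ha
        obtain ⟨m', Z', hZ', g', h', rfl⟩ := hb
        refine ⟨m + m', Fin.addCases (motive := fun _ => C) Z Z', ?_,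
          fun i => Fin.addCases (motive := fun i => X ⟶ Fin.addCases (motive := fun _ => C) Z Z' i)
            (fun i => g i ≫ eqToHom (by simp)) (fun i => g' i ≫ eqToHom (by simp)) i,
          fun i => Fin.addCases (motive := fun i => Fin.addCases (motive := fun _ => C) Z Z' i ⟶ Y)
            (fun i => eqToHom (by simp) ≫ h i) (fun i => eqToHom (by simp) ≫ h' i) i, ?_⟩
        · intro i
          refine Fin.addCases (fun i => ?_) (fun i => ?_) i
          · simpa using hZ i
          · simpa using hZ' i
        · rw [Fin.sum_univ_add]
          simp
      | neg a _ ha =>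
        obtain ⟨m, Z, hZ, g, h, rfl⟩ := ha
        exact ⟨m, Z, hZ, fun i => -g i, h, by simp⟩
    obtain ⟨m, Z, hZ, g, h, rfl⟩ := key
    exact ⟨m, Z, hZ, biproduct.lift g, biproduct.desc h, biproduct.lift_desc⟩
  · rintro ⟨m, Z, hZ, g, h, rfl⟩
    have : g ≫ h = ∑ i, (g ≫ biproduct.π Z i) ≫ (biproduct.ι Z i ≫ h) := by
      conv_lhs => rw [← Category.id_comp h, ← biproduct.total]
      simp only [Preadditive.sum_comp, Preadditive.comp_sum, Category.assoc]
    rw [this]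
    exact sum_mem fun i _ => AddSubgroup.subset_closure ⟨Z i, hZ i, _, _, rfl⟩

/-- Two morphisms are congruent modulo the ideal generated by `K` if their difference lies in it. -/
def objIdealRel (K : ObjectProperty C) : HomRel C :=
  fun X Y f g => f - g ∈ objIdeal K X Y

instance objIdealRel_congruence (K : ObjectProperty C) : Congruence (objIdealRel K) where
  comp_left f g g' h := by
    have := objIdeal_comp_left K f h
    rwa [Preadditive.comp_sub] at this
  comp_right g h := by
    have := objIdeal_comp_right K g h
    rwa [Preadditive.sub_comp] at this
  equivalence :=
    { refl := fun f => by
        change f - f ∈ _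
        rw [sub_self]; exact zero_mem _
      symm := fun {f g} h => by
        change g - f ∈ _
        rw [← neg_sub]; exact neg_mem h
      trans := fun {f g l} h h' => by
        change f - l ∈ _
        rw [← sub_add_sub_cancel f g l]; exact add_mem h h' }

theorem objIdealRel_add (K : ObjectProperty C) ⦃X Y : C⦄ (f₁ f₂ g₁ g₂ : X ⟶ Y)
    (hf : objIdealRel K f₁ f₂) (hg : objIdealRel K g₁ g₂) :
    objIdealRel K (f₁ + g₁) (f₂ + g₂) := by
  change f₁ + g₁ - (f₂ + g₂) ∈ _
  rw [add_sub_add_comm]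
  exact add_mem hf hg

/-- The factor category `C / ⟨K⟩`: the objects of `C`, and the residue classes of morphisms modulo
the ideal generated by `K`. -/
abbrev FactorCategory (K : ObjectProperty C) := CategoryTheory.Quotient (objIdealRel K)

instance factorCategoryPreadditive (K : ObjectProperty C) : Preadditive (FactorCategory K) :=
  Quotient.preadditive (objIdealRel K) (objIdealRel_add K)

/-- The canonical projection `C ⥤ C / ⟨K⟩`. -/
abbrev factorFunctor (K : ObjectProperty C) : C ⥤ FactorCategory K :=
  Quotient.functor (objIdealRel K)

instance factorFunctor_additive (K : ObjectProperty C) : (factorFunctor K).Additive :=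
  Quotient.functor_additive (objIdealRel K) (objIdealRel_add K)

instance factorCategory_hasFiniteBiproducts [HasFiniteBiproducts C] (K : ObjectProperty C) :
    HasFiniteBiproducts (FactorCategory K) where
  out m :=
    { has_biproduct := fun Z =>
        hasBiproduct_of_total ((factorFunctor K).mapBicone (biproduct.bicone fun i => (Z i).as)) (by
          have h : ∑ i, biproduct.π (fun i => (Z i).as) i ≫ biproduct.ι (fun i => (Z i).as) i
            = 𝟙 (⨁ fun i => (Z i).as) := biproduct.total
          have h' := congrArg (factorFunctor K).map h
          rw [Functor.map_sum, CategoryTheory.Functor.map_id] at h'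
          simp only [CategoryTheory.Functor.map_comp] at h'
          exact h') }

instance factorCategory_hasBinaryBiproducts [HasFiniteBiproducts C] (K : ObjectProperty C) :
    HasBinaryBiproducts (FactorCategory K) :=
  hasBinaryBiproducts_of_finite_biproducts _

end Ideals

/-- An equivalence of additive categories. -/
def AdditivelyEquivalent (C D : Type*) [Category C] [Preadditive C] [Category D] [Preadditive D] :
    Prop :=
  ∃ e : C ≌ D, e.functor.Additive

/-- The preadditive category `C` is abelian. -/
def IsAbelianCategory (C : Type*) [Category C] [inst : Preadditive C] : Prop :=
  ∃ A : Abelian C, A.toPreadditive = inst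

/-! ### Exact categories and Frobenius categories -/

section Exact

variable {C : Type*} [Category C] [Preadditive C]

/-- The inflations of a class `E` of short complexes. -/
def IsInflation (E : ObjectProperty (ShortComplex C)) {X Y : C} (i : X ⟶ Y) : Prop :=
  ∃ (Z : C) (p : Y ⟶ Z) (w : i ≫ p = 0), E (ShortComplex.mk i p w)

/-- The deflations of a class `E` of short complexes. -/
def IsDeflation (E : ObjectProperty (ShortComplex C)) {Y Z : C} (p : Y ⟶ Z) : Prop :=
  ∃ (X : C) (i : X ⟶ Y) (w : i ≫ p = 0), E (ShortComplex.mk i p w)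

/-- `E` is an exact structure, in the sense of Quillen, on the additive category `C`. -/
structure IsExactStructure (E : ObjectProperty (ShortComplex C)) : Prop where
  additive : HasFiniteBiproducts C
  isoClosed : E.IsClosedUnderIsomorphisms
  isKernel : ∀ S, E S → Nonempty (IsLimit (KernelFork.ofι S.f S.zero))
  isCokernel : ∀ S, E S → Nonempty (IsColimit (CokernelCofork.ofπ S.g S.zero))
  inflation_id : ∀ X : C, IsInflation E (𝟙 X)
  deflation_id : ∀ X : C, IsDeflation E (𝟙 X)
  inflation_comp : ∀ {X Y Z : C} (i : X ⟶ Y) (j : Y ⟶ Z),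
    IsInflation E i → IsInflation E j → IsInflation E (i ≫ j)
  deflation_comp : ∀ {X Y Z : C} (p : X ⟶ Y) (q : Y ⟶ Z),
    IsDeflation E p → IsDeflation E q → IsDeflation E (p ≫ q)
  pushout : ∀ {X Y X' : C} (i : X ⟶ Y) (f : X ⟶ X'), IsInflation E i →
    ∃ (Y' : C) (f' : Y ⟶ Y') (i' : X' ⟶ Y'), IsPushout i f f' i' ∧ IsInflation E i'
  pullback : ∀ {Y Z Z' : C} (p : Y ⟶ Z) (f : Z' ⟶ Z), IsDeflation E p →
    ∃ (Y' : C) (f' : Y' ⟶ Y) (p' : Y' ⟶ Z'), IsPullback f' p' p f ∧ IsDeflation E p'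

/-- `P` is projective with respect to the exact structure `E`. -/
def IsExactProjective (E : ObjectProperty (ShortComplex C)) (P : C) : Prop :=
  ∀ {Y Z : C} (p : Y ⟶ Z), IsDeflation E p → ∀ f : P ⟶ Z, ∃ g : P ⟶ Y, g ≫ p = f

/-- `J` is injective with respect to the exact structure `E`. -/
def IsExactInjective (E : ObjectProperty (ShortComplex C)) (J : C) : Prop :=
  ∀ {X Y : C} (i : X ⟶ Y), IsInflation E i → ∀ f : X ⟶ J, ∃ g : Y ⟶ J, i ≫ g = f

/-- `C` with the conflations `E` is a Frobenius category. -/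
structure IsFrobeniusStructure (E : ObjectProperty (ShortComplex C)) : Prop where
  exact : IsExactStructure E
  enoughProjectives : ∀ X : C, ∃ (P : C) (p : P ⟶ X), IsExactProjective E P ∧ IsDeflation E p
  enoughInjectives : ∀ X : C, ∃ (J : C) (i : X ⟶ J), IsExactInjective E J ∧ IsInflation E i
  projective_iff_injective : ∀ X : C, IsExactProjective E X ↔ IsExactInjective E X

end Exact

/-! ### The category `𝒮(n)` -/

/-- The algebra `Λ_n = k[x]/⟨x ^ n⟩`. -/
abbrev TruncPoly (k : Type u) [Field k] (n : ℕ) : Type u :=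
  Polynomial k ⧸ Ideal.span {(Polynomial.X : Polynomial k) ^ n}

/-- The residue class of `x` in `Λ_n`. -/
noncomputable def TruncPoly.x (k : Type u) [Field k] (n : ℕ) : TruncPoly k n :=
  Ideal.Quotient.mk _ Polynomial.X

/-- An object of `𝒮(n)`: a `Λ_n`-module `Y` of finite length together with a submodule `X`. -/
structure SubmodPair (k : Type u) [Field k] (n : ℕ) : Type (u + 1) where
  Y : Type u
  [addCommGroup : AddCommGroup Y]
  [module : Module (TruncPoly k n) Y]
  finiteLength : IsFiniteLength (TruncPoly k n) Y
  X : Submodule (TruncPoly k n) Y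

attribute [instance] SubmodPair.addCommGroup SubmodPair.module

/-- Morphisms `(X, Y) ⟶ (X', Y')` are the linear maps `Y → Y'` which map `X` into `X'`. -/
noncomputable instance SubmodPair.category (k : Type u) [Field k] (n : ℕ) : Category (SubmodPair k n) where
  Hom A B := ↥(Submodule.compatibleMaps A.X B.X)
  id A := ⟨LinearMap.id, fun _ h => h⟩
  comp f g := ⟨g.1 ∘ₗ f.1, fun _ h => g.2 (f.2 h)⟩

noncomputable instance SubmodPair.preadditive (k : Type u) [Field k] (n : ℕ) : Preadditive (SubmodPair k n) where
  homGroup A B := inferInstanceAs (AddCommGroup ↥(Submodule.compatibleMaps A.X B.X))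
  add_comp _ _ _ f f' g := Subtype.ext (LinearMap.comp_add f.1 f'.1 g.1)
  comp_add _ _ _ f g g' := Subtype.ext (LinearMap.add_comp f.1 g'.1 g.1)

/-- The underlying linear map `Y → Y'` of a morphism of `𝒮(n)`. -/
noncomputable def SubmodPair.toLin {k : Type u} [Field k] {n : ℕ} {A B : SubmodPair k n} (f : A ⟶ B) :
    A.Y →ₗ[TruncPoly k n] B.Y := f.1

instance SubmodPair.hasBinaryBiproducts (k : Type u) [Field k] (n : ℕ) :
    HasBinaryBiproducts (SubmodPair k n) where
  has_binary_biproduct A B :=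
    hasBinaryBiproduct_of_total
      { pt :=
          { Y := A.Y × B.Y
            finiteLength := by
              have hA := isFiniteLength_iff_isNoetherian_isArtinian.1 A.finiteLength
              have hB := isFiniteLength_iff_isNoetherian_isArtinian.1 B.finiteLength
              have := hA.1
              have := hA.2
              have := hB.1
              have := hB.2
              exact isFiniteLength_iff_isNoetherian_isArtinian.2 ⟨inferInstance, inferInstance⟩
            X := A.X.prod B.X }
        fst := ⟨LinearMap.fst _ _ _, fun _ h => h.1⟩
        snd := ⟨LinearMap.snd _ _ _, fun _ h => h.2⟩
        inl := ⟨LinearMap.inl _ _ _, fun _ h => ⟨h, zero_mem _⟩⟩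
        inr := ⟨LinearMap.inr _ _ _, fun _ h => ⟨zero_mem _, h⟩⟩
        inl_fst := rfl
        inl_snd := rfl
        inr_fst := rfl
        inr_snd := rfl }
      (Subtype.ext (LinearMap.ext fun y => by
        change (y.1, (0 : B.Y)) + ((0 : A.Y), y.2) = y
        simp))

instance SubmodPair.hasFiniteBiproducts (k : Type u) [Field k] (n : ℕ) :
    HasFiniteBiproducts (SubmodPair k n) := by
  let Z : SubmodPair k n :=
    { Y := PUnit
      finiteLength := IsFiniteLength.of_subsingleton
      X := ⊥ }
  have hZ : IsZero Z := by
    rw [IsZero.iff_id_eq_zero]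
    exact Subtype.ext (LinearMap.ext fun _ => rfl)
  have : HasTerminal (SubmodPair k n) := hZ.isTerminal.hasTerminal
  have : HasFiniteProducts (SubmodPair k n) := hasFiniteProducts_of_has_binary_and_terminal
  exact HasFiniteBiproducts.of_hasFiniteProducts

/-- The natural exact structure on `𝒮(n)`: the pairs of maps `(X₁, Y₁) ⟶ (X₂, Y₂) ⟶ (X₃, Y₃)` for
which both `0 → Y₁ → Y₂ → Y₃ → 0` and the induced `0 → X₁ → X₂ → X₃ → 0` are exact. -/
def SubmodPair.conflations (k : Type u) [Field k] (n : ℕ) :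
    ObjectProperty (ShortComplex (SubmodPair k n)) := fun S =>
  (Function.Injective (toLin S.f) ∧ Function.Exact (toLin S.f) (toLin S.g) ∧
    Function.Surjective (toLin S.g)) ∧
  (Function.Injective ((toLin S.f).restrict S.f.2) ∧
    Function.Exact ((toLin S.f).restrict S.f.2) ((toLin S.g).restrict S.g.2) ∧
    Function.Surjective ((toLin S.g).restrict S.g.2))

theorem TruncPoly.isFiniteLength (k : Type u) [Field k] (n : ℕ) :
    IsFiniteLength (TruncPoly k n) (TruncPoly k n) := by
  have : Module.Finite k (TruncPoly k n) :=
    (Polynomial.monic_X_pow (R := k) n).finite_quotient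
  exact isFiniteLength_iff_isNoetherian_isArtinian.2
    ⟨isNoetherian_of_tower k inferInstance, isArtinian_of_tower k inferInstance⟩

/-- The object `([i], [j])` of `𝒮(n)`, for `i ≤ j ≤ n`.  Here `[j] = Λ_n / ⟨x ^ j⟩` is the
indecomposable `Λ_n`-module of length `j`, and `[i]` is its submodule of length `i`, generated by
the residue class of `x ^ (j - i)`. -/
noncomputable def SubmodPair.pair (k : Type u) [Field k] (n i j : ℕ) : SubmodPair k n where
  Y := TruncPoly k n ⧸ Ideal.span {TruncPoly.x k n ^ j}
  finiteLength := by
    have h := isFiniteLength_iff_isNoetherian_isArtinian.1 (TruncPoly.isFiniteLength k n)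
    have := h.1
    have := h.2
    exact isFiniteLength_iff_isNoetherian_isArtinian.2 ⟨inferInstance, inferInstance⟩
  X := Submodule.span _ {Submodule.Quotient.mk (TruncPoly.x k n ^ (j - i))}

/-- The objects `([0], [n])` and `([n], [n])` of `𝒮(n)`. -/
def SubmodPair.projInj (k : Type u) [Field k] (n : ℕ) : ObjectProperty (SubmodPair k n) :=
  fun A => A = pair k n 0 n ∨ A = pair k n n n

/-- The objects `([i], [j])` of `𝒮(n)` with `i = j` or `j = n`. -/
def SubmodPair.classU (k : Type u) [Field k] (n : ℕ) : ObjectProperty (SubmodPair k n) :=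
  fun A => ∃ i j : ℕ, i ≤ j ∧ j ≤ n ∧ (i = j ∨ j = n) ∧ A = pair k n i j

/-- The objects `([i], [j])` of `𝒮(n)` with `i = j` or `i = 0`. -/
def SubmodPair.classV (k : Type u) [Field k] (n : ℕ) : ObjectProperty (SubmodPair k n) :=
  fun A => ∃ i j : ℕ, i ≤ j ∧ j ≤ n ∧ (i = j ∨ i = 0) ∧ A = pair k n i j

/-- The stable category `𝒯` of `𝒮(n)`: the factor category of `𝒮(n)` modulo the ideal generated by
the indecomposable projective-injective objects `([0], [n])` and `([n], [n])`. -/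
abbrev StableS (k : Type u) [Field k] (n : ℕ) := FactorCategory (SubmodPair.projInj k n)

/-- The canonical projection `𝒮(n) ⥤ 𝒯`. -/
noncomputable abbrev StableS.proj (k : Type u) [Field k] (n : ℕ) : SubmodPair k n ⥤ StableS k n :=
  factorFunctor (SubmodPair.projInj k n)

/-- The object `([i], [j])` of `𝒯`. -/
noncomputable abbrev StableS.pair (k : Type u) [Field k] (n : ℕ) (p : ℕ × ℕ) : StableS k n :=
  (StableS.proj k n).obj (SubmodPair.pair k n p.1 p.2)

/-- The pairs `(i, j)` with `1 ≤ i ≤ n - 1` and (`i = j` or `j = n`). -/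
def indexI (n : ℕ) : Set (ℕ × ℕ) := {p | 1 ≤ p.1 ∧ p.1 ≤ n - 1 ∧ (p.1 = p.2 ∨ p.2 = n)}

/-- The pairs `(i, j)` with `1 ≤ j ≤ n - 1` and (`i = j` or `i = 0`). -/
def indexJ (n : ℕ) : Set (ℕ × ℕ) := {p | 1 ≤ p.2 ∧ p.2 ≤ n - 1 ∧ (p.1 = p.2 ∨ p.1 = 0)}

/-- The class of objects `([i], [j])` of `𝒯` with `(i, j)` in `s`. -/
def StableS.pairs (k : Type u) [Field k] (n : ℕ) (s : Set (ℕ × ℕ)) :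
    ObjectProperty (StableS k n) :=
  fun A => ∃ p ∈ s, A = StableS.pair k n p

/-! ### The preprojective algebra of type `𝔸_m` -/

/-- Generators of the path algebra of the double quiver of `𝔸_m`: the `m` vertices, the `m - 1`
arrows `a i : i → i + 1`, and the opposite arrows `b i : i + 1 → i`. -/
inductive DoubleA (m : ℕ) : Type
  | e (i : Fin m) : DoubleA m
  | a (i : Fin (m - 1)) : DoubleA m
  | b (i : Fin (m - 1)) : DoubleA m

/-- The vertex `i`, where the arrow `a i` starts. -/
def DoubleA.src {m : ℕ} (i : Fin (m - 1)) : Fin m := ⟨i, by omega⟩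

/-- The vertex `i + 1`, where the arrow `a i` ends. -/
def DoubleA.tgt {m : ℕ} (i : Fin (m - 1)) : Fin m := ⟨i + 1, by omega⟩

open FreeAlgebra in
/-- The relations of the path algebra of the double quiver of `𝔸_m` (paths are composed like maps,
so that `a i = e (i + 1) * a i * e i`), and the preprojective relation `∑ (a b - b a) = 0`. -/
inductive PreprojRel (k : Type u) [Field k] (m : ℕ) :
    FreeAlgebra k (DoubleA m) → FreeAlgebra k (DoubleA m) → Prop
  | idem (i : Fin m) : PreprojRel k m (ι k (.e i) * ι k (.e i)) (ι k (.e i))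
  | orth (i j : Fin m) : i ≠ j → PreprojRel k m (ι k (.e i) * ι k (.e j)) 0
  | one : PreprojRel k m (∑ i : Fin m, ι k (.e i)) 1
  | a_src (i : Fin (m - 1)) : PreprojRel k m (ι k (.a i) * ι k (.e (DoubleA.src i))) (ι k (.a i))
  | a_tgt (i : Fin (m - 1)) : PreprojRel k m (ι k (.e (DoubleA.tgt i)) * ι k (.a i)) (ι k (.a i))
  | b_src (i : Fin (m - 1)) : PreprojRel k m (ι k (.b i) * ι k (.e (DoubleA.tgt i))) (ι k (.b i))
  | b_tgt (i : Fin (m - 1)) : PreprojRel k m (ι k (.e (DoubleA.src i)) * ι k (.b i)) (ι k (.b i))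
  | preproj : PreprojRel k m
      (∑ i : Fin (m - 1), (ι k (.a i) * ι k (.b i) - ι k (.b i) * ι k (.a i))) 0

/-- The preprojective algebra `Π_m` of type `𝔸_m`. -/
abbrev PreprojA (k : Type u) [Field k] (m : ℕ) : Type u := RingQuot (PreprojRel k m)

/-- The category `mod R` of (left) `R`-modules of finite length. -/
abbrev FinLenMod (R : Type u) [Ring R] :=
  ObjectProperty.FullSubcategory (fun M : ModuleCat.{u} R => IsFiniteLength R M)

/-! The ring `Λ_n` is uniserial and self-injective: its ideals are generated by powers of `x`, its
finitely generated modules are direct sums of cyclic modules `[j]` with `j ≤ n`, and `[n]` is both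
projective and injective. All three parts rest on this.

(a) Maps out of `([n],[n])` and `([0],[n])` are elements of `X` and of `Y`; maps into them are maps
from `Y` and from `Y/X` to `[n]`. So both pairs are projective and injective, and every pair is
covered by, and embeds into, a sum of copies of them (`exists_deflation_freePair`,
`exists_inflation_freePair`). Local endomorphism rings then identify the indecomposable ones. For
the triangulation, the cocycles of degree zero give an equivalence from the homotopy category of
exact complexes of projective-injective pairs to `𝒯` (`exactCocycles`), and the triangulated
structure is carried across it. A conflation is resolved by a degreewise split sequence of
complexes, as in the horseshoe lemma (`exists_distinguished_triangle`).

(b), (c) `Π_{n-1}` is the stable Auslander algebra of `Λ_n`: the vertex `i`, counted from `0`,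
stands for `[i+1]`. Hence every module of finite length over it is the cokernel of
`\underline{Hom}(-,Y) → \underline{Hom}(-,Z)` for some `g : Y → Z`, and `Phi g` is this cokernel
written with elements. By the Yoneda argument a homomorphism `Phi g → Phi g'` comes from some `ζ : Z
→ Z'` with `ζ g = g' s + w v`, where `v` has values in a free module
(`Phi.exists_lift_factorization`); density is `Phi.exists_equiv`.

Applying `Phi` to `X → Y` and to `Y → Y/X` gives two full and dense functors on `𝒮(n)`. If the first
one kills `f`, then `f = s + w v` with `s : Y → X'`, so `f` factors through the sum of `(Y,Y)` and
`(v(X), free)`, which belongs to the ideal of `𝒰`. If the second one kills `f`, then `f = t π + r`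
with `t` defined on `Y/X` and `r : Y → X'`, so `f` factors through `(0,Y/X)` and `(Y,Y)`, which
gives `𝒱`. Since `𝒰` and `𝒱` both contain the projective-injective pairs, factoring out these first
and the remaining objects afterwards has the same result, and abelianness is inherited from `mod
Π_{n-1}`. -/

/-! ### Modules over `k[x]/⟨x ^ n⟩` -/

namespace TruncPoly

variable {k : Type u} [Field k] {n : ℕ}

theorem x_pow_self : x k n ^ n = 0 := by
  rw [x, ← map_pow, Ideal.Quotient.eq_zero_iff_mem]
  exact Ideal.mem_span_singleton_self _

theorem x_pow_eq_zero {i : ℕ} (h : n ≤ i) : x k n ^ i = 0 :=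
  pow_eq_zero_of_le h x_pow_self

theorem x_pow_smul_eq_zero {Y : Type*} [AddCommGroup Y] [Module (TruncPoly k n) Y] (y : Y) :
    x k n ^ n • y = 0 := by
  rw [x_pow_self, zero_smul (TruncPoly k n) y]

theorem x_pow_smul_of_le {Y : Type*} [AddCommGroup Y] [Module (TruncPoly k n) Y] {i : ℕ}
    (h : n ≤ i) (y : Y) : x k n ^ i • y = 0 := by
  rw [← Nat.sub_add_cancel h, pow_add, mul_smul, x_pow_smul_eq_zero, smul_zero]

theorem mk_surjective : Function.Surjective
    (Ideal.Quotient.mk (Ideal.span {(Polynomial.X : Polynomial k) ^ n})) :=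
  Ideal.Quotient.mk_surjective

theorem mk_X_pow (i : ℕ) :
    Ideal.Quotient.mk (Ideal.span {(Polynomial.X : Polynomial k) ^ n}) (Polynomial.X ^ i)
      = x k n ^ i := by
  rw [map_pow, x]

/-- For `j ≤ n` the power `X ^ j` divides `X ^ n`, so divisibility by it does not depend on the
representative. -/
theorem mk_mem_span_x_pow {j : ℕ} (hj : j ≤ n) {p : Polynomial k} :
    Ideal.Quotient.mk (Ideal.span {(Polynomial.X : Polynomial k) ^ n}) p
      ∈ Ideal.span {x k n ^ j} ↔ Polynomial.X ^ j ∣ p := by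
  rw [Ideal.mem_span_singleton]
  constructor
  · rintro ⟨d, hd⟩
    obtain ⟨q, rfl⟩ := mk_surjective d
    rw [← mk_X_pow, ← map_mul, Ideal.Quotient.eq, Ideal.mem_span_singleton] at hd
    have h := (pow_dvd_pow Polynomial.X hj).trans hd
    exact (dvd_sub_left (dvd_mul_right _ _)).1 h
  · rintro ⟨q, rfl⟩
    exact ⟨Ideal.Quotient.mk _ q, by rw [map_mul, mk_X_pow]⟩

/-- `X ^ i` can be cancelled in the domain `k[X]`. For `i ≥ j` the truncated exponent is `0` and
there is nothing to prove. -/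
theorem mem_span_x_pow_of_mul_mem {i j : ℕ} (hj : j ≤ n) {c : TruncPoly k n}
    (h : x k n ^ i * c ∈ Ideal.span {x k n ^ j}) : c ∈ Ideal.span {x k n ^ (j - i)} := by
  obtain ⟨p, rfl⟩ := mk_surjective c
  rw [← mk_X_pow i, ← map_mul, mk_mem_span_x_pow hj] at h
  rw [mk_mem_span_x_pow (by omega)]
  rcases le_total j i with hij | hij
  · rw [Nat.sub_eq_zero_of_le hij, pow_zero]; exact one_dvd _
  · rw [← Nat.add_sub_cancel' hij, pow_add] at h
    exact (mul_dvd_mul_iff_left (pow_ne_zero _ Polynomial.X_ne_zero)).1 h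

/-- The preimage in `k[X]` is principal and contains `X ^ n`, so its generator is associated to a
power of the prime `X`. -/
theorem exists_ideal_eq_span (I : Ideal (TruncPoly k n)) :
    ∃ i ≤ n, I = Ideal.span {x k n ^ i} := by
  set J := I.comap (Ideal.Quotient.mk (Ideal.span {(Polynomial.X : Polynomial k) ^ n})) with hJ
  obtain ⟨p, hp⟩ := (IsPrincipalIdealRing.principal J).principal
  have hX : Polynomial.X ^ n ∈ J := by
    rw [hJ, Ideal.mem_comap, mk_X_pow, x_pow_self]; exact zero_mem _
  rw [hp, Ideal.submodule_span_eq, Ideal.mem_span_singleton] at hX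
  obtain ⟨i, hi, hi'⟩ := (dvd_prime_pow Polynomial.prime_X n).1 hX
  refine ⟨i, hi, ?_⟩
  have hIJ : I = J.map (Ideal.Quotient.mk _) :=
    (Ideal.map_comap_of_surjective _ mk_surjective I).symm
  rw [hIJ, hp, Ideal.submodule_span_eq, Ideal.span_singleton_eq_span_singleton.2 hi',
    Ideal.map_span, Set.image_singleton, mk_X_pow]

instance : IsNoetherianRing (TruncPoly k n) :=
  (isFiniteLength_iff_isNoetherian_isArtinian.1 (isFiniteLength k n)).1

instance : IsArtinianRing (TruncPoly k n) :=
  (isFiniteLength_iff_isNoetherian_isArtinian.1 (isFiniteLength k n)).2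

theorem isFiniteLength_iff_finite {Y : Type u} [AddCommGroup Y] [Module (TruncPoly k n) Y] :
    IsFiniteLength (TruncPoly k n) Y ↔ Module.Finite (TruncPoly k n) Y := by
  rw [isFiniteLength_iff_isNoetherian_isArtinian]
  exact ⟨fun h => have := h.1; inferInstance, fun _ => ⟨inferInstance, inferInstance⟩⟩

end TruncPoly

/-- The cyclic `Λ_n`-module `[j] = Λ_n / ⟨x ^ j⟩`. -/
def CyclicMod (k : Type u) [Field k] (n j : ℕ) : Type u :=
  TruncPoly k n ⧸ Ideal.span {TruncPoly.x k n ^ j}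

/-- The structure is taken from `SubmodPair.pair`, so that the module underlying `([i],[j])` is
`CyclicMod k n j` by definition, for every `i`. -/
noncomputable instance (k : Type u) [Field k] (n j : ℕ) : AddCommGroup (CyclicMod k n j) :=
  (SubmodPair.pair k n 0 j).addCommGroup

noncomputable instance (k : Type u) [Field k] (n j : ℕ) :
    Module (TruncPoly k n) (CyclicMod k n j) :=
  (SubmodPair.pair k n 0 j).module

namespace CyclicMod

open TruncPoly

variable {k : Type u} [Field k] {n : ℕ}

/-- The residue class map `Λ_n → [j]`. -/
noncomputable def mk (k : Type u) [Field k] (n j : ℕ) :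
    TruncPoly k n →ₗ[TruncPoly k n] CyclicMod k n j :=
  Submodule.mkQ (Ideal.span {TruncPoly.x k n ^ j})

theorem mk_surjective (j : ℕ) : Function.Surjective (mk k n j) :=
  Submodule.mkQ_surjective _

instance (j : ℕ) : Module.Finite (TruncPoly k n) (CyclicMod k n j) :=
  Module.Finite.of_surjective (mk k n j) (mk_surjective j)

/-- The canonical generator of `[j]`. -/
noncomputable def gen (k : Type u) [Field k] (n j : ℕ) : CyclicMod k n j := mk k n j 1

theorem mk_eq_smul_gen {j : ℕ} (c : TruncPoly k n) : mk k n j c = c • gen k n j := by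
  rw [gen, ← map_smul, smul_eq_mul, mul_one]

theorem exists_smul_gen {j : ℕ} (y : CyclicMod k n j) : ∃ c : TruncPoly k n, y = c • gen k n j := by
  obtain ⟨c, rfl⟩ := mk_surjective _ y
  exact ⟨c, mk_eq_smul_gen c⟩

theorem smul_gen_eq_zero {j : ℕ} {c : TruncPoly k n} :
    c • gen k n j = 0 ↔ c ∈ Ideal.span {x k n ^ j} := by
  rw [← mk_eq_smul_gen]
  exact Submodule.Quotient.mk_eq_zero _

theorem x_pow_smul_gen_self (j : ℕ) : x k n ^ j • gen k n j = 0 :=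
  smul_gen_eq_zero.2 (Ideal.mem_span_singleton_self _)

theorem x_pow_smul_self {j : ℕ} (y : CyclicMod k n j) : x k n ^ j • y = 0 := by
  obtain ⟨c, rfl⟩ := exists_smul_gen y
  rw [smul_comm, x_pow_smul_gen_self, smul_zero]

theorem exists_of_x_pow_smul_eq_zero {i j : ℕ} (hj : j ≤ n) {y : CyclicMod k n j}
    (h : x k n ^ i • y = 0) : ∃ c : TruncPoly k n, y = (c * x k n ^ (j - i)) • gen k n j := by
  obtain ⟨c, rfl⟩ := exists_smul_gen y
  rw [smul_smul, smul_gen_eq_zero] at h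
  obtain ⟨d, hd⟩ := Ideal.mem_span_singleton.1 (mem_span_x_pow_of_mul_mem hj h)
  exact ⟨d, by rw [hd, mul_comm]⟩

section Lift

variable {Y : Type*} [AddCommGroup Y] [Module (TruncPoly k n) Y]

/-- The linear map `[j] → Y` which maps the generator to an element `y` with `x ^ j • y = 0`. -/
noncomputable def lift {j : ℕ} (y : Y) (h : x k n ^ j • y = 0) :
    CyclicMod k n j →ₗ[TruncPoly k n] Y :=
  Submodule.liftQ (Ideal.span {TruncPoly.x k n ^ j})
    (LinearMap.toSpanSingleton (TruncPoly k n) Y y) (by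
      refine (Submodule.span_le (p := LinearMap.ker _)).2 ?_
      rw [Set.singleton_subset_iff]
      exact h)

@[simp]
theorem lift_gen {j : ℕ} (y : Y) (h : x k n ^ j • y = 0) : lift y h (gen k n j) = y :=
  one_smul _ _

end Lift

/-- The embedding of `[j]` into `[n]`. -/
noncomputable def toTop (k : Type u) [Field k] (n j : ℕ) :
    CyclicMod k n j →ₗ[TruncPoly k n] CyclicMod k n n :=
  lift (x k n ^ (n - j) • gen k n n) (by
    rw [smul_smul, ← pow_add, x_pow_smul_of_le (by omega)])

theorem toTop_gen (j : ℕ) : toTop k n j (gen k n j) = x k n ^ (n - j) • gen k n n :=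
  lift_gen _ _

theorem toTop_injective {j : ℕ} (hj : j ≤ n) : Function.Injective (toTop k n j) := by
  rw [injective_iff_map_eq_zero]
  intro y hy
  obtain ⟨c, rfl⟩ := exists_smul_gen y
  rw [map_smul, toTop_gen, smul_smul, mul_comm, smul_gen_eq_zero] at hy
  have := mem_span_x_pow_of_mul_mem le_rfl hy
  rwa [Nat.sub_sub_self hj, ← smul_gen_eq_zero] at this

/-- Exactness of `x ^ i` followed by `x ^ (n - i)` on `[n]`, from which self-injectivity follows. -/
theorem exists_x_pow_smul_of_eq_zero {i : ℕ} (hi : i ≤ n) {w : CyclicMod k n n}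
    (h : x k n ^ (n - i) • w = 0) : ∃ w', w = x k n ^ i • w' := by
  obtain ⟨c, hc⟩ := exists_of_x_pow_smul_eq_zero le_rfl h
  exact ⟨c • gen k n n, by rw [hc, Nat.sub_sub_self hi, smul_smul, mul_comm]⟩

/-- The image of the generator `x ^ i` of an ideal is killed by `x ^ (n - i)`, hence is `x ^ i • w`
for some `w`, and `1 ↦ w` extends the map. -/
theorem baer : Module.Baer (TruncPoly k n) (CyclicMod k n n) := by
  intro I g
  obtain ⟨i, hi, rfl⟩ := exists_ideal_eq_span I
  have hm : x k n ^ i ∈ Ideal.span {x k n ^ i} := Ideal.mem_span_singleton_self _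
  have h0 : x k n ^ (n - i) • g ⟨_, hm⟩ = 0 := by
    rw [← map_smul]
    convert map_zero g
    refine Subtype.ext ?_
    change x k n ^ (n - i) * x k n ^ i = 0
    rw [← pow_add, x_pow_eq_zero (by omega)]
  obtain ⟨w, hw⟩ := exists_x_pow_smul_of_eq_zero hi h0
  refine ⟨LinearMap.toSpanSingleton _ _ w, fun c hc => ?_⟩
  obtain ⟨d, rfl⟩ := Ideal.mem_span_singleton.1 hc
  have : (⟨x k n ^ i * d, hc⟩ : Ideal.span {x k n ^ i}) = d • ⟨_, hm⟩ :=
    Subtype.ext (mul_comm _ _)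
  rw [this, map_smul, hw, smul_smul, mul_comm]
  rfl

section Extension

variable {A B : Type u} [AddCommGroup A] [AddCommGroup B] [Module (TruncPoly k n) A]
  [Module (TruncPoly k n) B]

theorem exists_extension (i : A →ₗ[TruncPoly k n] B) (hi : Function.Injective i)
    (f : A →ₗ[TruncPoly k n] CyclicMod k n n) :
    ∃ g : B →ₗ[TruncPoly k n] CyclicMod k n n, g ∘ₗ i = f :=
  baer.extension_property i hi f

theorem exists_extension_pi {ι : Type*} (i : A →ₗ[TruncPoly k n] B) (hi : Function.Injective i)
    (f : A →ₗ[TruncPoly k n] (ι → CyclicMod k n n)) :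
    ∃ g : B →ₗ[TruncPoly k n] (ι → CyclicMod k n n), g ∘ₗ i = f := by
  choose g hg using fun l => exists_extension i hi (LinearMap.proj l ∘ₗ f)
  refine ⟨LinearMap.pi g, LinearMap.ext fun a => funext fun l => ?_⟩
  exact LinearMap.congr_fun (hg l) a

end Extension

section Pi

variable {ι : Type*} [Fintype ι] [DecidableEq ι] (e : ι → ℕ)

theorem pi_eq_sum_smul_single (c : ι → TruncPoly k n) :
    (fun l => c l • gen k n (e l)) = ∑ l, c l • Pi.single l (gen k n (e l)) := by
  ext l
  rw [Finset.sum_apply, Finset.sum_eq_single l]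
  · simp
  · intro l' _ h
    rw [Pi.smul_apply, Pi.single_eq_of_ne h.symm, smul_zero]
  · simp

theorem pi_exists_sum (y : ∀ l, CyclicMod k n (e l)) :
    ∃ c : ι → TruncPoly k n, y = ∑ l, c l • Pi.single l (gen k n (e l)) := by
  choose c hc using fun l => exists_smul_gen (y l)
  exact ⟨c, by rw [← pi_eq_sum_smul_single]; exact funext hc⟩

theorem pi_exists_sum_of_x_pow_smul_eq_zero (he : ∀ l, e l ≤ n) {i : ℕ}
    {y : ∀ l, CyclicMod k n (e l)} (h : x k n ^ i • y = 0) :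
    ∃ c : ι → TruncPoly k n,
      y = ∑ l, (c l * x k n ^ (e l - i)) • Pi.single l (gen k n (e l)) := by
  choose c hc using fun l => exists_of_x_pow_smul_eq_zero (he l) (congrFun h l)
  exact ⟨c, by rw [← pi_eq_sum_smul_single]; exact funext hc⟩

variable {Y : Type*} [AddCommGroup Y] [Module (TruncPoly k n) Y]

/-- The linear map out of a direct sum of cyclic modules determined by the images of the
generators. -/
noncomputable def piLift (y : ι → Y) (h : ∀ l, x k n ^ e l • y l = 0) :
    (∀ l, CyclicMod k n (e l)) →ₗ[TruncPoly k n] Y :=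
  ∑ l, lift (y l) (h l) ∘ₗ LinearMap.proj l

variable {e}

@[simp]
theorem piLift_single (y : ι → Y) (h : ∀ l, x k n ^ e l • y l = 0) (l : ι) :
    piLift e y h (Pi.single l (gen k n (e l))) = y l := by
  rw [piLift, LinearMap.sum_apply, Finset.sum_eq_single l]
  · simp
  · intro l' _ h
    simp [Pi.single_eq_of_ne h]
  · simp

theorem piLift_sum (y : ι → Y) (h : ∀ l, x k n ^ e l • y l = 0) (c : ι → TruncPoly k n) :
    piLift e y h (∑ l, c l • Pi.single l (gen k n (e l))) = ∑ l, c l • y l := by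
  simp

end Pi

end CyclicMod

namespace TruncPoly

open CyclicMod

variable {k : Type u} [Field k] {n : ℕ} (Y : Type u) [AddCommGroup Y] [Module (TruncPoly k n) Y]
  [Module.Finite (TruncPoly k n) Y]

/-- The structure theorem is applied over the principal ideal domain `k[X]`. The decomposition
obtained there is only `k[X]`-linear, so the `Λ_n`-linear isomorphism is rebuilt from the images of
the cyclic generators. -/
theorem exists_equiv_pi_cyclicMod :
    ∃ (d : ℕ) (e : Fin d → ℕ), (∀ l, e l ≤ n) ∧
      Nonempty (Y ≃ₗ[TruncPoly k n] ∀ l, CyclicMod k n (e l)) := by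
  let _ : Module (Polynomial k) Y := Module.compHom Y
    (Ideal.Quotient.mk (Ideal.span {(Polynomial.X : Polynomial k) ^ n}))
  have hsm (p : Polynomial k) (y : Y) :
      p • y = (Ideal.Quotient.mk (Ideal.span {(Polynomial.X : Polynomial k) ^ n}) p) • y := rfl
  have : IsScalarTower (Polynomial k) (TruncPoly k n) Y := ⟨fun p c y => by
    rw [hsm, smul_smul]; rfl⟩
  have : Module.Finite (Polynomial k) (TruncPoly k n) :=
    Module.Finite.of_surjective (Submodule.mkQ _) (Submodule.mkQ_surjective _)
  have : Module.Finite (Polynomial k) Y := Module.Finite.trans (TruncPoly k n) Y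
  have hX (y : Y) : (Polynomial.X ^ n : Polynomial k) • y = 0 := by
    rw [hsm, mk_X_pow, x_pow_smul_eq_zero]
  obtain ⟨d, e, ⟨φ⟩⟩ := Module.torsion_by_prime_power_decomposition
    (R := Polynomial k) (M := Y) (p := Polynomial.X) Polynomial.irreducible_X
    (fun {y} => ⟨⟨_, n, rfl⟩, hX y⟩)
  let g (l : Fin d) : DirectSum (Fin d) fun i => Polynomial k ⧸
      Submodule.span (Polynomial k) {(Polynomial.X : Polynomial k) ^ e i} :=
    DirectSum.lof (Polynomial k) _ _ l (Submodule.Quotient.mk 1)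
  have hg (l : Fin d) (p : Polynomial k) : p • g l = 0 ↔ Polynomial.X ^ e l ∣ p := by
    have hinj : Function.Injective (DirectSum.lof (Polynomial k) (Fin d) (fun i => Polynomial k ⧸
        Submodule.span (Polynomial k) {(Polynomial.X : Polynomial k) ^ e i}) l) :=
      DFinsupp.single_injective (β := fun i => Polynomial k ⧸
        Submodule.span (Polynomial k) {(Polynomial.X : Polynomial k) ^ e i})
    rw [← map_smul, ← Submodule.Quotient.mk_smul, smul_eq_mul, mul_one,
      map_eq_zero_iff _ hinj,
      Submodule.Quotient.mk_eq_zero, ← Ideal.span, Ideal.mem_span_singleton]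
  -- `X ^ n` kills `Y`, hence every cyclic summand.
  have he (l : Fin d) : e l ≤ n := by
    have : (Polynomial.X ^ n : Polynomial k) • g l = 0 := by
      rw [← φ.apply_symm_apply (g l), ← map_smul, hX, map_zero]
    rw [hg] at this
    exact (pow_dvd_pow_iff Polynomial.X_ne_zero Polynomial.not_isUnit_X).1 this
  have hy (l : Fin d) : x k n ^ e l • φ.symm (g l) = 0 := by
    rw [← mk_X_pow, ← hsm, ← map_smul, (hg l _).2 dvd_rfl, map_zero]
  refine ⟨d, e, he, ⟨(LinearEquiv.ofBijective (piLift e (fun l => φ.symm (g l)) hy)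
    ⟨?_, ?_⟩).symm⟩⟩
  · rw [injective_iff_map_eq_zero]
    intro y h
    obtain ⟨c, rfl⟩ := pi_exists_sum e y
    rw [piLift_sum] at h
    choose p hp using fun l => mk_surjective (c l)
    have h' : ∑ l, p l • g l = 0 := by
      rw [← map_zero φ, ← h, map_sum]
      refine Finset.sum_congr rfl fun l _ => ?_
      rw [← hp, ← hsm, map_smul, φ.apply_symm_apply]
    refine Finset.sum_eq_zero fun l _ => ?_
    have hl : p l • g l = 0 := by
      have h1 := DFunLike.congr_fun h' l
      have h2 : (∑ l, p l • g l) l = (p l • g l) l := by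
        rw [DirectSum.sum_apply, Finset.sum_eq_single l]
        · intro l' _ hl'
          rw [← map_smul, DirectSum.lof_eq_of, DirectSum.of_eq_of_ne _ _ _ hl'.symm]
        · simp
      rw [h2, ← map_smul, DirectSum.lof_apply] at h1
      rw [← map_smul, h1]; exact map_zero _
    rw [hg] at hl
    have hc : c l • gen k n (e l) = 0 := by
      rw [smul_gen_eq_zero, ← hp]
      exact (mk_mem_span_x_pow (he l)).2 hl
    ext l'
    by_cases h' : l' = l
    · subst h'; simpa using hc
    · simp [Pi.single_eq_of_ne h']
  · intro y
    have : ∃ z, φ (piLift e (fun l => φ.symm (g l)) hy z) = φ y := by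
      induction φ y using DirectSum.induction_on with
      | zero => exact ⟨0, by rw [map_zero, map_zero]⟩
      | add a b ha hb =>
        obtain ⟨z, rfl⟩ := ha
        obtain ⟨z', rfl⟩ := hb
        exact ⟨z + z', by rw [map_add, map_add]⟩
      | of l a =>
        obtain ⟨p, rfl⟩ := Submodule.Quotient.mk_surjective _ a
        refine ⟨Ideal.Quotient.mk (Ideal.span {Polynomial.X ^ n}) p • (Pi.single l (gen k n (e l)) :
          ∀ l, CyclicMod k n (e l)), ?_⟩
        rw [map_smul, piLift_single, ← hsm, map_smul, φ.apply_symm_apply, ← map_smul,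
          ← Submodule.Quotient.mk_smul, smul_eq_mul, mul_one]
        rfl
    obtain ⟨z, hz⟩ := this
    exact ⟨z, φ.injective hz⟩

theorem exists_embedding_pi : ∃ (d : ℕ) (i : Y →ₗ[TruncPoly k n] (Fin d → CyclicMod k n n)),
    Function.Injective i := by
  obtain ⟨d, e, he, ⟨φ⟩⟩ := exists_equiv_pi_cyclicMod (k := k) (n := n) Y
  refine ⟨d, LinearMap.pi (fun l => toTop k n (e l) ∘ₗ LinearMap.proj l) ∘ₗ φ.toLinearMap, ?_⟩
  intro a b h
  exact φ.injective (funext fun l => toTop_injective (he l) (congrFun h l))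

theorem exists_surjection_pi : ∃ (d : ℕ) (p : (Fin d → CyclicMod k n n) →ₗ[TruncPoly k n] Y),
    Function.Surjective p := by
  obtain ⟨d, s, hs⟩ := Module.Finite.exists_fin (R := TruncPoly k n) (M := Y)
  refine ⟨d, piLift (fun _ => n) s fun l => x_pow_smul_eq_zero _, ?_⟩
  rw [← LinearMap.range_eq_top, eq_top_iff, ← hs, Submodule.span_le]
  rintro _ ⟨l, rfl⟩
  exact ⟨_, piLift_single _ _ l⟩

theorem exists_lift_pi {ι A B : Type*} [Fintype ι] [AddCommGroup A] [AddCommGroup B]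
    [Module (TruncPoly k n) A] [Module (TruncPoly k n) B] (p : A →ₗ[TruncPoly k n] B)
    (hp : Function.Surjective p) (f : (ι → CyclicMod k n n) →ₗ[TruncPoly k n] B) :
    ∃ g : (ι → CyclicMod k n n) →ₗ[TruncPoly k n] A, p ∘ₗ g = f := by
  classical
  choose a ha using fun l : ι => hp (f (Pi.single l (gen k n n)))
  refine ⟨piLift (fun _ => n) a fun l => x_pow_smul_eq_zero _, LinearMap.ext fun y => ?_⟩
  obtain ⟨c, rfl⟩ := pi_exists_sum (fun _ => n) y
  simp [ha]

end TruncPoly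

/-! ### Morphisms and conflations of `𝒮(n)` -/

namespace SubmodPair

open TruncPoly CyclicMod

variable {k : Type u} [Field k] {n : ℕ} {A B D : SubmodPair k n}

instance (A : SubmodPair k n) : Module.Finite (TruncPoly k n) A.Y :=
  isFiniteLength_iff_finite.1 A.finiteLength

/-- The pair given by a finitely generated module and a submodule. -/
noncomputable abbrev of {Y : Type u} [AddCommGroup Y] [Module (TruncPoly k n) Y]
    [Module.Finite (TruncPoly k n) Y] (X : Submodule (TruncPoly k n) Y) : SubmodPair k n :=
  { Y := Y, finiteLength := isFiniteLength_iff_finite.2 inferInstance, X := X }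

/-- The morphism of `𝒮(n)` given by a linear map. -/
noncomputable def homMk (f : A.Y →ₗ[TruncPoly k n] B.Y) (h : ∀ y ∈ A.X, f y ∈ B.X) : A ⟶ B := ⟨f, h⟩

@[simp] theorem toLin_homMk (f : A.Y →ₗ[TruncPoly k n] B.Y) (h : ∀ y ∈ A.X, f y ∈ B.X) :
    toLin (homMk f h) = f := rfl

@[simp] theorem toLin_comp (f : A ⟶ B) (g : B ⟶ D) (y : A.Y) :
    toLin (f ≫ g) y = toLin g (toLin f y) := rfl

@[simp] theorem toLin_id (y : A.Y) : toLin (𝟙 A) y = y := rfl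

@[simp] theorem toLin_add (f g : A ⟶ B) (y : A.Y) : toLin (f + g) y = toLin f y + toLin g y := rfl

@[simp] theorem toLin_sub (f g : A ⟶ B) (y : A.Y) : toLin (f - g) y = toLin f y - toLin g y := by
  have := toLin_add (f - g) g y
  rw [sub_add_cancel] at this
  rw [this, add_sub_cancel_right]

@[simp] theorem toLin_zero (y : A.Y) : toLin (0 : A ⟶ B) y = 0 := rfl

@[simp] theorem toLin_neg (f : A ⟶ B) (y : A.Y) : toLin (-f) y = - toLin f y := rfl

theorem toLin_mem (f : A ⟶ B) {y : A.Y} (hy : y ∈ A.X) : toLin f y ∈ B.X := f.2 hy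

theorem hom_ext {f g : A ⟶ B} (h : ∀ y, toLin f y = toLin g y) : f = g :=
  Subtype.ext (LinearMap.ext h)

theorem hom_congr {f g : A ⟶ B} (h : f = g) (y : A.Y) : toLin f y = toLin g y := by rw [h]

@[simp] theorem toLin_sum {ι : Type*} (s : Finset ι) (f : ι → (A ⟶ B)) (y : A.Y) :
    toLin (∑ i ∈ s, f i) y = ∑ i ∈ s, toLin (f i) y := by
  classical
  induction s using Finset.induction_on with
  | empty => simp
  | insert i s hi ih => rw [Finset.sum_insert hi, Finset.sum_insert hi, toLin_add, ih]

theorem isZero_iff : IsZero A ↔ Subsingleton A.Y := by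
  rw [IsZero.iff_id_eq_zero]
  constructor
  · intro h
    exact subsingleton_of_forall_eq 0 fun y => hom_congr h y
  · intro _
    exact hom_ext fun _ => Subsingleton.elim _ _

/-- A linear equivalence which identifies the submodules gives an isomorphism of pairs. -/
noncomputable def isoMk (e : A.Y ≃ₗ[TruncPoly k n] B.Y) (h : ∀ y, e y ∈ B.X ↔ y ∈ A.X) : A ≅ B where
  hom := homMk e.toLinearMap fun y hy => (h y).2 hy
  inv := homMk e.symm.toLinearMap fun y hy => (h _).1 (by
    rw [LinearEquiv.coe_coe, e.apply_symm_apply]; exact hy)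
  hom_inv_id := hom_ext fun y => e.symm_apply_apply y
  inv_hom_id := hom_ext fun y => e.apply_symm_apply y

theorem isIso_of_bijective (f : A ⟶ B) (hf : Function.Bijective (toLin f))
    (h : ∀ y, toLin f y ∈ B.X → y ∈ A.X) : IsIso f :=
  (isoMk (LinearEquiv.ofBijective (toLin f) hf) fun y => ⟨h y, toLin_mem f⟩).isIso_hom

@[simp] theorem toLin_iso_inv_hom (e : A ≅ B) (y : B.Y) : toLin e.hom (toLin e.inv y) = y :=
  hom_congr e.inv_hom_id y

@[simp] theorem toLin_iso_hom_inv (e : A ≅ B) (y : A.Y) : toLin e.inv (toLin e.hom y) = y :=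
  hom_congr e.hom_inv_id y

/-- Exactness of the sequence of submodules in the middle follows from that of the big modules once
`S.f` reflects membership in the submodules. -/
theorem conflations_iff (S : ShortComplex (SubmodPair k n)) :
    conflations k n S ↔ Function.Injective (toLin S.f) ∧
      (∀ y, toLin S.g y = 0 → ∃ z, toLin S.f z = y) ∧ Function.Surjective (toLin S.g) ∧
      (∀ z, toLin S.f z ∈ S.X₂.X → z ∈ S.X₁.X) ∧
      (∀ w ∈ S.X₃.X, ∃ y ∈ S.X₂.X, toLin S.g y = w) := by
  have hz (z : S.X₁.Y) : toLin S.g (toLin S.f z) = 0 := hom_congr S.zero z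
  constructor
  · rintro ⟨⟨h1, h2, h3⟩, h4, h5, h6⟩
    refine ⟨h1, fun y hy => (h2 y).1 hy, h3, fun z h => ?_, fun w hw => ?_⟩
    · obtain ⟨z', hz'⟩ := (h5 ⟨_, h⟩).1 (Subtype.ext (hz z))
      have : z'.1 = z := h1 (congrArg Subtype.val hz')
      rw [← this]; exact z'.2
    · obtain ⟨y, hy⟩ := h6 ⟨w, hw⟩
      exact ⟨y.1, y.2, congrArg Subtype.val hy⟩
  · rintro ⟨h1, h2, h3, h4, h5⟩
    refine ⟨⟨h1, fun y => ⟨h2 y, ?_⟩, h3⟩, fun a b h => Subtype.ext (h1 (congrArg Subtype.val h)),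
      fun y => ⟨fun h => ?_, ?_⟩, fun w => ?_⟩
    · rintro ⟨z, rfl⟩; exact hz z
    · obtain ⟨z, hz⟩ := h2 y.1 (congrArg Subtype.val h)
      exact ⟨⟨z, h4 z (hz ▸ y.2)⟩, Subtype.ext hz⟩
    · rintro ⟨z, rfl⟩; exact Subtype.ext (hz z.1)
    · obtain ⟨y, hy, h⟩ := h5 w.1 w.2
      exact ⟨⟨y, hy⟩, Subtype.ext h⟩

/-- The cokernel is given the image of `B.X` as its submodule; the dual statement below gives the
kernel the preimage of `A.X`. -/
theorem isInflation_iff (f : A ⟶ B) : IsInflation (conflations k n) f ↔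
    Function.Injective (toLin f) ∧ ∀ y, toLin f y ∈ B.X → y ∈ A.X := by
  constructor
  · rintro ⟨Z, p, w, h⟩
    obtain ⟨h1, -, -, h4, -⟩ := (conflations_iff _).1 h
    exact ⟨h1, h4⟩
  · rintro ⟨h1, h2⟩
    let q := (LinearMap.range (toLin f)).mkQ
    let Z : SubmodPair k n := of (B.X.map q)
    refine ⟨Z, homMk q fun y hy => Submodule.mem_map_of_mem hy, hom_ext fun y => ?_, ?_⟩
    · exact (Submodule.Quotient.mk_eq_zero _).2 ⟨y, rfl⟩
    · refine (conflations_iff _).2 ⟨h1, fun y hy => ?_, Submodule.mkQ_surjective _, h2, ?_⟩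
      · exact (Submodule.Quotient.mk_eq_zero _).1 hy
      · rintro _ ⟨y, hy, rfl⟩
        exact ⟨y, hy, rfl⟩

theorem isDeflation_iff (f : A ⟶ B) : IsDeflation (conflations k n) f ↔
    Function.Surjective (toLin f) ∧ ∀ w ∈ B.X, ∃ y ∈ A.X, toLin f y = w := by
  constructor
  · rintro ⟨Z, p, w, h⟩
    obtain ⟨-, -, h3, -, h5⟩ := (conflations_iff _).1 h
    exact ⟨h3, h5⟩
  · rintro ⟨h1, h2⟩
    let Z : SubmodPair k n := of (A.X.comap (LinearMap.ker (toLin f)).subtype)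
    refine ⟨Z, homMk (LinearMap.ker (toLin f)).subtype fun y hy => hy, hom_ext fun y => y.2, ?_⟩
    exact (conflations_iff _).2 ⟨Subtype.val_injective, fun y hy => ⟨⟨y, hy⟩, rfl⟩, h1,
      fun z hz => hz, h2⟩

theorem mono_of_injective (f : A ⟶ B) (hf : Function.Injective (toLin f)) : Mono f :=
  ⟨fun _ _ h => hom_ext fun y => hf (hom_congr h y)⟩

theorem epi_of_surjective (f : A ⟶ B) (hf : Function.Surjective (toLin f)) : Epi f :=
  ⟨fun _ _ h => hom_ext fun y => by
    obtain ⟨z, rfl⟩ := hf y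
    exact hom_congr h z⟩

theorem exists_lift_of_inflation {f : A ⟶ B} (hf : IsInflation (conflations k n) f)
    (h : D ⟶ B) (w : ∀ y, ∃ z, toLin f z = toLin h y) : ∃ l : D ⟶ A, l ≫ f = h := by
  obtain ⟨h1, h2⟩ := (isInflation_iff f).1 hf
  choose l hl using w
  refine ⟨homMk { toFun := l, map_add' := ?_, map_smul' := ?_ } fun y hy => h2 _ ?_,
    hom_ext hl⟩
  · intro a b; apply h1; simp only [map_add, hl]
  · intro c a; apply h1; simp only [map_smul, hl, RingHom.id_apply]
  · change toLin f (l y) ∈ B.X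
    rw [hl]; exact toLin_mem h hy

theorem exists_desc_of_deflation {f : A ⟶ B} (hf : IsDeflation (conflations k n) f)
    (h : A ⟶ D) (w : ∀ y, toLin f y = 0 → toLin h y = 0) : ∃ l : B ⟶ D, f ≫ l = h := by
  obtain ⟨h1, h2⟩ := (isDeflation_iff f).1 hf
  have w' (a b : A.Y) (e : toLin f a = toLin f b) : toLin h a = toLin h b := by
    rw [← sub_eq_zero, ← map_sub]
    exact w _ (by rw [map_sub, e, sub_self])
  choose s hs using h1
  refine ⟨homMk { toFun := fun y => toLin h (s y), map_add' := ?_, map_smul' := ?_ } ?_,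
    hom_ext fun y => w' _ _ (hs _)⟩
  · intro a b; rw [← map_add]; apply w'; simp only [map_add, hs]
  · intro c a; rw [RingHom.id_apply, ← map_smul]; apply w'; simp only [map_smul, hs]
  · intro y hy
    obtain ⟨z, hz, rfl⟩ := h2 y hy
    change toLin h (s _) ∈ D.X
    rw [w' _ _ (hs (toLin f z))]
    exact toLin_mem h hz

theorem conflations_exists_lift {S : ShortComplex (SubmodPair k n)} (hS : conflations k n S)
    (h : D ⟶ S.X₂) (w : h ≫ S.g = 0) : ∃ l : D ⟶ S.X₁, l ≫ S.f = h :=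
  exists_lift_of_inflation ⟨_, _, S.zero, hS⟩ h fun y =>
    ((conflations_iff S).1 hS).2.1 _ (hom_congr w y)

theorem conflations_exists_desc {S : ShortComplex (SubmodPair k n)} (hS : conflations k n S)
    (h : S.X₂ ⟶ D) (w : S.f ≫ h = 0) : ∃ l : S.X₃ ⟶ D, S.g ≫ l = h :=
  exists_desc_of_deflation ⟨_, _, S.zero, hS⟩ h fun y hy => by
    obtain ⟨z, rfl⟩ := ((conflations_iff S).1 hS).2.1 _ hy
    exact hom_congr w z

theorem conflations_of_iso {S T : ShortComplex (SubmodPair k n)} (e : S ≅ T)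
    (hS : conflations k n S) : conflations k n T := by
  obtain ⟨h1, h2, h3, h4, h5⟩ := (conflations_iff S).1 hS
  let e₁ : S.X₁ ≅ T.X₁ := ShortComplex.π₁.mapIso e
  let e₂ : S.X₂ ≅ T.X₂ := ShortComplex.π₂.mapIso e
  let e₃ : S.X₃ ≅ T.X₃ := ShortComplex.π₃.mapIso e
  have cf (z : S.X₁.Y) : toLin T.f (toLin e₁.hom z) = toLin e₂.hom (toLin S.f z) :=
    hom_congr e.hom.comm₁₂ z
  have cf' (z : T.X₁.Y) : toLin S.f (toLin e₁.inv z) = toLin e₂.inv (toLin T.f z) :=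
    hom_congr e.inv.comm₁₂ z
  have cg (z : S.X₂.Y) : toLin T.g (toLin e₂.hom z) = toLin e₃.hom (toLin S.g z) :=
    hom_congr e.hom.comm₂₃ z
  have cg' (z : T.X₂.Y) : toLin S.g (toLin e₂.inv z) = toLin e₃.inv (toLin T.g z) :=
    hom_congr e.inv.comm₂₃ z
  refine (conflations_iff T).2 ⟨fun a b h => ?_, fun y hy => ?_, fun w => ?_, fun z hz => ?_,
    fun w hw => ?_⟩
  · have : toLin S.f (toLin e₁.inv a) = toLin S.f (toLin e₁.inv b) := by rw [cf', cf', h]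
    rw [← toLin_iso_inv_hom e₁ a, h1 this, toLin_iso_inv_hom]
  · obtain ⟨z, hz⟩ := h2 (toLin e₂.inv y) (by rw [cg', hy, map_zero])
    exact ⟨toLin e₁.hom z, by rw [cf, hz, toLin_iso_inv_hom]⟩
  · obtain ⟨y, hy⟩ := h3 (toLin e₃.inv w)
    exact ⟨toLin e₂.hom y, by rw [cg, hy, toLin_iso_inv_hom]⟩
  · have := h4 (toLin e₁.inv z) (by rw [cf']; exact toLin_mem _ hz)
    rw [← toLin_iso_inv_hom e₁ z]
    exact toLin_mem _ this
  · obtain ⟨y, hy, hy'⟩ := h5 (toLin e₃.inv w) (toLin_mem _ hw)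
    exact ⟨toLin e₂.hom y, toLin_mem _ hy, by rw [cg, hy', toLin_iso_inv_hom]⟩

/-- The pushout is that of modules, with the image of `B.X ⊕ X'.X` as submodule. If `(0, y)` is
congruent to some `(b, c)` in `B.X ⊕ X'.X`, then `b = i z`, so `z ∈ A.X`, and `y = c + f z` lies in
`X'.X`; therefore `i'` is again an inflation. -/
theorem exists_pushout {X' : SubmodPair k n} (i : A ⟶ B) (f : A ⟶ X')
    (hi : IsInflation (conflations k n) i) :
    ∃ (Y' : SubmodPair k n) (f' : B ⟶ Y') (i' : X' ⟶ Y'),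
      IsPushout i f f' i' ∧ IsInflation (conflations k n) i' := by
  obtain ⟨h1, h2⟩ := (isInflation_iff i).1 hi
  let N := LinearMap.range ((toLin i).prod (-toLin f))
  let Y' : SubmodPair k n := of ((B.X.prod X'.X).map N.mkQ)
  let f' : B ⟶ Y' := homMk (N.mkQ ∘ₗ LinearMap.inl _ _ _) fun y hy =>
    ⟨(y, 0), ⟨hy, zero_mem _⟩, rfl⟩
  let i' : X' ⟶ Y' := homMk (N.mkQ ∘ₗ LinearMap.inr _ _ _) fun y hy =>
    ⟨(0, y), ⟨zero_mem _, hy⟩, rfl⟩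
  have w : i ≫ f' = f ≫ i' := hom_ext fun y => by
    refine (Submodule.Quotient.eq N).2 ⟨y, ?_⟩
    exact Prod.ext (sub_zero _).symm (zero_sub _).symm
  have hj {W : SubmodPair k n} {a b : Y' ⟶ W} (ha : f' ≫ a = f' ≫ b) (hb : i' ≫ a = i' ≫ b) :
      a = b := hom_ext fun y => by
    obtain ⟨⟨y, z⟩, rfl⟩ := N.mkQ_surjective y
    have : N.mkQ (y, z) = toLin f' y + toLin i' z := by
      change _ = N.mkQ (y, 0) + N.mkQ (0, z)
      rw [← map_add, Prod.mk_add_mk, add_zero, zero_add]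
    rw [this, map_add, map_add]
    exact congrArg₂ _ (hom_congr ha y) (hom_congr hb z)
  have hd {W : SubmodPair k n} (a : B ⟶ W) (b : X' ⟶ W) (h : i ≫ a = f ≫ b) :
      ∃ l : Y' ⟶ W, f' ≫ l = a ∧ i' ≫ l = b := by
    refine ⟨homMk (N.liftQ ((toLin a).coprod (toLin b)) ?_) ?_, hom_ext fun y => ?_,
      hom_ext fun y => ?_⟩
    · rintro _ ⟨y, rfl⟩
      have := hom_congr h y
      rw [toLin_comp, toLin_comp] at this
      simp [this]
    · rintro _ ⟨y, hy, rfl⟩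
      exact add_mem (toLin_mem a hy.1) (toLin_mem b hy.2)
    · change toLin a y + toLin b 0 = _
      rw [map_zero, add_zero]
    · change toLin a 0 + toLin b y = _
      rw [map_zero, zero_add]
  refine ⟨Y', f', i', ⟨⟨w⟩, ⟨PushoutCocone.IsColimit.mk w
    (fun s => (hd s.inl s.inr s.condition).choose)
    (fun s => (hd s.inl s.inr s.condition).choose_spec.1)
    (fun s => (hd s.inl s.inr s.condition).choose_spec.2)
    (fun s m h h' => hj (h.trans (hd s.inl s.inr s.condition).choose_spec.1.symm)
      (h'.trans (hd s.inl s.inr s.condition).choose_spec.2.symm))⟩⟩, ?_⟩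
  refine (isInflation_iff i').2 ⟨?_, fun y hy => ?_⟩
  · rw [injective_iff_map_eq_zero]
    intro y hy
    obtain ⟨z, hz⟩ := (Submodule.Quotient.mk_eq_zero N).1 hy
    have hz1 : toLin i z = 0 := congrArg Prod.fst hz
    have hz2 : -toLin f z = y := congrArg Prod.snd hz
    rw [map_eq_zero_iff _ h1] at hz1
    rw [← hz2, hz1, map_zero, neg_zero]
  · obtain ⟨⟨b, c⟩, ⟨hb, hc⟩, h⟩ := hy
    obtain ⟨z, hz⟩ := (Submodule.Quotient.eq N).1 h
    have hz1 : toLin i z = b - 0 := congrArg Prod.fst hz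
    have hz2 : -toLin f z = c - y := congrArg Prod.snd hz
    rw [sub_zero] at hz1
    have : y = c + toLin f z := by rw [← neg_neg (toLin f z), hz2]; abel
    rw [this]
    exact add_mem hc (toLin_mem f (h2 z (hz1 ▸ hb)))

theorem exists_pullback {Z' : SubmodPair k n} (p : A ⟶ B) (f : Z' ⟶ B)
    (hp : IsDeflation (conflations k n) p) :
    ∃ (Y' : SubmodPair k n) (f' : Y' ⟶ A) (p' : Y' ⟶ Z'),
      IsPullback f' p' p f ∧ IsDeflation (conflations k n) p' := by
  obtain ⟨h1, h2⟩ := (isDeflation_iff p).1 hp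
  let N := LinearMap.ker ((toLin p).coprod (-toLin f))
  have hN (y : A.Y) (z : Z'.Y) : (y, z) ∈ N ↔ toLin p y = toLin f z := by
    rw [LinearMap.mem_ker, LinearMap.coprod_apply, LinearMap.neg_apply, add_neg_eq_zero]
  let Y' : SubmodPair k n := of ((A.X.prod Z'.X).comap N.subtype)
  let f' : Y' ⟶ A := homMk (LinearMap.fst _ _ _ ∘ₗ N.subtype) fun y hy => hy.1
  let p' : Y' ⟶ Z' := homMk (LinearMap.snd _ _ _ ∘ₗ N.subtype) fun y hy => hy.2
  have w : f' ≫ p = p' ≫ f := hom_ext fun y => (hN _ _).1 y.2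
  have hl {W : SubmodPair k n} (a : W ⟶ A) (b : W ⟶ Z') (h : a ≫ p = b ≫ f) :
      ∃ l : W ⟶ Y', l ≫ f' = a ∧ l ≫ p' = b :=
    ⟨homMk (((toLin a).prod (toLin b)).codRestrict N fun y => (hN _ _).2 (hom_congr h y))
      fun y hy => ⟨toLin_mem a hy, toLin_mem b hy⟩, rfl, rfl⟩
  refine ⟨Y', f', p', ⟨⟨w⟩, ⟨PullbackCone.IsLimit.mk w
    (fun s => (hl s.fst s.snd s.condition).choose)
    (fun s => (hl s.fst s.snd s.condition).choose_spec.1)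
    (fun s => (hl s.fst s.snd s.condition).choose_spec.2)
    (fun s m h h' => hom_ext fun y => Subtype.ext (Prod.ext
      (hom_congr (h.trans (hl s.fst s.snd s.condition).choose_spec.1.symm) y)
      (hom_congr (h'.trans (hl s.fst s.snd s.condition).choose_spec.2.symm) y)))⟩⟩, ?_⟩
  refine (isDeflation_iff p').2 ⟨fun z => ?_, fun z hz => ?_⟩
  · obtain ⟨y, hy⟩ := h1 (toLin f z)
    exact ⟨⟨(y, z), (hN _ _).2 hy⟩, rfl⟩
  · obtain ⟨y, hy, hy'⟩ := h2 (toLin f z) (toLin_mem f hz)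
    exact ⟨⟨(y, z), (hN _ _).2 hy'⟩, ⟨hy, hz⟩, rfl⟩

theorem isExactStructure (k : Type u) [Field k] (n : ℕ) :
    IsExactStructure (conflations k n) where
  additive := inferInstance
  isoClosed := ⟨fun e hS => conflations_of_iso e hS⟩
  isKernel S hS := by
    have := mono_of_injective S.f ((conflations_iff S).1 hS).1
    exact ⟨KernelFork.IsLimit.ofι' S.f S.zero fun h w =>
      ⟨(conflations_exists_lift hS h w).choose, (conflations_exists_lift hS h w).choose_spec⟩⟩
  isCokernel S hS := by
    have := epi_of_surjective S.g ((conflations_iff S).1 hS).2.2.1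
    exact ⟨CokernelCofork.IsColimit.ofπ' S.g S.zero fun h w =>
      ⟨(conflations_exists_desc hS h w).choose, (conflations_exists_desc hS h w).choose_spec⟩⟩
  inflation_id X := (isInflation_iff _).2 ⟨fun _ _ h => h, fun _ h => h⟩
  deflation_id X := (isDeflation_iff _).2 ⟨fun y => ⟨y, rfl⟩, fun y h => ⟨y, h, rfl⟩⟩
  inflation_comp i j hi hj := by
    rw [isInflation_iff] at hi hj ⊢
    exact ⟨hj.1.comp hi.1, fun y h => hi.2 _ (hj.2 _ h)⟩
  deflation_comp p q hp hq := by
    rw [isDeflation_iff] at hp hq ⊢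
    refine ⟨hq.1.comp hp.1, fun w hw => ?_⟩
    obtain ⟨z, hz, rfl⟩ := hq.2 w hw
    obtain ⟨y, hy, rfl⟩ := hp.2 z hz
    exact ⟨y, hy, rfl⟩
  pushout i f hi := exists_pushout i f hi
  pullback p f hp := exists_pullback p f hp

/-! ### Finite direct sums of pairs -/

/-- The direct sum of two pairs. -/
noncomputable abbrev prod (A B : SubmodPair k n) : SubmodPair k n := of (A.X.prod B.X)

/-- The direct sum of a finite family of pairs. -/
noncomputable abbrev pi {ι : Type} [Finite ι] (Z : ι → SubmodPair k n) : SubmodPair k n :=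
  of (Submodule.pi Set.univ fun i => (Z i).X)

section Pi

variable {ι : Type} [Finite ι] (Z : ι → SubmodPair k n)

/-- The projection of a direct sum of pairs. -/
noncomputable def piProj (i : ι) : pi Z ⟶ Z i := homMk (LinearMap.proj i) fun _ h => h i trivial

/-- The inclusion of a summand into a direct sum of pairs. -/
noncomputable def piIncl [DecidableEq ι] (i : ι) : Z i ⟶ pi Z :=
  homMk (B := pi Z) (LinearMap.single (TruncPoly k n) (fun i => (Z i).Y) i) fun y h j _ => by
    by_cases hj : j = i
    · subst hj; simpa using h
    · simp [Pi.single_eq_of_ne hj]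

/-- The morphism into a direct sum of pairs. -/
noncomputable def piLift (f : ∀ i, A ⟶ Z i) : A ⟶ pi Z :=
  homMk (LinearMap.pi fun i => toLin (f i)) fun _ h i _ => toLin_mem (f i) h

theorem pi_total [Fintype ι] [DecidableEq ι] : ∑ i, piProj Z i ≫ piIncl Z i = 𝟙 (pi Z) :=
  hom_ext fun y => by
    rw [toLin_sum]
    exact Finset.univ_sum_single (M := fun i => (Z i).Y) y

variable {Z}

theorem pi_isExactProjective {E : ObjectProperty (ShortComplex (SubmodPair k n))}
    (h : ∀ i, IsExactProjective E (Z i)) : IsExactProjective E (pi Z) := by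
  classical
  have := Fintype.ofFinite ι
  intro Y W p hp f
  choose g hg using fun i => h i p hp (piIncl Z i ≫ f)
  refine ⟨∑ i, piProj Z i ≫ g i, ?_⟩
  simp only [Preadditive.sum_comp, Category.assoc, hg]
  simp only [← Category.assoc, ← Preadditive.sum_comp, pi_total, Category.id_comp]

theorem pi_isExactInjective {E : ObjectProperty (ShortComplex (SubmodPair k n))}
    (h : ∀ i, IsExactInjective E (Z i)) : IsExactInjective E (pi Z) := by
  intro Y W j hj f
  choose g hg using fun i => h i j hj (f ≫ piProj Z i)
  exact ⟨piLift Z g, hom_ext fun y => funext fun i => hom_congr (hg i) y⟩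

/-- That the identity of an object lies in the ideal of `K` is the working form of being a direct
summand of a finite sum of objects of `K`; it avoids choosing biproducts. -/
theorem id_pi_mem_objIdeal {K : ObjectProperty (SubmodPair k n)}
    (h : ∀ i, 𝟙 (Z i) ∈ objIdeal K (Z i) (Z i)) : 𝟙 (pi Z) ∈ objIdeal K (pi Z) (pi Z) := by
  classical
  have := Fintype.ofFinite ι
  rw [← pi_total]
  refine sum_mem fun i _ => ?_
  rw [← Category.id_comp (piIncl Z i)]
  exact objIdeal_comp_left K _ (objIdeal_comp_right K _ (h i))

end Pi

section Prod

variable (A B)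

/-- The first projection. -/
noncomputable def prodFst : prod A B ⟶ A := homMk (LinearMap.fst _ _ _) fun _ h => h.1

/-- The second projection. -/
noncomputable def prodSnd : prod A B ⟶ B := homMk (LinearMap.snd _ _ _) fun _ h => h.2

/-- The first inclusion. -/
noncomputable def prodInl : A ⟶ prod A B := homMk (LinearMap.inl _ _ _) fun _ h => ⟨h, zero_mem _⟩

/-- The second inclusion. -/
noncomputable def prodInr : B ⟶ prod A B := homMk (LinearMap.inr _ _ _) fun _ h => ⟨zero_mem _, h⟩

theorem prod_total : prodFst A B ≫ prodInl A B + prodSnd A B ≫ prodInr A B = 𝟙 (prod A B) :=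
  hom_ext fun y => by
    change (y.1, (0 : B.Y)) + ((0 : A.Y), y.2) = y
    simp

variable {A B}

/-- The morphism into a direct sum of two pairs. -/
noncomputable def prodLift (f : D ⟶ A) (g : D ⟶ B) : D ⟶ prod A B :=
  homMk ((toLin f).prod (toLin g)) fun _ h => ⟨toLin_mem f h, toLin_mem g h⟩

theorem prod_isExactProjective {E : ObjectProperty (ShortComplex (SubmodPair k n))}
    (hA : IsExactProjective E A) (hB : IsExactProjective E B) :
    IsExactProjective E (prod A B) := by
  intro Y W p hp f
  obtain ⟨g, hg⟩ := hA p hp (prodInl A B ≫ f)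
  obtain ⟨h, hh⟩ := hB p hp (prodInr A B ≫ f)
  refine ⟨prodFst A B ≫ g + prodSnd A B ≫ h, ?_⟩
  rw [Preadditive.add_comp, Category.assoc, Category.assoc, hg, hh, ← Category.assoc,
    ← Category.assoc, ← Preadditive.add_comp, prod_total, Category.id_comp]

theorem prod_isExactInjective {E : ObjectProperty (ShortComplex (SubmodPair k n))}
    (hA : IsExactInjective E A) (hB : IsExactInjective E B) :
    IsExactInjective E (prod A B) := by
  intro Y W j hj f
  obtain ⟨g, hg⟩ := hA j hj (f ≫ prodFst A B)
  obtain ⟨h, hh⟩ := hB j hj (f ≫ prodSnd A B)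
  exact ⟨prodLift g h, hom_ext fun y => Prod.ext (hom_congr hg y) (hom_congr hh y)⟩

theorem id_prod_mem_objIdeal {K : ObjectProperty (SubmodPair k n)}
    (hA : 𝟙 A ∈ objIdeal K A A) (hB : 𝟙 B ∈ objIdeal K B B) :
    𝟙 (prod A B) ∈ objIdeal K (prod A B) (prod A B) := by
  rw [← prod_total, ← Category.id_comp (prodInl A B), ← Category.id_comp (prodInr A B)]
  exact add_mem (objIdeal_comp_left K _ (objIdeal_comp_right K _ hA))
    (objIdeal_comp_left K _ (objIdeal_comp_right K _ hB))

end Prod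

end SubmodPair

/-! ### Ideals and retracts -/

section Ideals

variable {C : Type*} [Category C] [Preadditive C] {K : ObjectProperty C}

theorem id_mem_objIdeal {X : C} (h : K X) : 𝟙 X ∈ objIdeal K X X :=
  AddSubgroup.subset_closure ⟨X, h, 𝟙 X, 𝟙 X, Category.id_comp _⟩

theorem mem_objIdeal_of_factor {X Y Z : C} (h : 𝟙 Z ∈ objIdeal K Z Z) (f : X ⟶ Z) (g : Z ⟶ Y) :
    f ≫ g ∈ objIdeal K X Y := by
  have := objIdeal_comp_right K g h
  rw [Category.id_comp] at this
  exact objIdeal_comp_left K f this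

theorem id_mem_objIdeal_of_retract {X Z : C} (h : 𝟙 Z ∈ objIdeal K Z Z) (f : X ⟶ Z) (g : Z ⟶ X)
    (w : f ≫ g = 𝟙 X) : 𝟙 X ∈ objIdeal K X X :=
  w ▸ mem_objIdeal_of_factor h f g

theorem objIdeal_mono {K' : ObjectProperty C} (h : ∀ X, K X → K' X) {X Y : C} :
    objIdeal K X Y ≤ objIdeal K' X Y :=
  AddSubgroup.closure_mono fun _ ⟨Z, hZ, g, g', w⟩ => ⟨Z, h Z hZ, g, g', w⟩

theorem isExactProjective_of_retract {E : ObjectProperty (ShortComplex C)} {X Z : C}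
    (h : IsExactProjective E Z) (f : X ⟶ Z) (g : Z ⟶ X) (w : f ≫ g = 𝟙 X) :
    IsExactProjective E X := by
  intro Y W p hp a
  obtain ⟨b, hb⟩ := h p hp (g ≫ a)
  exact ⟨f ≫ b, by rw [Category.assoc, hb, ← Category.assoc, w, Category.id_comp]⟩

theorem isExactInjective_of_retract {E : ObjectProperty (ShortComplex C)} {X Z : C}
    (h : IsExactInjective E Z) (f : X ⟶ Z) (g : Z ⟶ X) (w : f ≫ g = 𝟙 X) :
    IsExactInjective E X := by
  intro Y W j hj a
  obtain ⟨b, hb⟩ := h j hj (a ≫ f)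
  exact ⟨b ≫ g, by rw [← Category.assoc, hb, Category.assoc, w, Category.comp_id]⟩

end Ideals

namespace SubmodPair

open TruncPoly CyclicMod

variable {k : Type u} [Field k] {n : ℕ} {A B D : SubmodPair k n}

/-! ### The pairs `([i], [j])` -/

/-- The generator of `([i], [j])`. -/
noncomputable def pairGen (k : Type u) [Field k] (n i j : ℕ) : (pair k n i j).Y := gen k n j

theorem exists_smul_pairGen {i j : ℕ} (y : (pair k n i j).Y) :
    ∃ c : TruncPoly k n, y = c • pairGen k n i j :=
  exists_smul_gen (j := j) y

theorem smul_pairGen_eq_zero {i j : ℕ} {c : TruncPoly k n} :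
    c • pairGen k n i j = 0 ↔ c ∈ Ideal.span {x k n ^ j} :=
  smul_gen_eq_zero (j := j)

theorem pair_X_eq (i j : ℕ) : (pair k n i j).X =
    Submodule.span (TruncPoly k n) {x k n ^ (j - i) • pairGen k n i j} := by
  have h : x k n ^ (j - i) • pairGen k n i j = CyclicMod.mk k n j (x k n ^ (j - i)) :=
    (mk_eq_smul_gen (j := j) _).symm
  rw [h]
  rfl

theorem mem_pair_X {i j : ℕ} {y : (pair k n i j).Y} :
    y ∈ (pair k n i j).X ↔ ∃ c : TruncPoly k n, y = (c * x k n ^ (j - i)) • pairGen k n i j := by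
  rw [pair_X_eq, Submodule.mem_span_singleton]
  simp only [mul_smul, eq_comm]

theorem mem_pair_X_self {j : ℕ} (y : (pair k n j j).Y) : y ∈ (pair k n j j).X := by
  obtain ⟨c, rfl⟩ := exists_smul_pairGen y
  exact mem_pair_X.2 ⟨c, by rw [Nat.sub_self, pow_zero, mul_one]⟩

theorem mem_pair_X_zero {j : ℕ} {y : (pair k n 0 j).Y} : y ∈ (pair k n 0 j).X ↔ y = 0 := by
  constructor
  · rw [mem_pair_X]
    rintro ⟨c, rfl⟩
    rw [smul_pairGen_eq_zero, Nat.sub_zero]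
    exact Ideal.mul_mem_left _ _ (Ideal.mem_span_singleton_self _)
  · rintro rfl; exact zero_mem _

/-- The morphism out of `([i], [j])` determined by the image of the generator. -/
noncomputable def pairLift {i j : ℕ} (y : A.Y) (h : x k n ^ j • y = 0)
    (h' : x k n ^ (j - i) • y ∈ A.X) : pair k n i j ⟶ A :=
  homMk (CyclicMod.lift y h) fun z hz => by
    obtain ⟨c, rfl⟩ := mem_pair_X.1 hz
    change CyclicMod.lift y h ((c * x k n ^ (j - i)) • gen k n j) ∈ A.X
    rw [map_smul, lift_gen, mul_smul]
    exact A.X.smul_mem c h'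

@[simp]
theorem toLin_pairLift_gen {i j : ℕ} (y : A.Y) (h : x k n ^ j • y = 0)
    (h' : x k n ^ (j - i) • y ∈ A.X) : toLin (pairLift y h h') (pairGen k n i j) = y :=
  lift_gen y h

theorem pair_hom_ext {i j : ℕ} {f g : pair k n i j ⟶ A}
    (h : toLin f (pairGen k n i j) = toLin g (pairGen k n i j)) : f = g :=
  hom_ext fun y => by
    obtain ⟨c, rfl⟩ := exists_smul_pairGen y
    rw [map_smul, map_smul, h]

/-! ### The Frobenius structure -/

/-- Morphisms from `([n],[n])` are elements of `X`, those from `([0],[n])` are elements of `Y`, and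
deflations are surjective on both. -/
theorem pair_top_isExactProjective : IsExactProjective (conflations k n) (pair k n n n) := by
  intro Y Z p hp f
  obtain ⟨y, hy, h⟩ := ((isDeflation_iff p).1 hp).2 _ (toLin_mem f (mem_pair_X_self (pairGen k n n n)))
  exact ⟨pairLift y (x_pow_smul_eq_zero y) (Y.X.smul_mem _ hy), pair_hom_ext (by simp [h])⟩

theorem pair_bot_isExactProjective : IsExactProjective (conflations k n) (pair k n 0 n) := by
  intro Y Z p hp f
  obtain ⟨y, h⟩ := ((isDeflation_iff p).1 hp).1 (toLin f (pairGen k n 0 n))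
  have h0 : x k n ^ (n - 0) • y ∈ Y.X := by
    rw [Nat.sub_zero, x_pow_smul_eq_zero]
    exact zero_mem _
  exact ⟨pairLift y (x_pow_smul_eq_zero y) h0, pair_hom_ext (by simp [h])⟩

/-- Morphisms to `([n],[n])` are maps `Y → [n]`, those to `([0],[n])` are maps `Y/X → [n]`.
Inflations are injective on `Y` and on `Y/X`, and `[n]` is injective. -/
theorem pair_top_isExactInjective : IsExactInjective (conflations k n) (pair k n n n) := by
  intro Y Z i hi f
  obtain ⟨g, hg⟩ := CyclicMod.exists_extension (toLin i) ((isInflation_iff i).1 hi).1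
    (show Y.Y →ₗ[TruncPoly k n] CyclicMod k n n from toLin f)
  exact ⟨homMk (B := pair k n n n) g fun y _ => mem_pair_X_self _,
    hom_ext fun y => LinearMap.congr_fun hg y⟩

theorem pair_bot_isExactInjective : IsExactInjective (conflations k n) (pair k n 0 n) := by
  intro Y Z i hi f
  obtain ⟨h1, h2⟩ := (isInflation_iff i).1 hi
  let i' : (Y.Y ⧸ Y.X) →ₗ[TruncPoly k n] (Z.Y ⧸ Z.X) :=
    Y.X.mapQ Z.X (toLin i) fun y hy => toLin_mem i hy
  have hi' : Function.Injective i' := by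
    rw [injective_iff_map_eq_zero]
    intro y hy
    obtain ⟨y, rfl⟩ := Y.X.mkQ_surjective y
    exact (Submodule.Quotient.mk_eq_zero _).2 (h2 y ((Submodule.Quotient.mk_eq_zero _).1 hy))
  obtain ⟨g, hg⟩ := CyclicMod.exists_extension i' hi'
    (show (Y.Y ⧸ Y.X) →ₗ[TruncPoly k n] CyclicMod k n n from
      Y.X.liftQ (toLin f) fun y hy => mem_pair_X_zero.1 (toLin_mem f hy))
  refine ⟨homMk (B := pair k n 0 n) (g ∘ₗ Z.X.mkQ) fun y hy => ?_,
    hom_ext fun y => LinearMap.congr_fun hg (Y.X.mkQ y)⟩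
  rw [mem_pair_X_zero]
  change g (Z.X.mkQ y) = 0
  rw [Submodule.mkQ_apply, (Submodule.Quotient.mk_eq_zero _).2 hy, map_zero]

/-- The direct sum of `a` copies of `([n], [n])` and `b` copies of `([0], [n])`. -/
noncomputable abbrev freePair (k : Type u) [Field k] (n a b : ℕ) : SubmodPair k n :=
  prod (pi fun _ : Fin a => pair k n n n) (pi fun _ : Fin b => pair k n 0 n)

theorem freePair_isExactProjective (a b : ℕ) :
    IsExactProjective (conflations k n) (freePair k n a b) :=
  prod_isExactProjective (pi_isExactProjective fun _ => pair_top_isExactProjective)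
    (pi_isExactProjective fun _ => pair_bot_isExactProjective)

theorem freePair_isExactInjective (a b : ℕ) :
    IsExactInjective (conflations k n) (freePair k n a b) :=
  prod_isExactInjective (pi_isExactInjective fun _ => pair_top_isExactInjective)
    (pi_isExactInjective fun _ => pair_bot_isExactInjective)

theorem id_freePair_mem (a b : ℕ) :
    𝟙 (freePair k n a b) ∈ objIdeal (projInj k n) (freePair k n a b) (freePair k n a b) :=
  id_prod_mem_objIdeal (id_pi_mem_objIdeal fun _ => id_mem_objIdeal (Or.inr rfl))
    (id_pi_mem_objIdeal fun _ => id_mem_objIdeal (Or.inl rfl))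

/-- Copies of `([n],[n])` cover `X`, copies of `([0],[n])` cover `Y`. -/
theorem exists_deflation_freePair (A : SubmodPair k n) :
    ∃ (a b : ℕ) (p : freePair k n a b ⟶ A), IsDeflation (conflations k n) p := by
  obtain ⟨a, p, hp⟩ := exists_surjection_pi (k := k) (n := n) A.X
  obtain ⟨b, q, hq⟩ := exists_surjection_pi (k := k) (n := n) A.Y
  let p' : (pi fun _ : Fin a => pair k n n n).Y →ₗ[TruncPoly k n] A.Y := A.X.subtype ∘ₗ p
  let q' : (pi fun _ : Fin b => pair k n 0 n).Y →ₗ[TruncPoly k n] A.Y := q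
  refine ⟨a, b, homMk (A := freePair k n a b) (p'.coprod q') ?_, (isDeflation_iff _).2 ⟨?_, ?_⟩⟩
  · rintro ⟨y, z⟩ ⟨-, hz⟩
    have : z = 0 := funext fun i => mem_pair_X_zero.1 (hz i trivial)
    rw [LinearMap.coprod_apply, this, map_zero, add_zero]
    exact (p y).2
  · intro y
    obtain ⟨z, rfl⟩ := hq y
    refine ⟨(0, z), ?_⟩
    rw [toLin_homMk, LinearMap.coprod_apply, map_zero, zero_add]
    rfl
  · intro w hw
    obtain ⟨z, hz⟩ := hp ⟨w, hw⟩
    refine ⟨(z, 0), ⟨fun i _ => mem_pair_X_self _, zero_mem _⟩, ?_⟩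
    rw [toLin_homMk, LinearMap.coprod_apply, map_zero, add_zero]
    exact congrArg Subtype.val hz

/-- `Y` is embedded by means of `([n],[n])`; an embedding of `Y/X` by means of `([0],[n])` makes the
map reflect the submodule. -/
theorem exists_inflation_freePair (A : SubmodPair k n) :
    ∃ (a b : ℕ) (i : A ⟶ freePair k n a b), IsInflation (conflations k n) i := by
  obtain ⟨a, i, hi⟩ := exists_embedding_pi (k := k) (n := n) A.Y
  obtain ⟨b, j, hj⟩ := exists_embedding_pi (k := k) (n := n) (A.Y ⧸ A.X)
  let i' : A.Y →ₗ[TruncPoly k n] (pi fun _ : Fin a => pair k n n n).Y := i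
  let j' : A.Y →ₗ[TruncPoly k n] (pi fun _ : Fin b => pair k n 0 n).Y := j ∘ₗ A.X.mkQ
  have hj' (y : A.Y) : j' y = 0 ↔ y ∈ A.X :=
    (map_eq_zero_iff j hj).trans (Submodule.Quotient.mk_eq_zero _)
  refine ⟨a, b, homMk (B := freePair k n a b) (i'.prod j') ?_,
    (isInflation_iff _).2 ⟨fun y z h => hi (congrArg Prod.fst h), fun y hy => ?_⟩⟩
  · intro y hy
    refine ⟨fun l _ => mem_pair_X_self _, fun l _ => ?_⟩
    exact mem_pair_X_zero.2 (congrFun ((hj' y).2 hy) l)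
  · exact (hj' y).1 (funext fun l => mem_pair_X_zero.1 (hy.2 l trivial))

theorem exists_retract_of_isExactProjective (hA : IsExactProjective (conflations k n) A) :
    ∃ (a b : ℕ) (f : A ⟶ freePair k n a b) (g : freePair k n a b ⟶ A), f ≫ g = 𝟙 A := by
  obtain ⟨a, b, p, hp⟩ := exists_deflation_freePair A
  obtain ⟨f, hf⟩ := hA p hp (𝟙 A)
  exact ⟨a, b, f, p, hf⟩

theorem exists_retract_of_isExactInjective (hA : IsExactInjective (conflations k n) A) :
    ∃ (a b : ℕ) (f : A ⟶ freePair k n a b) (g : freePair k n a b ⟶ A), f ≫ g = 𝟙 A := by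
  obtain ⟨a, b, i, hi⟩ := exists_inflation_freePair A
  obtain ⟨g, hg⟩ := hA i hi (𝟙 A)
  exact ⟨a, b, i, g, hg⟩

theorem isFrobeniusStructure (k : Type u) [Field k] (n : ℕ) :
    IsFrobeniusStructure (conflations k n) where
  exact := isExactStructure k n
  enoughProjectives A := by
    obtain ⟨a, b, p, hp⟩ := exists_deflation_freePair A
    exact ⟨_, p, freePair_isExactProjective a b, hp⟩
  enoughInjectives A := by
    obtain ⟨a, b, i, hi⟩ := exists_inflation_freePair A
    exact ⟨_, i, freePair_isExactInjective a b, hi⟩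
  projective_iff_injective A := by
    constructor
    · intro h
      obtain ⟨a, b, f, g, w⟩ := exists_retract_of_isExactProjective h
      exact isExactInjective_of_retract (freePair_isExactInjective a b) f g w
    · intro h
      obtain ⟨a, b, f, g, w⟩ := exists_retract_of_isExactInjective h
      exact isExactProjective_of_retract (freePair_isExactProjective a b) f g w

theorem id_mem_of_isExactProjective (hA : IsExactProjective (conflations k n) A) :
    𝟙 A ∈ objIdeal (projInj k n) A A := by
  obtain ⟨a, b, f, g, w⟩ := exists_retract_of_isExactProjective hA
  exact id_mem_objIdeal_of_retract (id_freePair_mem a b) f g w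

theorem projInj_isExactProjective (h : projInj k n A) : IsExactProjective (conflations k n) A := by
  rcases h with rfl | rfl
  exacts [pair_bot_isExactProjective, pair_top_isExactProjective]

theorem projInj_isExactInjective (h : projInj k n A) : IsExactInjective (conflations k n) A := by
  rcases h with rfl | rfl
  exacts [pair_bot_isExactInjective, pair_top_isExactInjective]

/-- Morphisms in the ideal of the projective-injective objects extend along inflations. -/
theorem exists_extension_of_mem {f : A ⟶ D} (hf : f ∈ objIdeal (projInj k n) A D) {i : A ⟶ B}
    (hi : IsInflation (conflations k n) i) : ∃ g : B ⟶ D, i ≫ g = f := by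
  induction hf using AddSubgroup.closure_induction with
  | mem f hf =>
    obtain ⟨Z, hZ, a, b, rfl⟩ := hf
    obtain ⟨c, rfl⟩ := projInj_isExactInjective hZ i hi a
    exact ⟨c ≫ b, by simp⟩
  | zero => exact ⟨0, comp_zero⟩
  | add a b _ _ ha hb =>
    obtain ⟨c, rfl⟩ := ha
    obtain ⟨d, rfl⟩ := hb
    exact ⟨c + d, by simp⟩
  | neg a _ ha =>
    obtain ⟨c, rfl⟩ := ha
    exact ⟨-c, by simp⟩

/-- A pair with zero submodule is a direct sum of pairs `([0], [j])`. -/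
theorem id_mem_of_X_eq_bot {K : ObjectProperty (SubmodPair k n)}
    (hK : ∀ j ≤ n, K (pair k n 0 j)) (hA : A.X = ⊥) : 𝟙 A ∈ objIdeal K A A := by
  obtain ⟨d, e, he, ⟨φ⟩⟩ := exists_equiv_pi_cyclicMod (k := k) (n := n) A.Y
  let e' : A ≅ pi fun l => pair k n 0 (e l) := isoMk φ fun y => by
    rw [hA, Submodule.mem_bot, ← φ.map_eq_zero_iff]
    exact ⟨fun h => funext fun l => mem_pair_X_zero.1 (h l trivial),
      fun h l _ => mem_pair_X_zero.2 (congrFun h l)⟩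
  exact id_mem_objIdeal_of_retract (id_pi_mem_objIdeal fun l => id_mem_objIdeal (hK _ (he l)))
    e'.hom e'.inv e'.hom_inv_id

/-- A pair with `X = Y` is a direct sum of pairs `([j], [j])`. -/
theorem id_mem_of_X_eq_top {K : ObjectProperty (SubmodPair k n)}
    (hK : ∀ j ≤ n, K (pair k n j j)) (hA : A.X = ⊤) : 𝟙 A ∈ objIdeal K A A := by
  obtain ⟨d, e, he, ⟨φ⟩⟩ := exists_equiv_pi_cyclicMod (k := k) (n := n) A.Y
  let e' : A ≅ pi fun l => pair k n (e l) (e l) := isoMk φ fun y => by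
    rw [hA]
    exact ⟨fun _ => trivial, fun _ l _ => mem_pair_X_self _⟩
  exact id_mem_objIdeal_of_retract (id_pi_mem_objIdeal fun l => id_mem_objIdeal (hK _ (he l)))
    e'.hom e'.inv e'.hom_inv_id

/-- A pair `(X, Y)` with `Y` free is a direct sum of pairs `([i], [n])`. -/
theorem id_mem_of_free {K : ObjectProperty (SubmodPair k n)} (hK : ∀ i ≤ n, K (pair k n i n))
    {d : ℕ} (W : Submodule (TruncPoly k n) (Fin d → CyclicMod k n n)) :
    𝟙 (of W) ∈ objIdeal K (of W) (of W) := by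
  obtain ⟨r, e, he, ⟨φ⟩⟩ := exists_equiv_pi_cyclicMod (k := k) (n := n) W
  let E : SubmodPair k n := pi fun l => pair k n (e l) n
  let ι : W →ₗ[TruncPoly k n] (Fin r → CyclicMod k n n) :=
    LinearMap.pi (fun l => toTop k n (e l) ∘ₗ LinearMap.proj l) ∘ₗ φ.toLinearMap
  have hι : Function.Injective ι := fun a b h =>
    φ.injective (funext fun l => toTop_injective (he l) (congrFun h l))
  have hE (w : W) : ι w ∈ E.X := fun l _ => by
    obtain ⟨c, hc⟩ := exists_smul_gen (φ w l)
    refine mem_pair_X.2 ⟨c, ?_⟩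
    change toTop k n (e l) (φ w l) = _
    rw [hc, map_smul, toTop_gen, smul_smul]
    rfl
  have hE' (y : Fin r → CyclicMod k n n) (hy : y ∈ E.X) : ∃ w : W, ι w = y := by
    choose c hc using fun l => mem_pair_X.1 (hy l trivial)
    refine ⟨φ.symm fun l => c l • gen k n (e l), funext fun l => ?_⟩
    change toTop k n (e l) (φ (φ.symm _) l) = _
    rw [φ.apply_symm_apply, map_smul, toTop_gen, smul_smul]
    exact (hc l).symm
  -- `W` is the submodule part both of `of W` and of `E`. Self-injectivity extends its
  -- identification to maps `u` and `v` of the big modules. These need not be mutually inverse, but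
  -- `u v` is the identity on `W`.
  obtain ⟨u, hu⟩ := exists_extension_pi ι hι W.subtype
  obtain ⟨v, hv⟩ := exists_extension_pi W.subtype W.injective_subtype ι
  let u' : E ⟶ of W := homMk (A := E) u fun y hy => by
    obtain ⟨w, rfl⟩ := hE' y hy
    have : u (ι w) = w := LinearMap.congr_fun hu w
    exact Set.mem_of_eq_of_mem this w.2
  let v' : of W ⟶ E := homMk (B := E) v fun y hy => by
    have : v y = ι ⟨y, hy⟩ := LinearMap.congr_fun hv ⟨y, hy⟩
    exact Set.mem_of_eq_of_mem this (hE _)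
  have huv (y : Fin d → CyclicMod k n n) (hy : y ∈ W) : u (v y) = y := by
    have h1 : v y = ι ⟨y, hy⟩ := LinearMap.congr_fun hv ⟨y, hy⟩
    have h2 : u (ι ⟨y, hy⟩) = y := LinearMap.congr_fun hu ⟨y, hy⟩
    rw [h1, h2]
  -- The difference `1 - u v` vanishes on `W`, so it factors through a sum of copies of `([0],[n])`.
  let F : SubmodPair k n := pi fun _ : Fin d => pair k n 0 n
  let p : of W ⟶ F := homMk (B := F) (LinearMap.id - u ∘ₗ v) fun y hy => by
    have : y - u (v y) = 0 := by rw [huv y hy, sub_self]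
    exact Set.mem_of_eq_of_mem this (zero_mem F.X)
  let q : F ⟶ of W := homMk (A := F) LinearMap.id fun y hy => by
    have : y = 0 := funext fun l => mem_pair_X_zero.1 (hy l trivial)
    rw [this]; exact zero_mem _
  have htot : 𝟙 (of W) = p ≫ q + v' ≫ u' := hom_ext fun y => by
    change y = (y - u (v y)) + u (v y)
    rw [sub_add_cancel]
  have h1 : p ≫ q ∈ objIdeal K (of W) (of W) := mem_objIdeal_of_factor
    (id_pi_mem_objIdeal fun _ => id_mem_objIdeal (hK 0 (Nat.zero_le n))) p q
  have h2 : v' ≫ u' ∈ objIdeal K (of W) (of W) := mem_objIdeal_of_factor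
    (id_pi_mem_objIdeal fun l => id_mem_objIdeal (hK _ (he l))) v' u'
  rw [htot]
  exact add_mem h1 h2

end SubmodPair

/-! ### Objects with local endomorphism ring -/

/-- The endomorphism ring of `A` is local or zero: one of `f` and `1 - f` is invertible. -/
def HasLocalEnd {C : Type*} [Category C] [Preadditive C] (A : C) : Prop :=
  ∀ f : A ⟶ A, IsIso f ∨ IsIso (𝟙 A - f)

section LocalEnd

variable {C : Type*} [Category C] [Preadditive C] {A Z : C}

theorem isIso_one_sub_of_isNilpotent {f : A ⟶ A} (hf : IsNilpotent (End.of f)) :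
    IsIso (𝟙 A - f) :=
  (isUnit_iff_isIso (𝟙 A - f)).1 hf.isUnit_one_sub

/-- If a sum of two endomorphisms is invertible, one of the summands is, by locality. So an
invertible element of the ideal has an invertible summand that factors through a single object of
`K`. -/
theorem HasLocalEnd.exists_factor {K : ObjectProperty C} (hA : HasLocalEnd A) (h0 : ¬ IsZero A)
    {f : A ⟶ A} (hf : f ∈ objIdeal K A A) (h : IsIso f) :
    ∃ (Z : C) (_ : K Z) (a : A ⟶ Z) (b : Z ⟶ A), IsIso (a ≫ b) := by
  induction hf using AddSubgroup.closure_induction with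
  | mem f hf =>
    obtain ⟨Z, hZ, a, b, rfl⟩ := hf
    exact ⟨Z, hZ, a, b, h⟩
  | zero =>
    refine absurd ((IsZero.iff_id_eq_zero A).2 ?_) h0
    rw [← IsIso.hom_inv_id (0 : A ⟶ A), zero_comp]
  | add a b _ _ ha hb =>
    rcases hA (inv (a + b) ≫ a) with h' | h'
    · have := IsIso.of_isIso_comp_left (inv (a + b)) a
      exact ha this
    · have e : 𝟙 A - inv (a + b) ≫ a = inv (a + b) ≫ b := by
        rw [sub_eq_iff_eq_add, ← Preadditive.comp_add, add_comm b a, IsIso.inv_hom_id]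
      rw [e] at h'
      have := IsIso.of_isIso_comp_left (inv (a + b)) b
      exact hb this
  | neg a _ ha =>
    refine ha ⟨-inv (-a), ?_, ?_⟩
    · rw [Preadditive.comp_neg, ← Preadditive.neg_comp, IsIso.hom_inv_id]
    · rw [Preadditive.neg_comp, ← Preadditive.comp_neg, IsIso.inv_hom_id]

/-- Once `a ≫ c = 𝟙`, the endomorphism `e = c ≫ a` of `Z` is idempotent. If `e` is invertible it is
the identity; if `1 - e` is invertible then `e = 0`, which forces `A = 0`. -/
theorem HasLocalEnd.nonempty_iso (hZ : HasLocalEnd Z) (h0 : ¬ IsZero A) (a : A ⟶ Z) (b : Z ⟶ A)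
    (h : IsIso (a ≫ b)) : Nonempty (A ≅ Z) := by
  obtain ⟨c, hac⟩ : ∃ c : Z ⟶ A, a ≫ c = 𝟙 A :=
    ⟨b ≫ inv (a ≫ b), by rw [← Category.assoc, IsIso.hom_inv_id]⟩
  rcases hZ (c ≫ a) with h' | h'
  · refine ⟨⟨a, c, hac, ?_⟩⟩
    rw [← cancel_epi (c ≫ a), Category.assoc, ← Category.assoc a c a, hac, Category.id_comp,
      Category.comp_id]
  · refine absurd ((IsZero.iff_id_eq_zero A).2 ?_) h0
    have : c ≫ a = 0 := by
      rw [← cancel_mono (𝟙 Z - c ≫ a), zero_comp, Preadditive.comp_sub, Category.comp_id,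
        Category.assoc, ← Category.assoc a c a, hac, Category.id_comp, sub_self]
    rw [← hac, ← Category.comp_id (a ≫ c), ← hac, Category.assoc, ← Category.assoc c, this,
      zero_comp, comp_zero]

theorem HasLocalEnd.indecomposable [HasBinaryBiproducts C] (hA : HasLocalEnd A)
    (h0 : ¬ IsZero A) : Indecomposable A := by
  refine ⟨h0, fun Y Z e => ?_⟩
  have key (W : C) (i : W ⟶ A) (p : A ⟶ W) (hi : i ≫ p = 𝟙 W) (f : A ⟶ A) (hf : IsIso f)
      (h : i ≫ f = 0) : IsZero W := by
    rw [IsZero.iff_id_eq_zero, ← hi]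
    have : i = 0 := by rw [← cancel_mono f, h, zero_comp]
    rw [this, zero_comp]
  rcases hA (e.hom ≫ biprod.fst ≫ biprod.inl ≫ e.inv) with h | h
  · exact Or.inr (key Z (biprod.inr ≫ e.inv) (e.hom ≫ biprod.snd) (by simp) _ h (by simp))
  · exact Or.inl (key Y (biprod.inl ≫ e.inv) (e.hom ≫ biprod.fst) (by simp) _ h (by simp))

theorem indecomposable_of_iso [HasBinaryBiproducts C] (e : A ≅ Z) (h : Indecomposable Z) :
    Indecomposable A :=
  ⟨fun hA => h.1 (hA.of_iso e.symm), fun Y W e' => h.2 Y W (e.symm ≪≫ e')⟩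

theorem HasLocalEnd.map {D : Type*} [Category D] [Preadditive D] (F : C ⥤ D) [F.Full]
    [F.Additive] (hA : HasLocalEnd A) : HasLocalEnd (F.obj A) := by
  intro f
  obtain ⟨f, rfl⟩ := F.map_surjective f
  rw [← F.map_id, ← F.map_sub]
  rcases hA f with h | h
  · exact Or.inl inferInstance
  · exact Or.inr inferInstance

end LocalEnd

namespace SubmodPair

open TruncPoly CyclicMod

variable {k : Type u} [Field k] {n : ℕ} {A B D : SubmodPair k n}

theorem toLin_pow (f : End A) (m : ℕ) : toLin (f ^ m : A ⟶ A) = toLin (f : A ⟶ A) ^ m := by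
  induction m with
  | zero => rfl
  | succ m ih =>
    rw [pow_succ, pow_succ, ← ih]
    rfl

/-- Fitting's lemma for `𝒮(n)`. -/
theorem hasLocalEnd_of_indecomposable (hA : Indecomposable A) : HasLocalEnd A := by
  intro f
  let φ := toLin f
  let ψ := φ.restrict (p := A.X) (q := A.X) fun y hy => toLin_mem f hy
  -- One exponent is chosen for `φ` on `Y` and for its restriction `ψ` to `X`, so that the Fitting
  -- decomposition of `Y` restricts to that of `X` and splits the pair.
  obtain ⟨N, ⟨hN, hN'⟩, h0⟩ := ((φ.eventually_isCompl_ker_pow_range_pow.and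
    ψ.eventually_isCompl_ker_pow_range_pow).and (Filter.eventually_ne_atTop 0)).exists
  set K := LinearMap.ker (φ ^ N)
  set R := LinearMap.range (φ ^ N)
  have hψ (y : A.X) : ((ψ ^ N) y : A.Y) = (φ ^ N) y := by
    have := Module.End.pow_restrict (p := A.X) (f' := φ) N (fun y hy => toLin_mem f hy)
    exact congrArg Subtype.val (LinearMap.congr_fun this y)
  have hdec {y : A.Y} (hy : y ∈ A.X) : ∃ a ∈ A.X, a ∈ K ∧ ∃ b ∈ A.X, b ∈ R ∧ a + b = y := by
    have : (⟨y, hy⟩ : A.X) ∈ LinearMap.ker (ψ ^ N) ⊔ LinearMap.range (ψ ^ N) := by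
      rw [hN'.sup_eq_top]; trivial
    obtain ⟨a, ha, b, hb, hab⟩ := Submodule.mem_sup.1 this
    obtain ⟨c, rfl⟩ := hb
    refine ⟨a, a.2, ?_, _, ((ψ ^ N) c).2, ⟨c, (hψ c).symm⟩, congrArg Subtype.val hab⟩
    rw [LinearMap.mem_ker, ← hψ, LinearMap.mem_ker.1 ha]
    rfl
  let π₁ := K.projectionOnto R hN
  let π₂ := R.projectionOnto K hN.symm
  have hπ₁ {a b : A.Y} (ha : a ∈ K) (hb : b ∈ R) : (π₁ (a + b) : A.Y) = a := by
    have h1 : π₁ a = ⟨a, ha⟩ := Submodule.projectionOnto_apply_left hN ⟨a, ha⟩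
    have h2 : π₁ b = 0 := Submodule.projectionOnto_apply_right hN ⟨b, hb⟩
    rw [map_add, h1, h2, add_zero]
  have hπ₂ {a b : A.Y} (ha : a ∈ K) (hb : b ∈ R) : (π₂ (a + b) : A.Y) = b := by
    have h1 : π₂ b = ⟨b, hb⟩ := Submodule.projectionOnto_apply_left hN.symm ⟨b, hb⟩
    have h2 : π₂ a = 0 := Submodule.projectionOnto_apply_right hN.symm ⟨a, ha⟩
    rw [map_add, h1, h2, zero_add]
  let A₁ : SubmodPair k n := of (A.X.comap K.subtype)
  let A₂ : SubmodPair k n := of (A.X.comap R.subtype)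
  let p₁ : A ⟶ A₁ := homMk (B := A₁) π₁ fun y hy => by
    obtain ⟨a, ha, ha', b, hb, hb', rfl⟩ := hdec hy
    exact Set.mem_of_eq_of_mem (s := A.X) (hπ₁ ha' hb') ha
  let p₂ : A ⟶ A₂ := homMk (B := A₂) π₂ fun y hy => by
    obtain ⟨a, ha, ha', b, hb, hb', rfl⟩ := hdec hy
    exact Set.mem_of_eq_of_mem (s := A.X) (hπ₂ ha' hb') hb
  let b : BinaryBicone A₁ A₂ :=
    { pt := A
      fst := p₁
      snd := p₂
      inl := homMk (A := A₁) K.subtype fun _ h => h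
      inr := homMk (A := A₂) R.subtype fun _ h => h
      inl_fst := hom_ext fun y => Submodule.projectionOnto_apply_left hN y
      inl_snd := hom_ext fun y => Submodule.projectionOnto_apply_right hN.symm y
      inr_fst := hom_ext fun y => Submodule.projectionOnto_apply_right hN y
      inr_snd := hom_ext fun y => Submodule.projectionOnto_apply_left hN.symm y }
  have hb : b.fst ≫ b.inl + b.snd ≫ b.inr = 𝟙 b.pt := hom_ext fun y => by
    change (π₁ y : A.Y) + (π₂ y : A.Y) = y
    have : y ∈ K ⊔ R := by rw [hN.sup_eq_top]; trivial
    obtain ⟨c, hc, d, hd, rfl⟩ := Submodule.mem_sup.1 this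
    rw [hπ₁ hc hd, hπ₂ hc hd]
  rcases hA.2 _ _ (biprod.uniqueUpToIso _ _ (isBinaryBilimitOfTotal b hb)) with h | h
  · left
    have hK : K = ⊥ := (Submodule.subsingleton_iff_eq_bot).1 (isZero_iff.1 h)
    have hR : R = ⊤ := by rw [← hN.sup_eq_top, hK, bot_sup_eq]
    have : IsIso (End.of f ^ N : A ⟶ A) := by
      refine isIso_of_bijective _ ?_ fun y hy => ?_
      · rw [toLin_pow]
        exact ⟨LinearMap.ker_eq_bot.1 hK, LinearMap.range_eq_top.1 hR⟩
      · rw [toLin_pow] at hy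
        obtain ⟨a, ha, ha', c, hc, hc', h⟩ := hdec hy
        rw [hK, Submodule.mem_bot] at ha'
        -- As `K = 0`, the map `ψ ^ N` is injective, hence by its own Fitting decomposition
        -- surjective onto `X`. With injectivity of `φ ^ N` this shows that `X` is the full preimage
        -- of `X` under `φ ^ N`.
        have h1 : LinearMap.ker (ψ ^ N) = ⊥ := by
          rw [eq_bot_iff]
          intro z hz
          have : (z : A.Y) ∈ K := by
            rw [LinearMap.mem_ker, ← hψ, LinearMap.mem_ker.1 hz]; rfl
          rw [hK, Submodule.mem_bot] at this
          exact (Submodule.mem_bot _).2 (Subtype.ext this)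
        have h2 : (⟨_, hy⟩ : A.X) ∈ LinearMap.range (ψ ^ N) := by
          rw [← bot_sup_eq (LinearMap.range (ψ ^ N)), ← h1, hN'.sup_eq_top]
          trivial
        obtain ⟨z, hz⟩ := h2
        have h3 : (φ ^ N) z = (φ ^ N) y := by
          rw [← hψ, hz]
        rw [← LinearMap.ker_eq_bot.1 hK h3]
        exact z.2
    have : IsUnit (End.of f ^ N) := (isUnit_iff_isIso _).2 this
    exact (isUnit_iff_isIso _).1 ((isUnit_pow_iff h0).1 this)
  · right
    have hR : R = ⊥ := (Submodule.subsingleton_iff_eq_bot).1 (isZero_iff.1 h)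
    refine isIso_one_sub_of_isNilpotent ⟨N, ?_⟩
    refine hom_ext (f := (End.of f ^ N : A ⟶ A)) (g := 0) fun y => ?_
    rw [toLin_pow]
    have : (φ ^ N) y ∈ R := ⟨y, rfl⟩
    rw [hR] at this
    exact this

/-- Modulo the nilpotent element `x` only the constant term matters. -/
theorem isUnit_or_isUnit_one_sub (c : TruncPoly k n) : IsUnit c ∨ IsUnit (1 - c) := by
  obtain ⟨p, rfl⟩ := TruncPoly.mk_surjective c
  have hnil : IsNilpotent (Ideal.Quotient.mk (Ideal.span {(Polynomial.X : Polynomial k) ^ n})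
      (p.divX * Polynomial.X)) := by
    refine ⟨n, ?_⟩
    rw [← map_pow, mul_pow, Ideal.Quotient.eq_zero_iff_mem]
    exact Ideal.mul_mem_left _ _ (Ideal.mem_span_singleton_self _)
  rw [← p.divX_mul_X_add, map_add]
  by_cases h : p.coeff 0 = 0
  · right
    rw [h, map_zero, map_zero, add_zero]
    exact hnil.isUnit_one_sub
  · left
    rw [add_comm]
    refine hnil.isUnit_add_left_of_commute ?_ (Commute.all _ _)
    exact ((Polynomial.isUnit_C.2 (isUnit_iff_ne_zero.2 h)).map _)

theorem isIso_of_pairGen {i j : ℕ} {f : pair k n i j ⟶ pair k n i j} {c : TruncPoly k n}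
    (hc : IsUnit c) (h : toLin f (pairGen k n i j) = c • pairGen k n i j) : IsIso f := by
  obtain ⟨u, rfl⟩ := hc
  have h1 : x k n ^ j • ((u⁻¹ : (TruncPoly k n)ˣ) : TruncPoly k n) • pairGen k n i j = 0 := by
    rw [smul_smul, smul_pairGen_eq_zero]
    exact Ideal.mul_mem_right _ _ (Ideal.mem_span_singleton_self _)
  have h2 : x k n ^ (j - i) • ((u⁻¹ : (TruncPoly k n)ˣ) : TruncPoly k n) • pairGen k n i j
      ∈ (pair k n i j).X := by
    rw [smul_smul, mul_comm]
    exact mem_pair_X.2 ⟨_, rfl⟩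
  refine ⟨pairLift _ h1 h2, pair_hom_ext ?_, pair_hom_ext ?_⟩
  · rw [toLin_comp, h, map_smul, toLin_pairLift_gen, smul_smul, Units.mul_inv]
    exact one_smul _ _
  · rw [toLin_comp, toLin_pairLift_gen, map_smul, h, smul_smul, Units.inv_mul]
    exact one_smul _ _

theorem hasLocalEnd_pair (i j : ℕ) : HasLocalEnd (pair k n i j) := by
  intro f
  obtain ⟨c, hc⟩ := exists_smul_pairGen (toLin f (pairGen k n i j))
  rcases isUnit_or_isUnit_one_sub c with h | h
  · exact Or.inl (isIso_of_pairGen h hc)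
  · refine Or.inr (isIso_of_pairGen h ?_)
    rw [toLin_sub, toLin_id, hc, sub_smul (1 : TruncPoly k n), one_smul (TruncPoly k n)]

theorem le_of_x_pow_mem {i j : ℕ} (hj : j ≤ n) (h : x k n ^ i ∈ Ideal.span {x k n ^ j}) :
    j ≤ i := by
  rw [← mk_X_pow i, mk_mem_span_x_pow hj] at h
  exact (pow_dvd_pow_iff Polynomial.X_ne_zero Polynomial.not_isUnit_X).1 h

theorem pair_not_isZero {i j : ℕ} (h1 : 1 ≤ j) (hj : j ≤ n) : ¬ IsZero (pair k n i j) := by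
  intro h
  have := isZero_iff.1 h
  have h0 : x k n ^ 0 • pairGen k n i j = 0 := Subsingleton.elim _ _
  have := le_of_x_pow_mem hj (smul_pairGen_eq_zero.1 h0)
  omega

/-- Annihilators are compared: `x ^ j` kills `[j]` and `x ^ i` kills the submodule `[i]`. -/
theorem le_of_pair_iso {i j i' j' : ℕ} (hij : i ≤ j) (hij' : i' ≤ j')
    (hj' : j' ≤ n) (e : pair k n i j ≅ pair k n i' j') : j' ≤ j ∧ i' ≤ i := by
  constructor
  · have h (y : (pair k n i j).Y) : x k n ^ j • y = 0 := x_pow_smul_self (j := j) y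
    have := h (toLin e.inv (pairGen k n i' j'))
    rw [← map_smul] at this
    have := congrArg (toLin e.hom) this
    rw [toLin_iso_inv_hom, map_zero, smul_pairGen_eq_zero] at this
    exact le_of_x_pow_mem hj' this
  · have h (y : (pair k n i j).Y) (hy : y ∈ (pair k n i j).X) : x k n ^ i • y = 0 := by
      obtain ⟨c, rfl⟩ := mem_pair_X.1 hy
      rw [smul_smul, mul_left_comm, ← pow_add, Nat.add_sub_cancel' hij, smul_pairGen_eq_zero]
      exact Ideal.mul_mem_left _ _ (Ideal.mem_span_singleton_self _)
    have hX : x k n ^ (j' - i') • pairGen k n i' j' ∈ (pair k n i' j').X :=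
      mem_pair_X.2 ⟨1, by rw [one_mul]⟩
    have := congrArg (toLin e.hom) (h _ (toLin_mem e.inv hX))
    rw [map_smul, toLin_iso_inv_hom, map_zero, smul_smul, ← pow_add, smul_pairGen_eq_zero] at this
    have := le_of_x_pow_mem hj' this
    omega

theorem eq_of_pair_iso {i j i' j' : ℕ} (hij : i ≤ j) (hj : j ≤ n) (hij' : i' ≤ j')
    (hj' : j' ≤ n) (e : pair k n i j ≅ pair k n i' j') : i = i' ∧ j = j' := by
  have h1 := le_of_pair_iso hij hij' hj' e
  have h2 := le_of_pair_iso hij' hij hj e.symm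
  omega

theorem projInj_hasLocalEnd (h : projInj k n A) : HasLocalEnd A := by
  rcases h with rfl | rfl
  exacts [hasLocalEnd_pair _ _, hasLocalEnd_pair _ _]

theorem exists_iso_of_isIso_mem (hA : HasLocalEnd A) (h0 : ¬ IsZero A) {f : A ⟶ A}
    (hf : f ∈ objIdeal (projInj k n) A A) (h : IsIso f) :
    Nonempty (A ≅ pair k n 0 n) ∨ Nonempty (A ≅ pair k n n n) := by
  obtain ⟨Z, hZ, a, b, hab⟩ := hA.exists_factor h0 hf h
  have := (projInj_hasLocalEnd hZ).nonempty_iso h0 a b hab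
  rcases hZ with rfl | rfl
  exacts [Or.inl this, Or.inr this]

/-- The identity of a projective pair lies in the ideal of `([0],[n])` and `([n],[n])`; if moreover
its endomorphism ring is local, `exists_factor` makes it isomorphic to one of these two. -/
theorem indecomposable_projective_injective_iff (hn : 1 ≤ n) (A : SubmodPair k n) :
    (Indecomposable A ∧ IsExactProjective (conflations k n) A ∧
        IsExactInjective (conflations k n) A) ↔
      (Nonempty (A ≅ pair k n 0 n) ∨ Nonempty (A ≅ pair k n n n)) := by
  constructor
  · rintro ⟨h1, h2, -⟩
    exact exists_iso_of_isIso_mem (hasLocalEnd_of_indecomposable h1) h1.1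
      (id_mem_of_isExactProjective h2) inferInstance
  · have key {Z : SubmodPair k n} (hZ : projInj k n Z) (h0 : ¬ IsZero Z) (e : A ≅ Z) :
        Indecomposable A ∧ IsExactProjective (conflations k n) A ∧
        IsExactInjective (conflations k n) A :=
      ⟨indecomposable_of_iso e ((projInj_hasLocalEnd hZ).indecomposable h0),
        isExactProjective_of_retract (projInj_isExactProjective hZ) e.hom e.inv e.hom_inv_id,
        isExactInjective_of_retract (projInj_isExactInjective hZ) e.hom e.inv e.hom_inv_id⟩
    rintro (⟨⟨e⟩⟩ | ⟨⟨e⟩⟩)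
    · exact key (Or.inl rfl) (pair_not_isZero hn le_rfl) e
    · exact key (Or.inr rfl) (pair_not_isZero hn le_rfl) e

end SubmodPair

/-! ### The objects `([i], [j])` of the stable category -/

namespace StableS

open SubmodPair

variable {k : Type u} [Field k] {n : ℕ}

theorem map_eq_zero_iff {C : Type*} [Category C] [Preadditive C] (K : ObjectProperty C) {X Y : C}
    (f : X ⟶ Y) : (factorFunctor K).map f = 0 ↔ f ∈ objIdeal K X Y := by
  rw [← Functor.map_zero, Quotient.functor_map_eq_iff]
  change f - 0 ∈ _ ↔ _
  rw [sub_zero]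

variable {p q : ℕ × ℕ}

theorem not_isIso_of_mem (h0 : 1 ≤ p.2) (h1 : p.1 ≤ p.2) (h2 : p.2 ≤ n) (hp : p ≠ (0, n))
    (hp' : p ≠ (n, n)) {f : SubmodPair.pair k n p.1 p.2 ⟶ SubmodPair.pair k n p.1 p.2}
    (hf : f ∈ objIdeal (projInj k n) _ _) : ¬ IsIso f := by
  intro h
  rcases exists_iso_of_isIso_mem (hasLocalEnd_pair _ _) (pair_not_isZero h0 h2) hf h with
    ⟨⟨e⟩⟩ | ⟨⟨e⟩⟩
  · have := eq_of_pair_iso h1 h2 (Nat.zero_le n) le_rfl e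
    exact hp (Prod.ext this.1 this.2)
  · have := eq_of_pair_iso h1 h2 le_rfl le_rfl e
    exact hp' (Prod.ext this.1 this.2)

theorem pair_indecomposable (h0 : 1 ≤ p.2) (h1 : p.1 ≤ p.2) (h2 : p.2 ≤ n) (hp : p ≠ (0, n))
    (hp' : p ≠ (n, n)) : Indecomposable (StableS.pair k n p) := by
  refine HasLocalEnd.indecomposable ((hasLocalEnd_pair p.1 p.2).map (StableS.proj k n)) fun h => ?_
  rw [IsZero.iff_id_eq_zero, ← CategoryTheory.Functor.map_id, map_eq_zero_iff] at h
  exact not_isIso_of_mem h0 h1 h2 hp hp' h inferInstance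

/-- The isomorphism and its inverse are lifted to `f` and `g` in `𝒮(n)`. Then `1 - f g` lies in the
ideal and is not invertible, so `f g` is, and the pairs are isomorphic already in `𝒮(n)`. -/
theorem eq_of_pair_iso (h0 : 1 ≤ p.2) (h1 : p.1 ≤ p.2) (h2 : p.2 ≤ n) (hp : p ≠ (0, n))
    (hp' : p ≠ (n, n)) (hq1 : q.1 ≤ q.2) (hq2 : q.2 ≤ n)
    (e : StableS.pair k n p ≅ StableS.pair k n q) : p = q := by
  obtain ⟨f, hf⟩ := (StableS.proj k n).map_surjective e.hom
  obtain ⟨g, hg⟩ := (StableS.proj k n).map_surjective e.inv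
  have hfg : 𝟙 _ - f ≫ g ∈ objIdeal (projInj k n) _ _ := by
    rw [← map_eq_zero_iff, Functor.map_sub, Functor.map_comp, hf, hg, e.hom_inv_id,
      CategoryTheory.Functor.map_id, sub_self]
  rcases hasLocalEnd_pair p.1 p.2 (f ≫ g) with h | h
  · obtain ⟨e'⟩ := (hasLocalEnd_pair q.1 q.2).nonempty_iso (pair_not_isZero h0 h2) f g h
    have := SubmodPair.eq_of_pair_iso h1 h2 hq1 hq2 e'
    exact Prod.ext this.1 this.2
  · exact absurd h (not_isIso_of_mem h0 h1 h2 hp hp' hfg)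

theorem indexI_bounds (h : p ∈ indexI n) : 1 ≤ p.2 ∧ p.1 ≤ p.2 ∧ p.2 ≤ n ∧ p ≠ (0, n) ∧
    p ≠ (n, n) := by
  obtain ⟨i, j⟩ := p
  simp only [indexI, Set.mem_ofPred_eq, ne_eq, Prod.mk.injEq] at h ⊢
  omega

theorem indexJ_bounds (h : p ∈ indexJ n) : 1 ≤ p.2 ∧ p.1 ≤ p.2 ∧ p.2 ≤ n ∧ p ≠ (0, n) ∧
    p ≠ (n, n) := by
  obtain ⟨i, j⟩ := p
  simp only [indexJ, Set.mem_ofPred_eq, ne_eq, Prod.mk.injEq] at h ⊢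
  omega

theorem ncard_of_eq_union (n : ℕ) {s : Set (ℕ × ℕ)} (f g : ℕ → ℕ × ℕ)
    (hf : Function.Injective f) (hg : Function.Injective g)
    (hfg : ∀ i ∈ Finset.Icc 1 (n - 1), ∀ j ∈ Finset.Icc 1 (n - 1), f i ≠ g j)
    (hs : ∀ p, p ∈ s ↔ ∃ i ∈ Finset.Icc 1 (n - 1), f i = p ∨ g i = p) :
    s.ncard = 2 * n - 2 := by
  have : s = ((Finset.Icc 1 (n - 1)).image f ∪ (Finset.Icc 1 (n - 1)).image g : Finset _) := by
    ext p
    rw [hs]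
    simp only [Finset.coe_union, Finset.coe_image, Set.mem_union, Set.mem_image, SetLike.mem_coe]
    grind
  rw [this, Set.ncard_coe_finset, Finset.card_union_of_disjoint,
    Finset.card_image_of_injective _ hf, Finset.card_image_of_injective _ hg, Nat.card_Icc]
  · omega
  · rw [Finset.disjoint_left]
    intro p hp hp'
    obtain ⟨i, hi, rfl⟩ := Finset.mem_image.1 hp
    obtain ⟨j, hj, h⟩ := Finset.mem_image.1 hp'
    exact hfg i hi j hj h.symm

theorem indexI_ncard (n : ℕ) : (indexI n).ncard = 2 * n - 2 := by
  refine ncard_of_eq_union n (fun i => (i, i)) (fun i => (i, n)) (fun i j h => (Prod.ext_iff.1 h).1)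
    (fun i j h => (Prod.ext_iff.1 h).1) (fun i hi j hj h => ?_) fun ⟨a, b⟩ => ?_
  · simp only [Finset.mem_Icc, Prod.mk.injEq] at hi hj h
    omega
  · simp only [indexI, Set.mem_ofPred_eq, Finset.mem_Icc, Prod.mk.injEq]
    constructor
    · rintro ⟨h1, h2, h3⟩; exact ⟨a, ⟨h1, h2⟩, by omega⟩
    · rintro ⟨i, h1, h2⟩; omega

theorem indexJ_ncard (n : ℕ) : (indexJ n).ncard = 2 * n - 2 := by
  refine ncard_of_eq_union n (fun i => (i, i)) (fun i => (0, i)) (fun i j h => (Prod.ext_iff.1 h).1)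
    (fun i j h => (Prod.ext_iff.1 h).2) (fun i hi j hj h => ?_) fun ⟨a, b⟩ => ?_
  · simp only [Finset.mem_Icc, Prod.mk.injEq] at hi hj h
    omega
  · simp only [indexJ, Set.mem_ofPred_eq, Finset.mem_Icc, Prod.mk.injEq]
    constructor
    · rintro ⟨h1, h2, h3⟩; exact ⟨b, ⟨h1, h2⟩, by omega⟩
    · rintro ⟨i, h1, h2⟩; omega

end StableS

/-! ### Exact sequences of projective pairs -/

/-- Choices are propagated from position `0` in both directions. This yields complete resolutions,
chain maps and homotopies alike, each with its own forward and backward step. -/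
theorem exists_int_section {W : ℤ → Type*} (R : ∀ i, W i → W (i + 1) → Prop)
    (hf : ∀ i w, ∃ w', R i w w') (hb : ∀ i w', ∃ w, R i w w') (w₀ : W 0) :
    ∃ s : ∀ i, W i, s 0 = w₀ ∧ ∀ i, R i (s i) (s (i + 1)) := by
  choose f hf using hf
  choose b hb using hb
  let F : ∀ m : ℕ, W (Int.ofNat m) :=
    fun m => Nat.rec (motive := fun m => W (Int.ofNat m)) w₀ (fun m w => f (Int.ofNat m) w) m
  let G : ∀ m : ℕ, W (Int.negSucc m) :=
    fun m => Nat.rec (motive := fun m => W (Int.negSucc m)) (b (Int.negSucc 0) w₀)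
      (fun m w => b (Int.negSucc (m + 1)) w) m
  refine ⟨fun i => Int.rec (motive := W) F G i, rfl, fun i => ?_⟩
  -- The types agree because `Int.negSucc 0 + 1` reduces to `0` and `Int.negSucc (m + 1) + 1` to
  -- `Int.negSucc m`.
  match i with
  | Int.ofNat m => exact hf (Int.ofNat m) (F m)
  | Int.negSucc 0 => exact hb (Int.negSucc 0) w₀
  | Int.negSucc (m + 1) => exact hb (Int.negSucc (m + 1)) (G m)

namespace SubmodPair

variable {k : Type u} [Field k] {n : ℕ} {A B D : SubmodPair k n}

/-- The kernel of a morphism of pairs. -/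
noncomputable abbrev kerPair (d : A ⟶ B) : SubmodPair k n :=
  of (A.X.comap (LinearMap.ker (toLin d)).subtype)

/-- The inclusion of the kernel. -/
noncomputable def kerIncl (d : A ⟶ B) : kerPair d ⟶ A :=
  homMk (A := kerPair d) (LinearMap.ker (toLin d)).subtype fun _ h => h

theorem toLin_kerIncl_mem (d : A ⟶ B) (y : (kerPair d).Y) : toLin d (toLin (kerIncl d) y) = 0 :=
  LinearMap.mem_ker.1 y.2

theorem kerIncl_isInflation (d : A ⟶ B) : IsInflation (conflations k n) (kerIncl d) :=
  (isInflation_iff _).2 ⟨Subtype.val_injective, fun _ h => h⟩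

/-- The factorization through the kernel. -/
noncomputable def kerLift {d : A ⟶ B} (f : D ⟶ A) (h : ∀ y, toLin d (toLin f y) = 0) :
    D ⟶ kerPair d :=
  homMk (B := kerPair d) ((toLin f).codRestrict _ fun y => LinearMap.mem_ker.2 (h y))
    fun _ hy => toLin_mem f hy

/-- A sequence of exact projective pairs, indexed by `ℤ`, which is exact on both components. -/
structure IsExactSeq (P : ℤ → SubmodPair k n) (d : ∀ i, P i ⟶ P (i + 1)) : Prop where
  projective : ∀ i, IsExactProjective (conflations k n) (P i)
  d_d : ∀ i y, toLin (d (i + 1)) (toLin (d i) y) = 0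
  exact : ∀ i y, toLin (d (i + 1)) y = 0 → ∃ z, toLin (d i) z = y
  exact_X : ∀ i, ∀ y ∈ (P (i + 1)).X, toLin (d (i + 1)) y = 0 → ∃ z ∈ (P i).X, toLin (d i) z = y

namespace IsExactSeq

variable {P : ℤ → SubmodPair k n} {d : ∀ i, P i ⟶ P (i + 1)} (hP : IsExactSeq P d)
  {Q : ℤ → SubmodPair k n} {d' : ∀ i, Q i ⟶ Q (i + 1)} (hQ : IsExactSeq Q d')

include hP

theorem injective (i : ℤ) : IsExactInjective (conflations k n) (P i) :=
  ((isFrobeniusStructure k n).projective_iff_injective _).1 (hP.projective i)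

/-- Exactness on both components lets each differential factor as a deflation onto the next kernel
followed by an inflation; this is what makes extending and lifting possible. -/
theorem cover_isDeflation (i : ℤ) :
    IsDeflation (conflations k n) (kerLift (d := d (i + 1)) (d i) (hP.d_d i)) := by
  refine (isDeflation_iff _).2 ⟨fun y => ?_, fun y hy => ?_⟩
  · obtain ⟨z, hz⟩ := hP.exact i y.1 (toLin_kerIncl_mem _ y)
    exact ⟨z, Subtype.ext hz⟩
  · obtain ⟨z, hz, hz'⟩ := hP.exact_X i y.1 hy (toLin_kerIncl_mem _ y)
    exact ⟨z, hz, Subtype.ext hz'⟩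

/-- The shifted complex with its sign, the target of the map `ψ` that glues two resolutions
together. -/
theorem shift_neg : IsExactSeq (fun i => P (i + 1)) (fun i => -d (i + 1)) where
  projective i := hP.projective _
  d_d i y := by
    rw [toLin_neg, toLin_neg, map_neg, hP.d_d, neg_zero, neg_zero]
  exact i y h := by
    obtain ⟨z, hz⟩ := hP.exact (i + 1) y (by rwa [toLin_neg, neg_eq_zero] at h)
    exact ⟨-z, by rw [toLin_neg, map_neg, neg_neg, hz]⟩
  exact_X i y hy h := by
    obtain ⟨z, hz, hz'⟩ := hP.exact_X (i + 1) y hy (by rwa [toLin_neg, neg_eq_zero] at h)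
    exact ⟨-z, neg_mem hz, by rw [toLin_neg, map_neg, neg_neg, hz']⟩

include hQ

/-- Morphisms between cocycles extend to morphisms of complexes. -/
theorem exists_lift (u : kerPair (d 0) ⟶ kerPair (d' 0)) :
    ∃ φ : ∀ i, P i ⟶ Q i, (∀ i, φ i ≫ d' i = d i ≫ φ (i + 1)) ∧
      kerIncl (d 0) ≫ φ 0 = u ≫ kerIncl (d' 0) := by
  let R (i : ℤ) (u : kerPair (d i) ⟶ kerPair (d' i)) (v : kerPair (d (i + 1)) ⟶ kerPair (d' (i + 1))) :
      Prop := ∃ φ : P i ⟶ Q i, kerIncl (d i) ≫ φ = u ≫ kerIncl (d' i) ∧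
        ∀ y, toLin (d' i) (toLin φ y) = toLin (v) (toLin (kerLift (d := d (i + 1)) (d i) (hP.d_d i)) y)
  -- `R i u v` says that a single map `P i → Q i` induces `u` on cocycles of degree `i` and `v` on
  -- those of degree `i + 1`. Going forward uses that `Q i` is injective, going backward that `P i`
  -- is projective.
  obtain ⟨s, hs, h⟩ := exists_int_section (W := fun i => kerPair (d i) ⟶ kerPair (d' i)) R
    (fun i u => by
      obtain ⟨φ, hφ⟩ := hQ.injective i _ (kerIncl_isInflation (d i)) (u ≫ kerIncl (d' i))
      obtain ⟨v, hv⟩ := exists_desc_of_deflation (hP.cover_isDeflation i)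
        (kerLift (d := d' (i + 1)) (φ ≫ d' i) fun y => hQ.d_d i _) fun y hy => Subtype.ext (by
          have h1 : toLin (d i) y = 0 := congrArg Subtype.val hy
          have h2 := hom_congr hφ ⟨y, LinearMap.mem_ker.2 h1⟩
          change toLin (d' i) (toLin φ y) = 0
          change toLin φ y = _ at h2
          rw [h2]
          exact toLin_kerIncl_mem _ _)
      refine ⟨v, φ, hφ, fun y => ?_⟩
      exact (congrArg Subtype.val (hom_congr hv y)).symm)
    (fun i v => by
      obtain ⟨φ, hφ⟩ := hP.projective i _ (hQ.cover_isDeflation i)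
        (kerLift (d := d (i + 1)) (d i) (hP.d_d i) ≫ v)
      have hφ' (y) : toLin (d' i) (toLin φ y)
          = toLin v (toLin (kerLift (d := d (i + 1)) (d i) (hP.d_d i)) y) :=
        congrArg Subtype.val (hom_congr hφ y)
      refine ⟨kerLift (kerIncl (d i) ≫ φ) fun y => ?_, φ, rfl, fun y => hφ' y⟩
      rw [toLin_comp, hφ']
      have : toLin (kerLift (d := d (i + 1)) (d i) (hP.d_d i)) (toLin (kerIncl (d i)) y) = 0 :=
        Subtype.ext (toLin_kerIncl_mem _ y)
      rw [this, map_zero]; rfl) u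
  choose φ h1 h2 using h
  refine ⟨φ, fun i => hom_ext fun y => ?_, by rw [h1, hs]⟩
  rw [toLin_comp, h2, toLin_comp]
  exact (hom_congr (h1 (i + 1)) _).symm

/-- A morphism of complexes is null-homotopic if it is stably zero on cocycles. -/
theorem exists_homotopy (f : ∀ i, P i ⟶ Q i) (hf : ∀ i, f i ≫ d' i = d i ≫ f (i + 1))
    (u : kerPair (d 0) ⟶ kerPair (d' 0)) (hu : kerIncl (d 0) ≫ f 0 = u ≫ kerIncl (d' 0))
    (h : u ∈ objIdeal (projInj k n) _ _) :
    ∃ w : ∀ i, P (i + 1) ⟶ Q i, ∀ i, f (i + 1) = w i ≫ d' i + d (i + 1) ≫ w (i + 1) := by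
  -- On cocycles the term `d ≫ w'` of the homotopy equation vanishes, so this is the condition on
  -- `w` alone that the equation imposes.
  let W (i : ℤ) := {w : P (i + 1) ⟶ Q i // ∀ y, toLin (d (i + 1)) y = 0 →
    toLin (d' i) (toLin w y) = toLin (f (i + 1)) y}
  -- Starting point of the homotopy: `u` extends along the kernel inclusion because it lies in the
  -- ideal, and the extension lifts through the cover of the cocycles. The degree `j = -1` is kept
  -- variable so that `0` can be rewritten as `j + 1`.
  have h0 (j : ℤ) (hj : j + 1 = 0) : Nonempty (W j) := by
    have hu' : ∃ u : kerPair (d 0) ⟶ kerPair (d' 0), kerIncl (d 0) ≫ f 0 = u ≫ kerIncl (d' 0) ∧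
      u ∈ objIdeal (projInj k n) _ _ := ⟨u, hu, h⟩
    rw [← hj] at hu'
    obtain ⟨u, hu, h⟩ := hu'
    obtain ⟨g, hg⟩ := exists_extension_of_mem h (kerIncl_isInflation (d (j + 1)))
    obtain ⟨w, hw⟩ := hP.projective (j + 1) _ (hQ.cover_isDeflation j) g
    refine ⟨w, fun y hy => ?_⟩
    have h1 : toLin (d' j) (toLin w y) = (toLin g y).1 := congrArg Subtype.val (hom_congr hw y)
    have h2 : toLin g y = toLin u ⟨y, LinearMap.mem_ker.2 hy⟩ :=
      hom_congr hg ⟨y, LinearMap.mem_ker.2 hy⟩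
    have h3 : toLin (f (j + 1)) y = (toLin u ⟨y, LinearMap.mem_ker.2 hy⟩).1 :=
      hom_congr hu ⟨y, LinearMap.mem_ker.2 hy⟩
    rw [h1, h2, h3]
  have hf' (i y) : toLin (d' i) (toLin (f i) y) = toLin (f (i + 1)) (toLin (d i) y) :=
    hom_congr (hf i) y
  -- `f - w ≫ d'` vanishes on cocycles, so it descends to the next kernel and then extends since `Q
  -- (i + 1)` is injective. Backward, `f - d ≫ w'` has values in cocycles and is lifted since `P (i
  -- + 1)` is projective.
  have fwd (i : ℤ) (w : W i) : ∃ w' : W (i + 1),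
      f (i + 1) = w.1 ≫ d' i + d (i + 1) ≫ w'.1 := by
    obtain ⟨w, hw⟩ := w
    obtain ⟨g, hg⟩ := exists_desc_of_deflation (hP.cover_isDeflation (i + 1))
      (f (i + 1) - w ≫ d' i) fun y hy => by
        rw [toLin_sub, toLin_comp, hw y (congrArg Subtype.val hy), sub_self]
    obtain ⟨w', hw'⟩ := hQ.injective (i + 1) _ (kerIncl_isInflation (d (i + 1 + 1))) g
    have key (y) : toLin w' (toLin (d (i + 1)) y)
        = toLin (f (i + 1)) y - toLin (d' i) (toLin w y) := by
      have := hom_congr hg y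
      rw [← hw', toLin_sub, toLin_comp] at this
      exact this
    refine ⟨⟨w', fun y hy => ?_⟩, hom_ext fun y => ?_⟩
    · obtain ⟨z, rfl⟩ := hP.exact (i + 1) y hy
      rw [key, map_sub, hQ.d_d, sub_zero, hf']
    · rw [toLin_add, toLin_comp, toLin_comp, key]
      abel
  have bwd (i : ℤ) (w' : W (i + 1)) : ∃ w : W i,
      f (i + 1) = w.1 ≫ d' i + d (i + 1) ≫ w'.1 := by
    obtain ⟨w', hw'⟩ := w'
    obtain ⟨w, hw⟩ := hP.projective (i + 1) _ (hQ.cover_isDeflation i)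
      (kerLift (d := d' (i + 1)) (f (i + 1) - d (i + 1) ≫ w') fun y => by
        rw [toLin_sub, map_sub, toLin_comp, hw' _ (hP.d_d _ _), hf', sub_self])
    have key (y) : toLin (d' i) (toLin w y)
        = toLin (f (i + 1)) y - toLin w' (toLin (d (i + 1)) y) :=
      congrArg Subtype.val (hom_congr hw y)
    refine ⟨⟨w, fun y hy => ?_⟩, hom_ext fun y => ?_⟩
    · rw [key, hy, map_zero, sub_zero]
    · rw [toLin_add, toLin_comp, toLin_comp, key]
      abel
  have ⟨w₁⟩ : Nonempty (W 0) := by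
    have e : (-1 : ℤ) + 1 = 0 := by norm_num
    obtain ⟨w, -⟩ := fwd (-1) (h0 (-1) e).some
    rw [← e]
    exact ⟨w⟩
  obtain ⟨s, -, hs⟩ := exists_int_section (W := W)
    (fun i w w' => f (i + 1) = w.1 ≫ d' i + d (i + 1) ≫ w'.1) fwd bwd w₁
  exact ⟨fun i => (s i).1, hs⟩

end IsExactSeq

/-- Every pair is the kernel in an exact sequence of projective pairs. -/
theorem exists_isExactSeq (A : SubmodPair k n) :
    ∃ (P : ℤ → SubmodPair k n) (d : ∀ i, P i ⟶ P (i + 1)), IsExactSeq P d ∧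
      Nonempty (kerPair (d 0) ≅ A) := by
  -- Successive conflations `A → P → B` with `P` projective, to the right from inflations into free
  -- pairs, to the left from deflations out of them, are spliced to a complex.
  obtain ⟨s, hs, h⟩ := exists_int_section (W := fun _ => SubmodPair k n)
    (fun _ A B => ∃ (P : SubmodPair k n) (i : A ⟶ P) (p : P ⟶ B) (w : i ≫ p = 0),
      IsExactProjective (conflations k n) P ∧ conflations k n (ShortComplex.mk i p w))
    (fun _ A => by
      obtain ⟨a, b, i, Z, p, w, h⟩ := exists_inflation_freePair A
      exact ⟨Z, _, i, p, w, freePair_isExactProjective a b, h⟩)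
    (fun _ B => by
      obtain ⟨a, b, p, Z, i, w, h⟩ := exists_deflation_freePair B
      exact ⟨Z, _, i, p, w, freePair_isExactProjective a b, h⟩) A
  choose P i p w hP hc using h
  have hc' (j) := (conflations_iff _).1 (hc j)
  have hi (j) : Function.Injective (toLin (i j)) := (hc' j).1
  have hd (j) (y) : toLin (p j ≫ i (j + 1)) y = 0 ↔ toLin (p j) y = 0 := by
    rw [toLin_comp, map_eq_zero_iff _ (hi _)]
  refine ⟨P, fun j => p j ≫ i (j + 1), ⟨hP, fun j y => ?_, fun j y h => ?_, fun j y hy h => ?_⟩, ?_⟩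
  · rw [hd, toLin_comp, ← toLin_comp, w]; rfl
  · rw [hd] at h
    obtain ⟨z, rfl⟩ := (hc' (j + 1)).2.1 y h
    obtain ⟨z', rfl⟩ := (hc' j).2.2.1 z
    exact ⟨z', toLin_comp _ _ _⟩
  · rw [hd] at h
    obtain ⟨z, rfl⟩ := (hc' (j + 1)).2.1 y h
    obtain ⟨z', hz', rfl⟩ := (hc' j).2.2.2.2 z ((hc' (j + 1)).2.2.2.1 z hy)
    exact ⟨z', hz', toLin_comp _ _ _⟩
  · let l : s 0 ⟶ kerPair (p 0 ≫ i (0 + 1)) := kerLift (i 0) fun y => by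
      rw [hd, ← toLin_comp, w]; rfl
    have : IsIso l := isIso_of_bijective l ⟨fun y y' h => hi 0 (congrArg Subtype.val h),
      fun y => by
        obtain ⟨z, hz⟩ := (hc' 0).2.1 y.1 ((hd 0 _).1 (toLin_kerIncl_mem _ y))
        exact ⟨z, Subtype.ext hz⟩⟩ fun y hy => (hc' 0).2.2.2.1 y hy
    exact ⟨(asIso l).symm ≪≫ eqToIso hs⟩

end SubmodPair

/-! ### Exact complexes of projective pairs, and the stable category -/

namespace SubmodPair

variable {k : Type u} [Field k] {n : ℕ} {A B D : SubmodPair k n}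

/-- The category of projective-injective pairs. -/
abbrev ProjPair (k : Type u) [Field k] (n : ℕ) :=
  ObjectProperty.FullSubcategory (fun A : SubmodPair k n => IsExactProjective (conflations k n) A)

namespace ProjPair

instance : HasZeroObject (ProjPair k n) :=
  ⟨⟨pi fun i : Empty => i.elim, pi_isExactProjective fun i => i.elim⟩, by
    rw [IsZero.iff_id_eq_zero]
    exact InducedCategory.hom_ext (hom_ext fun y => Subsingleton.elim _ _)⟩

instance : HasBinaryBiproducts (ProjPair k n) where
  has_binary_biproduct A B := hasBinaryBiproduct_of_total
    { pt := ⟨prod A.obj B.obj, prod_isExactProjective A.property B.property⟩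
      fst := ObjectProperty.homMk (prodFst _ _)
      snd := ObjectProperty.homMk (prodSnd _ _)
      inl := ObjectProperty.homMk (prodInl _ _)
      inr := ObjectProperty.homMk (prodInr _ _)
      inl_fst := rfl
      inl_snd := rfl
      inr_fst := rfl
      inr_snd := rfl } (InducedCategory.hom_ext (prod_total _ _))

/-- The functor mapping `(X, Y)` to `Y`. -/
noncomputable def forgetY (k : Type u) [Field k] (n : ℕ) :
    ProjPair k n ⥤ ModuleCat.{u} (TruncPoly k n) where
  obj A := ModuleCat.of _ A.obj.Y
  map f := ModuleCat.ofHom (toLin f.hom)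

/-- The functor mapping `(X, Y)` to `X`. -/
noncomputable def forgetX (k : Type u) [Field k] (n : ℕ) :
    ProjPair k n ⥤ ModuleCat.{u} (TruncPoly k n) where
  obj A := ModuleCat.of _ A.obj.X
  map f := ModuleCat.ofHom ((toLin f.hom).restrict fun _ h => toLin_mem f.hom h)

instance : (forgetY k n).Additive where
  map_add := rfl

instance : (forgetX k n).Additive where
  map_add := rfl

/-- The exact complexes of projective pairs. -/
noncomputable def exactComplexes (k : Type u) [Field k] (n : ℕ) :
    ObjectProperty (HomotopyCategory (ProjPair k n) (ComplexShape.up ℤ)) :=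
  (HomotopyCategory.subcategoryAcyclic _).inverseImage
      ((forgetY k n).mapHomotopyCategory (ComplexShape.up ℤ)) ⊓
    (HomotopyCategory.subcategoryAcyclic _).inverseImage
      ((forgetX k n).mapHomotopyCategory (ComplexShape.up ℤ))

/-- Exactness is tested by two triangulated functors with values in complexes of modules, so closure
is inherited from the acyclic complexes there. -/
instance : (exactComplexes k n).IsTriangulated := by
  dsimp only [exactComplexes]
  infer_instance

/-- The sequence of differentials of a complex of projective pairs. -/
def diff (K : CochainComplex (ProjPair k n) ℤ) (i : ℤ) : (K.X i).obj ⟶ (K.X (i + 1)).obj :=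
  (K.d i (i + 1)).hom

theorem exactAt_forgetY_iff (K : CochainComplex (ProjPair k n) ℤ) (i : ℤ) :
    (((forgetY k n).mapHomologicalComplex _).obj K).ExactAt (i + 1) ↔
      ∀ y, toLin (diff K (i + 1)) y = 0 → ∃ z, toLin (diff K i) z = y := by
  rw [HomologicalComplex.exactAt_iff' _ i (i + 1) (i + 1 + 1) (by simp) (by simp),
    ShortComplex.moduleCat_exact_iff]
  rfl

theorem exactAt_forgetX_iff (K : CochainComplex (ProjPair k n) ℤ) (i : ℤ) :
    (((forgetX k n).mapHomologicalComplex _).obj K).ExactAt (i + 1) ↔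
      ∀ y ∈ (K.X (i + 1)).obj.X, toLin (diff K (i + 1)) y = 0 →
        ∃ z ∈ (K.X i).obj.X, toLin (diff K i) z = y := by
  rw [HomologicalComplex.exactAt_iff' _ i (i + 1) (i + 1 + 1) (by simp) (by simp),
    ShortComplex.moduleCat_exact_iff]
  constructor
  · intro h y hy e
    obtain ⟨z, hz⟩ := h (⟨y, hy⟩ : (K.X (i + 1)).obj.X) (Subtype.ext e)
    have hz : (⟨toLin (diff K i) z.1, _⟩ : (K.X (i + 1)).obj.X) = ⟨y, hy⟩ := hz
    exact ⟨z.1, z.2, congrArg Subtype.val hz⟩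
  · intro h y e
    obtain ⟨z, hz, e'⟩ := h y.1 y.2 (congrArg Subtype.val e)
    exact ⟨(⟨z, hz⟩ : (K.X i).obj.X), Subtype.ext e'⟩

theorem exactComplexes_iff (K : CochainComplex (ProjPair k n) ℤ) :
    exactComplexes k n ((HomotopyCategory.quotient _ _).obj K) ↔ IsExactSeq _ (diff K) := by
  have e (F : ProjPair k n ⥤ ModuleCat.{u} (TruncPoly k n)) [F.Additive] :
      HomotopyCategory.subcategoryAcyclic _ ((F.mapHomotopyCategory (ComplexShape.up ℤ)).obj
        ((HomotopyCategory.quotient _ _).obj K)) ↔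
      ∀ i : ℤ, ((F.mapHomologicalComplex _).obj K).ExactAt (i + 1) := by
    refine (HomotopyCategory.quotient_obj_mem_subcategoryAcyclic_iff_exactAt
      ((F.mapHomologicalComplex _).obj K)).trans ⟨fun h i => h _, fun h i => ?_⟩
    rw [← sub_add_cancel i 1]
    exact h _
  refine (and_congr (e (forgetY k n)) (e (forgetX k n))).trans ?_
  simp only [exactAt_forgetY_iff, exactAt_forgetX_iff]
  refine ⟨fun h => ⟨fun i => (K.X i).property, fun i y => ?_, h.1, h.2⟩,
    fun h => ⟨h.exact, h.exact_X⟩⟩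
  have := congrArg InducedCategory.Hom.hom (K.d_comp_d i (i + 1) (i + 1 + 1))
  exact hom_congr this y

/-- The complex given by a sequence of projective pairs. -/
noncomputable def complexOf (P : ℤ → SubmodPair k n) (d : ∀ i, P i ⟶ P (i + 1))
    (hP : IsExactSeq P d) : CochainComplex (ProjPair k n) ℤ :=
  CochainComplex.of (fun i => ⟨P i, hP.projective i⟩) (fun i => ObjectProperty.homMk (d i))
    fun i => InducedCategory.hom_ext (hom_ext (hP.d_d i))

theorem diff_complexOf {P : ℤ → SubmodPair k n} {d : ∀ i, P i ⟶ P (i + 1)}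
    (hP : IsExactSeq P d) : diff (complexOf P d hP) = d := by
  funext i
  exact congrArg InducedCategory.Hom.hom
    (CochainComplex.of_d (fun i => (⟨P i, hP.projective i⟩ : ProjPair k n))
      (fun i => ObjectProperty.homMk (d i)) i)

theorem comm_diff {K L : CochainComplex (ProjPair k n) ℤ} (f : K ⟶ L) (i : ℤ) :
    (f.f i).hom ≫ diff L i = diff K i ≫ (f.f (i + 1)).hom :=
  congrArg InducedCategory.Hom.hom (f.comm i (i + 1))

/-- The chain map given by a family of morphisms. -/
noncomputable def chainMap {K L : CochainComplex (ProjPair k n) ℤ} (φ : ∀ i, (K.X i).obj ⟶ (L.X i).obj)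
    (h : ∀ i, φ i ≫ diff L i = diff K i ≫ φ (i + 1)) : K ⟶ L where
  f i := ObjectProperty.homMk (φ i)
  comm' := by
    rintro i _ rfl
    exact InducedCategory.hom_ext (h i)

/-- The pair of cocycles of degree zero. -/
noncomputable def cocycles (k : Type u) [Field k] (n : ℕ) :
    CochainComplex (ProjPair k n) ℤ ⥤ SubmodPair k n where
  obj K := kerPair (diff K 0)
  map {K L} f := kerLift (kerIncl (diff K 0) ≫ (f.f 0).hom) fun y => by
    have := hom_congr (comm_diff f 0) (toLin (kerIncl (diff K 0)) y)
    rw [toLin_comp, toLin_comp, toLin_kerIncl_mem, map_zero] at this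
    exact this

theorem cocycles_map_incl {K L : CochainComplex (ProjPair k n) ℤ} (f : K ⟶ L) :
    (cocycles k n).map f ≫ kerIncl (diff L 0) = kerIncl (diff K 0) ≫ (f.f 0).hom := rfl

instance : (cocycles k n).Additive where
  map_add := rfl

/-- On cocycles a homotopy contributes only the term that passes through the projective pair `L.X
(-1)`. -/
theorem cocycles_map_sub_mem {K L : CochainComplex (ProjPair k n) ℤ} {f g : K ⟶ L}
    (h : Homotopy f g) : (cocycles k n).map f - (cocycles k n).map g ∈
      objIdeal (projInj k n) _ _ := by
  have hd : ∀ y, toLin (diff L 0) (toLin (L.d (-1) 0).hom y) = 0 := fun y =>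
    hom_congr (congrArg InducedCategory.Hom.hom (L.d_comp_d (-1) 0 (0 + 1))) y
  have : (cocycles k n).map f - (cocycles k n).map g =
      (kerIncl (diff K 0) ≫ (h.hom 0 (-1)).hom) ≫ kerLift (L.d (-1) 0).hom hd := by
    refine hom_ext fun y => Subtype.ext ?_
    have e := h.comm 0
    rw [dNext_eq h.hom (show (ComplexShape.up ℤ).Rel 0 (0 + 1) from rfl),
      prevD_eq h.hom (show (ComplexShape.up ℤ).Rel (-1) 0 from by simp)] at e
    have e' := hom_congr (congrArg InducedCategory.Hom.hom e) y.1
    have e'' : toLin (diff K 0) y.1 = 0 := toLin_kerIncl_mem (diff K 0) y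
    change toLin (f.f 0).hom y.1 - toLin (g.f 0).hom y.1 =
      toLin (L.d (-1) 0).hom (toLin (h.hom 0 (-1)).hom y.1)
    change toLin (f.f 0).hom y.1 = toLin (h.hom (0 + 1) 0).hom (toLin (diff K 0) y.1) +
      toLin (L.d (-1) 0).hom (toLin (h.hom 0 (-1)).hom y.1) + toLin (g.f 0).hom y.1 at e'
    rw [e', e'', map_zero, zero_add, add_sub_cancel_right]
  rw [this]
  exact mem_objIdeal_of_factor (id_mem_of_isExactProjective (L.X (-1)).property) _ _

/-- The functor induced by the cocycles of degree zero on the homotopy category. -/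
noncomputable def stableCocycles (k : Type u) [Field k] (n : ℕ) :
    HomotopyCategory (ProjPair k n) (ComplexShape.up ℤ) ⥤ StableS k n :=
  CategoryTheory.Quotient.lift _ (cocycles k n ⋙ StableS.proj k n) fun _ _ _ _ ⟨h⟩ =>
    CategoryTheory.Quotient.sound _ (cocycles_map_sub_mem h)

theorem stableCocycles_map {K L : CochainComplex (ProjPair k n) ℤ} (f : K ⟶ L) :
    (stableCocycles k n).map ((HomotopyCategory.quotient _ _).map f) =
      (StableS.proj k n).map ((cocycles k n).map f) := rfl

instance : (stableCocycles k n).Additive where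
  map_add {K L f g} := by
    obtain ⟨f, rfl⟩ := (HomotopyCategory.quotient _ _).map_surjective f
    obtain ⟨g, rfl⟩ := (HomotopyCategory.quotient _ _).map_surjective g
    exact (cocycles k n ⋙ StableS.proj k n).map_add

/-- The functor from the homotopy category of exact complexes to the stable category. -/
noncomputable abbrev exactCocycles (k : Type u) [Field k] (n : ℕ) :
    (exactComplexes k n).FullSubcategory ⥤ StableS k n :=
  (exactComplexes k n).ι ⋙ stableCocycles k n

/-- Fullness is the extension of maps of cocycles to chain maps, faithfulness the construction of
homotopies, density the existence of complete resolutions. -/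
instance : (exactCocycles k n).Full where
  map_surjective {K L} u := by
    obtain ⟨K, hK⟩ := K
    obtain ⟨L, hL⟩ := L
    obtain ⟨K, rfl⟩ := HomotopyCategory.quotient_obj_surjective K
    obtain ⟨L, rfl⟩ := HomotopyCategory.quotient_obj_surjective L
    obtain ⟨u, rfl⟩ := (StableS.proj k n).map_surjective u
    obtain ⟨φ, h1, h2⟩ := ((exactComplexes_iff K).1 hK).exists_lift ((exactComplexes_iff L).1 hL) u
    refine ⟨ObjectProperty.homMk ((HomotopyCategory.quotient _ _).map (chainMap φ h1)), ?_⟩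
    refine (stableCocycles_map _).trans (congrArg _ (hom_ext fun y => Subtype.ext ?_))
    exact hom_congr h2 y

theorem quotient_map_eq_zero {K L : CochainComplex (ProjPair k n) ℤ} (f : K ⟶ L)
    (hK : IsExactSeq _ (diff K)) (hL : IsExactSeq _ (diff L))
    (hf : (StableS.proj k n).map ((cocycles k n).map f) = 0) :
    (HomotopyCategory.quotient _ _).map f = 0 := by
  obtain ⟨w, hw⟩ := hK.exists_homotopy hL (fun i => (f.f i).hom) (comm_diff f)
    ((cocycles k n).map f) (cocycles_map_incl f).symm ((StableS.map_eq_zero_iff _ _).1 hf)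
  let z : CochainComplex.HomComplex.Cochain K L (-1) :=
    CochainComplex.HomComplex.Cochain.mk fun p q hpq => by
      obtain rfl : p = q + 1 := by omega
      exact ObjectProperty.homMk (w q)
  rw [HomotopyCategory.quotient_map_eq_zero_iff]
  refine ⟨(CochainComplex.HomComplex.Cochain.equivHomotopy f 0).symm ⟨z, ?_⟩⟩
  ext p
  obtain ⟨i, rfl⟩ : ∃ i, p = i + 1 := ⟨p - 1, by omega⟩
  rw [CochainComplex.HomComplex.Cochain.add_v, CochainComplex.HomComplex.Cochain.ofHom_v,
    CochainComplex.HomComplex.Cochain.ofHom_v, CochainComplex.HomComplex.δ_v (-1) 0 (by norm_num)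
      z (i + 1) (i + 1) (add_zero _) i (i + 1 + 1) (by omega) rfl, HomologicalComplex.zero_f,
    add_zero, Int.negOnePow_zero, one_smul]
  exact hw i

instance : (exactCocycles k n).Faithful where
  map_injective {K L} f g hfg := by
    obtain ⟨K, hK⟩ := K
    obtain ⟨L, hL⟩ := L
    obtain ⟨K, rfl⟩ := HomotopyCategory.quotient_obj_surjective K
    obtain ⟨L, rfl⟩ := HomotopyCategory.quotient_obj_surjective L
    obtain ⟨f, rfl⟩ := ObjectProperty.homMk_surjective f
    obtain ⟨g, rfl⟩ := ObjectProperty.homMk_surjective g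
    obtain ⟨f, rfl⟩ := (HomotopyCategory.quotient _ _).map_surjective f
    obtain ⟨g, rfl⟩ := (HomotopyCategory.quotient _ _).map_surjective g
    refine InducedCategory.hom_ext (sub_eq_zero.1 ?_)
    have h := quotient_map_eq_zero (f - g) ((exactComplexes_iff K).1 hK)
      ((exactComplexes_iff L).1 hL) (by
        rw [Functor.map_sub, Functor.map_sub, sub_eq_zero]
        exact hfg)
    rw [Functor.map_sub] at h
    exact h

instance : (exactCocycles k n).EssSurj where
  mem_essImage A := by
    obtain ⟨P, d, hP, ⟨e⟩⟩ := exists_isExactSeq A.as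
    have hK : exactComplexes k n ((HomotopyCategory.quotient _ _).obj (complexOf P d hP)) := by
      rw [exactComplexes_iff, diff_complexOf]
      exact hP
    have e' : (cocycles k n).obj (complexOf P d hP) ≅ A.as :=
      eqToIso (congrArg (fun d : ∀ i, P i ⟶ P (i + 1) => kerPair (d 0)) (diff_complexOf hP)) ≪≫ e
    exact ⟨⟨_, hK⟩, ⟨(StableS.proj k n).mapIso e'⟩⟩

end ProjPair
end SubmodPair

/-! ### Triangulated structure along an equivalence -/

section Transfer

open Pretriangulated

variable {C D : Type*} [Category C] [Category D]

/-- An equivalence is a localization at the isomorphisms, so the triangulated structure can be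
transported along it by the localization theorem for triangulated categories, whose hypotheses are
checked here. -/
theorem isomorphisms_hasLeftCalculusOfFractions :
    (MorphismProperty.isomorphisms C).HasLeftCalculusOfFractions where
  exists_leftFraction X Y φ := by
    have : IsIso φ.s := φ.hs
    exact ⟨⟨inv φ.s ≫ φ.f, 𝟙 Y, MorphismProperty.isomorphisms.infer_property _⟩, by simp⟩
  ext X' X Y f₁ f₂ s hs h := by
    have : IsIso s := hs
    exact ⟨Y, 𝟙 Y, MorphismProperty.isomorphisms.infer_property _, by
      rw [(cancel_epi s).1 h]⟩

variable [Preadditive C] [HasZeroObject C] [HasShift C ℤ]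
  [∀ m : ℤ, (shiftFunctor C m).Additive] [Pretriangulated C]

theorem isomorphisms_isCompatibleWithTriangulation :
    (MorphismProperty.isomorphisms C).IsCompatibleWithTriangulation where
  condition m := by
    ext X Y f
    exact isIso_iff_of_reflects_iso f (shiftFunctor C m)
  compatible_with_triangulation T₁ T₂ h₁ h₂ a b ha hb w := by
    obtain ⟨c, hc, hc'⟩ := complete_distinguished_triangle_morphism T₁ T₂ h₁ h₂ a b w
    exact ⟨c, isIso₃_of_isIso₁₂ (Triangle.homMk T₁ T₂ a b c w hc hc') h₁ h₂ ha hb, hc, hc'⟩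

/-- A triangulated structure can be transported along an additive equivalence. -/
theorem exists_triangulated_of_isEquivalence [IsTriangulated C] [Preadditive D] [HasZeroObject D]
    (L : C ⥤ D) [L.IsEquivalence] [L.Additive] :
    ∃ (_ : HasShift D ℤ) (_ : ∀ m : ℤ, (shiftFunctor D m).Additive) (_ : Pretriangulated D)
      (_ : L.CommShift ℤ), IsTriangulated D ∧ L.IsTriangulated := by
  let W : MorphismProperty C := MorphismProperty.isomorphisms C
  have : L.IsLocalization W := Functor.IsLocalization.of_isEquivalence L W le_rfl
  have : W.HasLeftCalculusOfFractions := isomorphisms_hasLeftCalculusOfFractions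
  have : W.IsCompatibleWithTriangulation := isomorphisms_isCompatibleWithTriangulation
  let _ : HasShift D ℤ := HasShift.localized L W ℤ
  let _ : L.CommShift ℤ := Functor.CommShift.localized L W ℤ
  have hadd (m : ℤ) : (shiftFunctor D m).Additive := by
    rw [Localization.functor_additive_iff L W]
    exact Functor.additive_of_iso (L.commShiftIso m)
  let _ : Pretriangulated D := Triangulated.Localization.pretriangulated L W
  exact ⟨inferInstance, hadd, inferInstance, inferInstance,
    Triangulated.Localization.isTriangulated L W, inferInstance⟩

/-- Only the connecting morphism has to be adjusted, by the isomorphism that makes the inclusion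
commute with the shift. -/
theorem exists_distinguished_fullSubcategory {P : ObjectProperty C} [P.IsTriangulated]
    {X Y Z : P.FullSubcategory} (f : X ⟶ Y) (g : Y ⟶ Z)
    (h : Z.obj ⟶ (shiftFunctor C (1 : ℤ)).obj X.obj)
    (hT : Triangle.mk f.hom g.hom h ∈ distinguishedTriangles) :
    ∃ h' : Z ⟶ (shiftFunctor P.FullSubcategory (1 : ℤ)).obj X,
      Triangle.mk f g h' ∈ distinguishedTriangles := by
  refine ⟨P.fullyFaithfulι.preimage (h ≫ (P.ι.commShiftIso (1 : ℤ)).inv.app X), ?_⟩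
  refine isomorphic_distinguished _ hT _
    (Triangle.isoMk _ _ (Iso.refl _) (Iso.refl _) (Iso.refl _) ?_ ?_ ?_)
  · exact (Category.comp_id _).trans (Category.id_comp _).symm
  · exact (Category.comp_id _).trans (Category.id_comp _).symm
  · have h1 : (shiftFunctor C (1 : ℤ)).map (𝟙 X.obj) = 𝟙 _ := CategoryTheory.Functor.map_id _ _
    have h2 : (h ≫ (P.ι.commShiftIso (1 : ℤ)).inv.app X) ≫ (P.ι.commShiftIso (1 : ℤ)).hom.app X
        = h := by
      rw [Category.assoc, Iso.inv_hom_id_app]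
      exact Category.comp_id _
    exact (congrArg₂ (· ≫ ·) h2 h1).trans ((Category.comp_id _).trans (Category.id_comp _).symm)

end Transfer

/-! ### Distinguished triangles from conflations -/

namespace SubmodPair

variable {k : Type u} [Field k] {n : ℕ}

open ProjPair Pretriangulated

section Twist

variable {P Q : ℤ → SubmodPair k n} (d : ∀ i, P i ⟶ P (i + 1)) (d' : ∀ i, Q i ⟶ Q (i + 1))
  (ψ : ∀ i, Q i ⟶ P (i + 1))

/-- The differential `(a, c) ↦ (d a + ψ c, d' c)`. -/
noncomputable def twist (i : ℤ) : prod (P i) (Q i) ⟶ prod (P (i + 1)) (Q (i + 1)) :=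
  prodLift (prodFst _ _ ≫ d i + prodSnd _ _ ≫ ψ i) (prodSnd _ _ ≫ d' i)

theorem toLin_twist (i : ℤ) (y : (P i).Y × (Q i).Y) : toLin (twist d d' ψ i) y =
    (toLin (d i) y.1 + toLin (ψ i) y.2, toLin (d' i) y.2) := rfl

variable {d d' ψ}

/-- The mapping cone computation: `ψ` anticommutes with the differentials, so the twisted
differential squares to zero, and exactness is checked first in the component `Q`, then in `P`. -/
theorem twist_isExactSeq (hP : IsExactSeq P d) (hQ : IsExactSeq Q d')
    (h : ∀ i, ψ i ≫ (-d (i + 1)) = d' i ≫ ψ (i + 1)) :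
    IsExactSeq (fun i => prod (P i) (Q i)) (twist d d' ψ) := by
  have h' (i y) : toLin (ψ (i + 1)) (toLin (d' i) y) = -toLin (d (i + 1)) (toLin (ψ i) y) := by
    rw [← toLin_comp, ← h, toLin_comp, toLin_neg]
  have key (i) (y : (P (i + 1)).Y × (Q (i + 1)).Y) :
      toLin (twist d d' ψ (i + 1)) y = 0 ↔ toLin (d (i + 1)) y.1 + toLin (ψ (i + 1)) y.2 = 0 ∧
        toLin (d' (i + 1)) y.2 = 0 := Prod.mk_eq_zero
  refine ⟨fun i => prod_isExactProjective (hP.projective i) (hQ.projective i),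
    fun i y => ?_, fun i y hy => ?_, fun i y hy' hy => ?_⟩
  · rw [key, toLin_twist]
    exact ⟨by rw [map_add, hP.d_d, h', zero_add, add_neg_cancel], hQ.d_d _ _⟩
  · obtain ⟨a, c⟩ := y
    obtain ⟨h1, h2⟩ := (key i (a, c)).1 hy
    change toLin (d (i + 1)) a + toLin (ψ (i + 1)) c = 0 at h1
    obtain ⟨c', rfl⟩ := hQ.exact i c h2
    rw [h', ← sub_eq_add_neg, ← map_sub] at h1
    obtain ⟨a', ha⟩ := hP.exact i _ h1
    exact ⟨(a', c'), Prod.ext (eq_sub_iff_add_eq.1 ha) rfl⟩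
  · obtain ⟨a, c⟩ := y
    obtain ⟨h1, h2⟩ := (key i (a, c)).1 hy
    change toLin (d (i + 1)) a + toLin (ψ (i + 1)) c = 0 at h1
    obtain ⟨c', hc', rfl⟩ := hQ.exact_X i c hy'.2 h2
    rw [h', ← sub_eq_add_neg, ← map_sub] at h1
    obtain ⟨a', ha', ha⟩ := hP.exact_X i _ (sub_mem hy'.1 (toLin_mem (ψ i) hc')) h1
    exact ⟨(a', c'), ⟨ha', hc'⟩, Prod.ext (eq_sub_iff_add_eq.1 ha) rfl⟩

end Twist

theorem isIso_kerLift {A B D : SubmodPair k n} {d : A ⟶ B} {f : D ⟶ A}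
    (h : ∀ y, toLin d (toLin f y) = 0) (hf : Function.Injective (toLin f))
    (hX : ∀ y, toLin f y ∈ A.X → y ∈ D.X) (hs : ∀ z, toLin d z = 0 → ∃ y, toLin f y = z) :
    IsIso (kerLift f h) :=
  isIso_of_bijective _ ⟨fun _ _ e => hf (congrArg Subtype.val e), fun z => by
    obtain ⟨y, hy⟩ := hs z.1 (toLin_kerIncl_mem d z)
    exact ⟨y, Subtype.ext hy⟩⟩ hX

/-- The horseshoe lemma for complete resolutions `P` of `X₁` and `Q` of `X₃`. The middle term is
identified with the cocycles of `P ⊕ Q` under a differential twisted by some `ψ : Q → P[1]`; the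
complexes then form a degreewise split sequence, which gives a triangle. -/
theorem exists_distinguished_triangle {S : ShortComplex (SubmodPair k n)} (hS : conflations k n S) :
    ∃ (K₁ K₂ K₃ : (exactComplexes k n).FullSubcategory) (f : K₁ ⟶ K₂) (g : K₂ ⟶ K₃)
      (h : K₃ ⟶ (shiftFunctor _ (1 : ℤ)).obj K₁)
      (e₁ : (StableS.proj k n).obj S.X₁ ≅ (exactCocycles k n).obj K₁)
      (e₂ : (StableS.proj k n).obj S.X₂ ≅ (exactCocycles k n).obj K₂)
      (e₃ : (StableS.proj k n).obj S.X₃ ≅ (exactCocycles k n).obj K₃),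
      Triangle.mk f g h ∈ distinguishedTriangles ∧
      (StableS.proj k n).map S.f ≫ e₂.hom = e₁.hom ≫ (exactCocycles k n).map f ∧
      (StableS.proj k n).map S.g ≫ e₃.hom = e₂.hom ≫ (exactCocycles k n).map g := by
  obtain ⟨P, d, hP, ⟨e₁⟩⟩ := exists_isExactSeq S.X₁
  obtain ⟨Q, d', hQ, ⟨e₃⟩⟩ := exists_isExactSeq S.X₃
  obtain ⟨hc1, hc2, hc3, hc4, hc5⟩ := (conflations_iff S).1 hS
  obtain ⟨e, he⟩ := hP.injective 0 S.f
    (show IsInflation (conflations k n) S.f from ⟨_, _, S.zero, hS⟩) (e₁.inv ≫ kerIncl (d 0))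
  have he1 (y) : toLin e (toLin S.f y) = (toLin e₁.inv y).1 := hom_congr he y
  have he' (y) : toLin (d 0) (toLin e (toLin S.f y)) = 0 := by
    rw [he1]
    exact toLin_kerIncl_mem _ _
  have hgf (y) : toLin S.g (toLin S.f y) = 0 := hom_congr S.zero y
  -- `e` extends the inclusion of `X₁` into `P 0` to `X₂`; after applying `d 0` it vanishes on `X₁`
  -- and descends to `h` on `X₃`.
  obtain ⟨h, hh⟩ := conflations_exists_desc hS
    (kerLift (d := d (0 + 1)) (e ≫ d 0) fun y => hP.d_d _ _) (hom_ext fun y => Subtype.ext (he' y))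
  have hh' (y) : (toLin h (toLin S.g y)).1 = toLin (d 0) (toLin e y) :=
    congrArg Subtype.val (hom_congr hh y)
  -- The minus sign makes `(e y, S.g y)` a cocycle: its first component is `h (S.g y) - h (S.g y)`.
  obtain ⟨ψ, hψ, hψ0⟩ := hQ.exists_lift hP.shift_neg
    (kerLift (d := -d (0 + 1)) (-(e₃.hom ≫ h) ≫ kerIncl (d (0 + 1))) fun y => by
      rw [toLin_neg, neg_eq_zero]; exact toLin_kerIncl_mem (d (0 + 1)) (toLin (-(e₃.hom ≫ h)) y))
  have hψ0' (y : (kerPair (d' 0)).Y) : toLin (ψ 0) y.1 = -(toLin h (toLin e₃.hom y)).1 :=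
    hom_congr hψ0 y
  have hψ1 (y) : toLin (ψ 0) (toLin e₃.inv y).1 = -(toLin h y).1 := by
    rw [hψ0', toLin_iso_inv_hom]
  have hT := twist_isExactSeq hP hQ hψ
  let K₁ := complexOf P d hP
  let K₃ := complexOf Q d' hQ
  let K₂ := complexOf _ _ hT
  have hK₁ : diff K₁ = d := diff_complexOf hP
  have hK₂ : diff K₂ = twist d d' ψ := diff_complexOf hT
  have hK₃ : diff K₃ = d' := diff_complexOf hQ
  let f : K₁ ⟶ K₂ := chainMap (fun i => prodInl (P i) (Q i)) fun i => by
    rw [hK₁, hK₂]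
    refine hom_ext fun y => Prod.ext ?_ (map_zero (toLin (d' i)))
    change toLin (d i) y + toLin (ψ i) 0 = toLin (d i) y
    rw [map_zero, add_zero]
  let g : K₂ ⟶ K₃ := chainMap (fun i => prodSnd (P i) (Q i)) fun i => by
    rw [hK₂, hK₃]
    rfl
  let T : ShortComplex (CochainComplex (ProjPair k n) ℤ) := ShortComplex.mk f g (by ext i; rfl)
  let σ (i : ℤ) : (T.map (HomologicalComplex.eval _ _ i)).Splitting :=
    { r := ObjectProperty.homMk (prodFst (P i) (Q i))
      s := ObjectProperty.homMk (prodInr (P i) (Q i))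
      f_r := rfl
      s_g := rfl
      id := InducedCategory.hom_ext (prod_total (P i) (Q i)) }
  have hdist := (HomotopyCategory.distinguished_iff_iso_trianglehOfDegreewiseSplit _).2
    ⟨T, σ, ⟨Iso.refl _⟩⟩
  have hE₁ : exactComplexes k n ((HomotopyCategory.quotient _ _).obj K₁) :=
    (exactComplexes_iff K₁).2 (hK₁ ▸ hP)
  have hE₂ : exactComplexes k n ((HomotopyCategory.quotient _ _).obj K₂) :=
    (exactComplexes_iff K₂).2 (hK₂ ▸ hT)
  have hE₃ : exactComplexes k n ((HomotopyCategory.quotient _ _).obj K₃) :=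
    (exactComplexes_iff K₃).2 (hK₃ ▸ hQ)
  let f' : (⟨_, hE₁⟩ : (exactComplexes k n).FullSubcategory) ⟶ ⟨_, hE₂⟩ :=
    ObjectProperty.homMk ((HomotopyCategory.quotient _ _).map f)
  let g' : (⟨_, hE₂⟩ : (exactComplexes k n).FullSubcategory) ⟶ ⟨_, hE₃⟩ :=
    ObjectProperty.homMk ((HomotopyCategory.quotient _ _).map g)
  obtain ⟨t, ht⟩ := exists_distinguished_fullSubcategory f' g' _ hdist
  have w₁ (y) : toLin (diff K₁ 0) (toLin (e₁.inv ≫ kerIncl (d 0)) y) = 0 := by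
    rw [hK₁]
    exact toLin_kerIncl_mem _ _
  have w₃ (y) : toLin (diff K₃ 0) (toLin (e₃.inv ≫ kerIncl (d' 0)) y) = 0 := by
    rw [hK₃]
    exact toLin_kerIncl_mem _ _
  have w₂ (y) : toLin (diff K₂ 0)
      (toLin (prodLift e (S.g ≫ e₃.inv ≫ kerIncl (d' 0))) y) = 0 := by
    rw [hK₂]
    refine Prod.ext ?_ (toLin_kerIncl_mem (d' 0) _)
    change toLin (d 0) (toLin e y) + toLin (ψ 0) (toLin e₃.inv (toLin S.g y)).1 = 0
    rw [hψ1, hh', add_neg_cancel]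
  let l₁ : S.X₁ ⟶ (cocycles k n).obj K₁ := kerLift _ w₁
  let l₂ : S.X₂ ⟶ (cocycles k n).obj K₂ := kerLift _ w₂
  let l₃ : S.X₃ ⟶ (cocycles k n).obj K₃ := kerLift _ w₃
  have i₁ : IsIso l₁ := by
    refine isIso_kerLift w₁ (fun y y' h => ?_) (fun y hy => ?_) fun z hz => ?_
    · have := congrArg (toLin e₁.hom) (Subtype.ext h : toLin e₁.inv y = toLin e₁.inv y')
      rwa [toLin_iso_inv_hom, toLin_iso_inv_hom] at this
    · have : toLin e₁.hom (toLin e₁.inv y) ∈ S.X₁.X :=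
        toLin_mem e₁.hom (show toLin e₁.inv y ∈ (kerPair (d 0)).X from hy)
      rwa [toLin_iso_inv_hom] at this
    · rw [hK₁] at hz
      refine ⟨toLin e₁.hom ⟨z, LinearMap.mem_ker.2 hz⟩, ?_⟩
      change (toLin e₁.inv (toLin e₁.hom _)).1 = z
      rw [toLin_iso_hom_inv]
  have i₃ : IsIso l₃ := by
    refine isIso_kerLift w₃ (fun y y' h => ?_) (fun y hy => ?_) fun z hz => ?_
    · have := congrArg (toLin e₃.hom) (Subtype.ext h : toLin e₃.inv y = toLin e₃.inv y')
      rwa [toLin_iso_inv_hom, toLin_iso_inv_hom] at this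
    · have : toLin e₃.hom (toLin e₃.inv y) ∈ S.X₃.X :=
        toLin_mem e₃.hom (show toLin e₃.inv y ∈ (kerPair (d' 0)).X from hy)
      rwa [toLin_iso_inv_hom] at this
    · rw [hK₃] at hz
      refine ⟨toLin e₃.hom ⟨z, LinearMap.mem_ker.2 hz⟩, ?_⟩
      change (toLin e₃.inv (toLin e₃.hom _)).1 = z
      rw [toLin_iso_hom_inv]
  -- The five lemma, done by hand on `Y` and on the submodules. For the latter, `S.g y` is lifted to
  -- some `x` in the submodule of `X₂`, and `y - x` comes from an element of the submodule of `X₁`.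
  have i₂ : IsIso l₂ := by
    refine isIso_kerLift w₂ ?_ (fun y hy => ?_) fun z hz => ?_
    · refine (injective_iff_map_eq_zero _).2 fun y hy => ?_
      have h1 : toLin e y = 0 := congrArg Prod.fst hy
      have h2 : (toLin e₃.inv (toLin S.g y)).1 = 0 := congrArg Prod.snd hy
      obtain ⟨x, rfl⟩ := hc2 y (by
        rw [← toLin_iso_inv_hom e₃ (toLin S.g y), (Subtype.ext h2 : toLin e₃.inv _ = 0), map_zero])
      rw [he1] at h1
      rw [← toLin_iso_inv_hom e₁ x, (Subtype.ext h1 : toLin e₁.inv x = 0), map_zero, map_zero]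
    · have h1 : toLin e y ∈ (P 0).X := hy.1
      have h2 : toLin e₃.hom (toLin e₃.inv (toLin S.g y)) ∈ S.X₃.X :=
        toLin_mem e₃.hom (show toLin e₃.inv (toLin S.g y) ∈ (kerPair (d' 0)).X from hy.2)
      rw [toLin_iso_inv_hom] at h2
      obtain ⟨x, hx, hxy⟩ := hc5 _ h2
      obtain ⟨t, ht⟩ := hc2 (y - x) (by rw [map_sub, hxy, sub_self])
      have h3 : toLin e₁.inv t ∈ (kerPair (d 0)).X := by
        change (toLin e₁.inv t).1 ∈ (P 0).X
        rw [← he1, ht, map_sub]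
        exact sub_mem h1 (toLin_mem e hx)
      have h4 := toLin_mem S.f (toLin_mem e₁.hom h3)
      rw [toLin_iso_inv_hom, ht] at h4
      rw [← sub_add_cancel y x]
      exact add_mem h4 hx
    · rw [hK₂] at hz
      obtain ⟨a, c⟩ := z
      have h1 : toLin (d 0) a + toLin (ψ 0) c = 0 := congrArg Prod.fst hz
      have h2 : toLin (d' 0) c = 0 := congrArg Prod.snd hz
      let c' : (kerPair (d' 0)).Y := ⟨c, LinearMap.mem_ker.2 h2⟩
      obtain ⟨x, hx⟩ := hc3 (toLin e₃.hom c')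
      have h3 : toLin (ψ 0) c = -toLin (d 0) (toLin e x) := by
        rw [← hh', hx]
        exact hψ0' c'
      have h4 : toLin (d 0) (a - toLin e x) = 0 := by
        rw [map_sub, sub_eq_add_neg, ← h3, h1]
      let a' : (kerPair (d 0)).Y := ⟨a - toLin e x, LinearMap.mem_ker.2 h4⟩
      refine ⟨x + toLin S.f (toLin e₁.hom a'), Prod.ext ?_ ?_⟩
      · change toLin e (x + toLin S.f (toLin e₁.hom a')) = a
        rw [map_add, he1, toLin_iso_hom_inv]
        exact add_sub_cancel _ _
      · change (toLin e₃.inv (toLin S.g (x + toLin S.f (toLin e₁.hom a')))).1 = c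
        rw [map_add, hgf, add_zero, hx, toLin_iso_hom_inv]
  let E₁ : S.X₁ ≅ (cocycles k n).obj K₁ := asIso l₁
  let E₂ : S.X₂ ≅ (cocycles k n).obj K₂ := asIso l₂
  let E₃ : S.X₃ ≅ (cocycles k n).obj K₃ := asIso l₃
  refine ⟨_, _, _, f', g', t, (StableS.proj k n).mapIso E₁,
    (StableS.proj k n).mapIso E₂, (StableS.proj k n).mapIso E₃, ht, ?_, ?_⟩
  · change (StableS.proj k n).map S.f ≫ (StableS.proj k n).map l₂ =
      (StableS.proj k n).map l₁ ≫ (StableS.proj k n).map ((cocycles k n).map f)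
    rw [← Functor.map_comp, ← Functor.map_comp]
    refine congrArg _ (hom_ext fun y => Subtype.ext (Prod.ext (he1 y) ?_))
    change (toLin e₃.inv (toLin S.g (toLin S.f y))).1 = 0
    rw [hgf, map_zero]
    rfl
  · change (StableS.proj k n).map S.g ≫ (StableS.proj k n).map l₃ =
      (StableS.proj k n).map l₂ ≫ (StableS.proj k n).map ((cocycles k n).map g)
    rw [← Functor.map_comp, ← Functor.map_comp]
    rfl

/-- The stable category is triangulated, and conflations induce distinguished triangles. -/
theorem stable_triangulated (k : Type u) [Field k] (n : ℕ) :
    ∃ (_ : HasShift (StableS k n) ℤ)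
       (_ : ∀ m : ℤ, (shiftFunctor (StableS k n) m).Additive)
       (_ : Pretriangulated (StableS k n)),
      IsTriangulated (StableS k n) ∧
      ∀ S : ShortComplex (SubmodPair k n), SubmodPair.conflations k n S →
        ∃ h : (StableS.proj k n).obj S.X₃ ⟶
            (shiftFunctor (StableS k n) (1 : ℤ)).obj ((StableS.proj k n).obj S.X₁),
          Pretriangulated.Triangle.mk ((StableS.proj k n).map S.f) ((StableS.proj k n).map S.g) h ∈
            Pretriangulated.distinguishedTriangles := by
  have : (exactCocycles k n).IsEquivalence := { }
  obtain ⟨i₁, i₂, i₃, i₄, h₁, h₂⟩ := exists_triangulated_of_isEquivalence (exactCocycles k n)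
  refine ⟨i₁, i₂, i₃, h₁, fun S hS => ?_⟩
  obtain ⟨K₁, K₂, K₃, f, g, h, e₁, e₂, e₃, ht, hf, hg⟩ := exists_distinguished_triangle hS
  obtain ⟨m, hm⟩ : ∃ m : (exactCocycles k n).obj K₃ ⟶
      (shiftFunctor (StableS k n) (1 : ℤ)).obj ((exactCocycles k n).obj K₁),
      Triangle.mk ((exactCocycles k n).map f) ((exactCocycles k n).map g) m ∈
        distinguishedTriangles := ⟨_, (exactCocycles k n).map_distinguished _ ht⟩
  refine ⟨e₃.hom ≫ m ≫ (shiftFunctor (StableS k n) (1 : ℤ)).map e₁.inv, ?_⟩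
  refine isomorphic_distinguished _ hm _ (Triangle.isoMk _ _ e₁ e₂ e₃ hf hg ?_)
  change (e₃.hom ≫ m ≫ (shiftFunctor (StableS k n) (1 : ℤ)).map e₁.inv) ≫
    (shiftFunctor (StableS k n) (1 : ℤ)).map e₁.hom = e₃.hom ≫ m
  rw [Category.assoc, Category.assoc, ← Functor.map_comp, e₁.inv_hom_id,
    CategoryTheory.Functor.map_id, Category.comp_id]

end SubmodPair

/-! ### The preprojective algebra -/

namespace PreprojA

variable {k : Type u} [Field k] {m : ℕ}

/-- The generators of the preprojective algebra. -/
noncomputable def gen (k : Type u) [Field k] {m : ℕ} (g : DoubleA m) : PreprojA k m :=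
  RingQuot.mkAlgHom k (PreprojRel k m) (FreeAlgebra.ι k g)

theorem induction {C : PreprojA k m → Prop} (p : PreprojA k m)
    (algebraMap : ∀ c : k, C (algebraMap k _ c)) (gen : ∀ g, C (gen k g))
    (mul : ∀ p q, C p → C q → C (p * q)) (add : ∀ p q, C p → C q → C (p + q)) : C p := by
  obtain ⟨q, rfl⟩ := RingQuot.mkAlgHom_surjective k _ p
  induction q using FreeAlgebra.induction with
  | grade0 c => rw [AlgHom.commutes]; exact algebraMap c
  | grade1 g => exact gen g
  | mul p q hp hq => rw [map_mul]; exact mul _ _ hp hq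
  | add p q hp hq => rw [map_add]; exact add _ _ hp hq

theorem rel {p q : FreeAlgebra k (DoubleA m)} (h : PreprojRel k m p q) :
    RingQuot.mkAlgHom k (PreprojRel k m) p = RingQuot.mkAlgHom k (PreprojRel k m) q :=
  RingQuot.mkAlgHom_rel k h

/-- The idempotent of the vertex `i`, which is zero for `m ≤ i`. -/
noncomputable def vert (k : Type u) [Field k] (m i : ℕ) : PreprojA k m :=
  if h : i < m then gen k (.e ⟨i, h⟩) else 0

theorem vert_fin (i : Fin m) : vert k m i = gen k (.e i) := dif_pos i.2

theorem vert_of_le {i : ℕ} (h : m ≤ i) : vert k m i = 0 := dif_neg (by omega)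

theorem vert_mul_self (i : ℕ) : vert k m i * vert k m i = vert k m i := by
  by_cases h : i < m
  · have := rel (PreprojRel.idem (k := k) (m := m) ⟨i, h⟩)
    rw [map_mul] at this
    rw [vert, dif_pos h]
    exact this
  · rw [vert, dif_neg h, mul_zero]

theorem vert_mul_of_ne {i j : ℕ} (hij : i ≠ j) : vert k m i * vert k m j = 0 := by
  by_cases h : i < m
  · by_cases h' : j < m
    · have := rel (PreprojRel.orth (k := k) (m := m) ⟨i, h⟩ ⟨j, h'⟩ (by simpa using hij))
      rw [map_mul, map_zero] at this
      rw [vert, vert, dif_pos h, dif_pos h']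
      exact this
    · rw [vert_of_le (not_lt.1 h'), mul_zero]
  · rw [vert_of_le (not_lt.1 h), zero_mul]

theorem sum_vert : ∑ i : Fin m, vert k m i = 1 := by
  have := rel (PreprojRel.one (k := k) (m := m))
  rw [map_sum, map_one] at this
  simp only [vert_fin]
  exact this

theorem a_mul_vert (i : Fin (m - 1)) : gen k (.a i) * vert k m i = gen k (.a i) := by
  have := rel (PreprojRel.a_src (k := k) (m := m) i)
  rw [map_mul] at this
  rw [show vert k m i = gen k (.e (DoubleA.src i)) from vert_fin (DoubleA.src i)]
  exact this

theorem vert_mul_a (i : Fin (m - 1)) : vert k m (i + 1) * gen k (.a i) = gen k (.a i) := by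
  have := rel (PreprojRel.a_tgt (k := k) (m := m) i)
  rw [map_mul] at this
  rw [show vert k m (i + 1) = gen k (.e (DoubleA.tgt i)) from vert_fin (DoubleA.tgt i)]
  exact this

theorem b_mul_vert (i : Fin (m - 1)) : gen k (.b i) * vert k m (i + 1) = gen k (.b i) := by
  have := rel (PreprojRel.b_src (k := k) (m := m) i)
  rw [map_mul] at this
  rw [show vert k m (i + 1) = gen k (.e (DoubleA.tgt i)) from vert_fin (DoubleA.tgt i)]
  exact this

theorem vert_mul_b (i : Fin (m - 1)) : vert k m i * gen k (.b i) = gen k (.b i) := by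
  have := rel (PreprojRel.b_tgt (k := k) (m := m) i)
  rw [map_mul] at this
  rw [show vert k m i = gen k (.e (DoubleA.src i)) from vert_fin (DoubleA.src i)]
  exact this

/-- The sum of the arrows `i → i + 1`. -/
noncomputable def A (k : Type u) [Field k] (m : ℕ) : PreprojA k m :=
  ∑ i : Fin (m - 1), gen k (.a i)

/-- The sum of the arrows `i + 1 → i`. -/
noncomputable def B (k : Type u) [Field k] (m : ℕ) : PreprojA k m :=
  ∑ i : Fin (m - 1), gen k (.b i)

theorem A_mul_vert_fin (i : Fin (m - 1)) : A k m * vert k m i = gen k (.a i) := by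
  rw [A, Finset.sum_mul, Finset.sum_eq_single i, a_mul_vert]
  · intro j _ h
    rw [← a_mul_vert, mul_assoc, vert_mul_of_ne (by simpa [Fin.ext_iff] using h), mul_zero]
  · simp

theorem vert_mul_A_fin (i : Fin (m - 1)) : vert k m (i + 1) * A k m = gen k (.a i) := by
  rw [A, Finset.mul_sum, Finset.sum_eq_single i, vert_mul_a]
  · intro j _ h
    rw [← vert_mul_a, ← mul_assoc,
      vert_mul_of_ne (by simpa [Fin.ext_iff] using Ne.symm h), zero_mul]
  · simp

theorem B_mul_vert_fin (i : Fin (m - 1)) : B k m * vert k m (i + 1) = gen k (.b i) := by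
  rw [B, Finset.sum_mul, Finset.sum_eq_single i, b_mul_vert]
  · intro j _ h
    rw [← b_mul_vert, mul_assoc, vert_mul_of_ne (by simpa [Fin.ext_iff] using h), mul_zero]
  · simp

theorem vert_mul_B_fin (i : Fin (m - 1)) : vert k m i * B k m = gen k (.b i) := by
  rw [B, Finset.mul_sum, Finset.sum_eq_single i, vert_mul_b]
  · intro j _ h
    rw [← vert_mul_b, ← mul_assoc,
      vert_mul_of_ne (by simpa [Fin.ext_iff] using Ne.symm h), zero_mul]
  · simp

/-- No bound on `i` is needed: when `vert k m (i + 1)` is zero by convention, no arrow `a` starts at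
the vertex `i` either. -/
theorem A_mul_vert (i : ℕ) : A k m * vert k m i = vert k m (i + 1) * A k m := by
  by_cases h : i < m - 1
  · exact (A_mul_vert_fin ⟨i, h⟩).trans (vert_mul_A_fin ⟨i, h⟩).symm
  · rw [vert_of_le (i := i + 1) (by omega), zero_mul, A, Finset.sum_mul]
    refine Finset.sum_eq_zero fun j _ => ?_
    rw [← a_mul_vert, mul_assoc, vert_mul_of_ne (by omega), mul_zero]

theorem B_mul_vert_succ (i : ℕ) : B k m * vert k m (i + 1) = vert k m i * B k m := by
  by_cases h : i < m - 1
  · exact (B_mul_vert_fin ⟨i, h⟩).trans (vert_mul_B_fin ⟨i, h⟩).symm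
  · rw [vert_of_le (i := i + 1) (by omega), mul_zero, B, Finset.mul_sum]
    refine (Finset.sum_eq_zero fun j _ => ?_).symm
    rw [← vert_mul_b, ← mul_assoc, vert_mul_of_ne (by omega), zero_mul]

theorem B_mul_vert_zero : B k m * vert k m 0 = 0 := by
  rw [B, Finset.sum_mul]
  refine Finset.sum_eq_zero fun j _ => ?_
  rw [← b_mul_vert, mul_assoc, vert_mul_of_ne (by omega), mul_zero]

/-- By orthogonality of the vertices only the products `a i * b i`, respectively `b i * a i`,
survive, so the preprojective relation says exactly that `A` and `B` commute. -/
theorem A_mul_B : A k m * B k m = B k m * A k m := by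
  have h1 : A k m * B k m = ∑ i : Fin (m - 1), gen k (.a i) * gen k (.b i) := by
    rw [B, Finset.mul_sum]
    refine Finset.sum_congr rfl fun i _ => ?_
    conv_lhs => rw [← vert_mul_b, ← mul_assoc, A_mul_vert_fin]
  have h2 : B k m * A k m = ∑ i : Fin (m - 1), gen k (.b i) * gen k (.a i) := by
    rw [A, Finset.mul_sum]
    refine Finset.sum_congr rfl fun i _ => ?_
    conv_lhs => rw [← vert_mul_a, ← mul_assoc, B_mul_vert_fin]
  have := rel (PreprojRel.preproj (k := k) (m := m))
  rw [map_zero, map_sum] at this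
  simp only [map_sub, map_mul] at this
  rw [Finset.sum_sub_distrib, sub_eq_zero] at this
  rw [h1, h2]
  exact this

theorem A_commute_B : Commute (A k m) (B k m) := A_mul_B

theorem A_pow_mul_vert (s i : ℕ) : A k m ^ s * vert k m i = vert k m (i + s) * A k m ^ s := by
  induction s generalizing i with
  | zero => simp
  | succ s ih => rw [pow_succ, mul_assoc, A_mul_vert, ← mul_assoc, ih, mul_assoc, add_right_comm,
      add_assoc i s 1]

theorem B_pow_mul_vert (s i : ℕ) : B k m ^ s * vert k m (i + s) = vert k m i * B k m ^ s := by
  induction s generalizing i with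
  | zero => simp
  | succ s ih => rw [pow_succ, mul_assoc, ← add_assoc, B_mul_vert_succ, ← mul_assoc, ih, mul_assoc]

theorem A_pow_mul_vert_eq_zero {s i : ℕ} (h : m ≤ i + s) : A k m ^ s * vert k m i = 0 := by
  rw [A_pow_mul_vert, vert_of_le h, zero_mul]

theorem B_pow_mul_vert_eq_zero {s i : ℕ} (h : i < s) : B k m ^ s * vert k m i = 0 := by
  obtain ⟨r, rfl⟩ : ∃ r, s = r + 1 + i := ⟨s - 1 - i, by omega⟩
  have := B_pow_mul_vert (k := k) (m := m) i 0
  rw [zero_add] at this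
  rw [pow_add, mul_assoc, this, pow_succ, mul_assoc, ← mul_assoc (B k m), B_mul_vert_zero, zero_mul,
    mul_zero]

theorem A_pow_eq_zero {s : ℕ} (h : m ≤ s) : A k m ^ s = 0 := by
  rw [← mul_one (A k m ^ s), ← sum_vert, Finset.mul_sum]
  exact Finset.sum_eq_zero fun i _ => A_pow_mul_vert_eq_zero (by omega)

/-- The element `A ^ (i - j) * B ^ (j - i)`, which maps the vertex `j` to the vertex `i`. -/
noncomputable def path (k : Type u) [Field k] (m i j : ℕ) : PreprojA k m :=
  A k m ^ (i - j) * B k m ^ (j - i)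

theorem path_self (i : ℕ) : path k m i i = 1 := by simp [path]

theorem path_succ (i : ℕ) : path k m (i + 1) i = A k m := by simp [path]

theorem path_pred (i : ℕ) : path k m i (i + 1) = B k m := by simp [path]

theorem path_mul_vert (i j : ℕ) : path k m i j * vert k m j = vert k m i * path k m i j := by
  rcases le_total i j with h | h
  · obtain ⟨s, rfl⟩ := Nat.exists_eq_add_of_le h
    rw [path, Nat.sub_eq_zero_of_le h, pow_zero, one_mul, Nat.add_sub_cancel_left, B_pow_mul_vert]
  · obtain ⟨s, rfl⟩ := Nat.exists_eq_add_of_le h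
    rw [path, Nat.sub_eq_zero_of_le h, pow_zero, mul_one, Nat.add_sub_cancel_left, A_pow_mul_vert]

theorem A_mul_B_pow_mul_path (s i j : ℕ) :
    (A k m * B k m) ^ s * path k m i j = A k m ^ (s + (i - j)) * B k m ^ (s + (j - i)) := by
  rw [path, A_commute_B.mul_pow, pow_add, pow_add, mul_assoc, mul_assoc,
    (A_commute_B.pow_pow (i - j) s).symm.left_comm]

/-- The exponent counts the factors `B` exceeding those of the direct path; each of them is
accompanied by one excess factor `A`. -/
theorem path_mul_path (i j l : ℕ) : path k m i j * path k m j l =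
    (A k m * B k m) ^ ((j - i) + (l - j) - (l - i)) * path k m i l := by
  rw [A_mul_B_pow_mul_path, path, path, mul_assoc,
    (A_commute_B.pow_pow (j - l) (j - i)).symm.left_comm, ← mul_assoc, ← pow_add, ← pow_add]
  congr 2 <;> omega

theorem A_mul_B_pow_mul_path_mul_vert {s i j : ℕ} (h : j < s + (j - i)) :
    (A k m * B k m) ^ s * path k m i j * vert k m j = 0 := by
  rw [A_mul_B_pow_mul_path, mul_assoc, B_pow_mul_vert_eq_zero h, mul_zero]

/-- `A * B` commutes with `A` and `B`, and with the vertices because it returns to the starting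
vertex; at the vertex `0` both products vanish. Every arrow is the product of `A` or `B` with a
vertex. -/
theorem A_mul_B_central (p : PreprojA k m) : Commute (A k m * B k m) p := by
  have hA : Commute (A k m * B k m) (A k m) := (Commute.refl _).mul_left A_commute_B.symm
  have hB : Commute (A k m * B k m) (B k m) := A_commute_B.mul_left (Commute.refl _)
  have he (i : ℕ) : Commute (A k m * B k m) (vert k m i) := by
    cases i with
    | zero =>
      change _ * _ = _ * _
      rw [mul_assoc, B_mul_vert_zero, mul_zero, A_mul_B, ← mul_assoc]
      by_cases h : m = 0
      · subst h
        rw [vert_of_le le_rfl, zero_mul, zero_mul]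
      · have h0 : vert k m 0 * B k m = B k m * vert k m (0 + 1) := (B_mul_vert_succ 0).symm
        rw [h0, mul_assoc, ← A_mul_vert, ← mul_assoc, ← A_mul_B, mul_assoc, B_mul_vert_zero,
          mul_zero]
    | succ i =>
      change _ * _ = _ * _
      rw [mul_assoc, B_mul_vert_succ, ← mul_assoc, A_mul_vert, mul_assoc]
  induction p using induction with
  | algebraMap c => exact (Algebra.commutes c _).symm
  | gen g =>
    cases g with
    | e i => rw [← vert_fin]; exact he i
    | a i => rw [← A_mul_vert_fin]; exact hA.mul_right (he i)
    | b i => rw [← B_mul_vert_fin]; exact hB.mul_right (he _)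
  | mul p q hp hq => exact hp.mul_right hq
  | add p q hp hq => exact hp.add_right hq

/-- The central map `Λ_n → Π_{n - 1}`, `x ↦ A B`. -/
noncomputable def ofTrunc (k : Type u) [Field k] (n : ℕ) : TruncPoly k n →ₐ[k] PreprojA k (n - 1) :=
  Ideal.Quotient.liftₐ _ (Polynomial.aeval (A k (n - 1) * B k (n - 1))) fun p hp => by
    obtain ⟨q, rfl⟩ := Ideal.mem_span_singleton.1 hp
    rw [map_mul, map_pow, Polynomial.aeval_X, A_commute_B.mul_pow, A_pow_eq_zero (by omega),
      zero_mul, zero_mul]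

theorem ofTrunc_x (n : ℕ) : ofTrunc k n (TruncPoly.x k n) = A k (n - 1) * B k (n - 1) := by
  change Polynomial.aeval (A k (n - 1) * B k (n - 1)) Polynomial.X = _
  rw [Polynomial.aeval_X]

theorem ofTrunc_x_pow (n s : ℕ) :
    ofTrunc k n (TruncPoly.x k n ^ s) = (A k (n - 1) * B k (n - 1)) ^ s := by
  rw [map_pow, ofTrunc_x]

theorem ofTrunc_central {n : ℕ} (c : TruncPoly k n) (p : PreprojA k (n - 1)) :
    Commute (ofTrunc k n c) p := by
  obtain ⟨c, rfl⟩ := TruncPoly.mk_surjective c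
  change Commute (Polynomial.aeval (A k (n - 1) * B k (n - 1)) c) p
  induction c using Polynomial.induction_on with
  | C a => rw [Polynomial.aeval_C]; exact Algebra.commutes a p
  | add f g hf hg => rw [map_add]; exact hf.add_left hg
  | monomial s a _ =>
    rw [map_mul, map_pow, Polynomial.aeval_C, Polynomial.aeval_X]
    exact Commute.mul_left (Algebra.commutes a p) ((A_mul_B_central p).pow_left _)

end PreprojA

/-! ### The module over the preprojective algebra attached to a linear map -/

section Phi

open TruncPoly PreprojA

variable {k : Type u} [Field k] {n : ℕ} {Y Z : Type u} [AddCommGroup Y] [AddCommGroup Z]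
  [Module (TruncPoly k n) Y] [Module (TruncPoly k n) Z]

/-- The submodule of the elements of `Z` annihilated by `x ^ (i + 1)`. -/
noncomputable abbrev xTorsion (k : Type u) [Field k] (n : ℕ) (Z : Type u) [AddCommGroup Z]
    [Module (TruncPoly k n) Z] (i : ℕ) : Submodule (TruncPoly k n) Z :=
  Submodule.torsionBy (TruncPoly k n) Z (x k n ^ (i + 1))

theorem mem_xTorsion {i : ℕ} {z : Z} : z ∈ xTorsion k n Z i ↔ x k n ^ (i + 1) • z = 0 :=
  Submodule.mem_torsionBy_iff _ _

theorem x_pow_smul_eq_zero_of_le {i j : ℕ} {z : Z} (h : x k n ^ i • z = 0) (hij : i ≤ j) :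
    x k n ^ j • z = 0 := by
  rw [← Nat.sub_add_cancel hij, pow_add, mul_smul, h, smul_zero]

theorem x_pow_smul_mem_xTorsion {i j : ℕ} {z : Z} (h : z ∈ xTorsion k n Z j) :
    x k n ^ (j - i) • z ∈ xTorsion k n Z i := by
  rw [mem_xTorsion, smul_smul, ← pow_add]
  exact x_pow_smul_eq_zero_of_le (mem_xTorsion.1 h) (by omega)

variable (g : Y →ₗ[TruncPoly k n] Z)

/-- The submodule `x ^ (n - (i + 1)) Z + g(Y_i)`, where `Y_i` is annihilated by `x ^ (i + 1)`. -/
noncomputable def phiRel (i : ℕ) : Submodule (TruncPoly k n) Z :=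
  LinearMap.range (LinearMap.lsmul (TruncPoly k n) Z (x k n ^ (n - (i + 1)))) ⊔
    (xTorsion k n Y i).map g

variable {g}

theorem mem_phiRel {i : ℕ} {z : Z} : z ∈ phiRel g i ↔
    ∃ (w : Z) (y : Y), x k n ^ (i + 1) • y = 0 ∧ x k n ^ (n - (i + 1)) • w + g y = z := by
  rw [phiRel, Submodule.mem_sup]
  constructor
  · rintro ⟨_, ⟨w, rfl⟩, _, ⟨y, hy, rfl⟩, h⟩
    exact ⟨w, y, mem_xTorsion.1 hy, h⟩
  · rintro ⟨w, y, hy, h⟩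
    exact ⟨_, ⟨w, rfl⟩, _, ⟨y, mem_xTorsion.2 hy, rfl⟩, h⟩

theorem x_pow_smul_mem_phiRel {i s : ℕ} (h : n ≤ s + (i + 1)) (w : Z) :
    x k n ^ s • w ∈ phiRel g i :=
  mem_phiRel.2 ⟨x k n ^ (s - (n - (i + 1))) • w, 0, smul_zero _, by
    rw [map_zero, add_zero, smul_smul, ← pow_add]
    congr 2
    omega⟩

theorem map_mem_phiRel {i : ℕ} {y : Y} (h : x k n ^ (i + 1) • y = 0) : g y ∈ phiRel g i :=
  mem_phiRel.2 ⟨0, y, h, by rw [smul_zero, zero_add]⟩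

/-- The vertex `n - 1` would correspond to the projective module `[n]`, where stable morphisms
vanish. This permits indexing by all natural numbers. -/
theorem mem_phiRel_of_le {i : ℕ} (h : n ≤ i + 1) (z : Z) : z ∈ phiRel g i := by
  rw [← one_smul (TruncPoly k n) z, ← pow_zero (x k n)]
  exact x_pow_smul_mem_phiRel (by omega) z

theorem x_pow_smul_mem_phiRel_of_mem {i j : ℕ} {z : Z} (h : z ∈ phiRel g j) :
    x k n ^ (j - i) • z ∈ phiRel g i := by
  obtain ⟨w, y, hy, rfl⟩ := mem_phiRel.1 h
  rw [smul_add, smul_smul, ← pow_add, ← map_smul]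
  refine add_mem (x_pow_smul_mem_phiRel (by omega) _) (map_mem_phiRel ?_)
  exact mem_xTorsion.1 (x_pow_smul_mem_xTorsion (mem_xTorsion.2 hy))

variable (g)

/-- The component of `Phi g` at the vertex `i`. -/
abbrev PhiAt (i : ℕ) : Type u :=
  xTorsion k n Z i ⧸ (phiRel g i).comap (xTorsion k n Z i).subtype

/-- The map induced by multiplication with `x ^ (j - i)`. -/
noncomputable def xShift (i j : ℕ) : xTorsion k n Z j →ₗ[TruncPoly k n] xTorsion k n Z i :=
  (LinearMap.lsmul (TruncPoly k n) Z (x k n ^ (j - i))).restrict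
    fun _ h => x_pow_smul_mem_xTorsion h

theorem xShift_val (i j : ℕ) (z : xTorsion k n Z j) :
    (xShift i j z : Z) = x k n ^ (j - i) • (z : Z) := rfl

/-- The map `PhiAt g j → PhiAt g i` induced by multiplication with `x ^ (j - i)`. -/
noncomputable def phiShift (i j : ℕ) : PhiAt g j →ₗ[TruncPoly k n] PhiAt g i :=
  Submodule.mapQ _ _ (xShift i j) fun _ h => x_pow_smul_mem_phiRel_of_mem h

theorem phiShift_phiShift (i j : ℕ) (z : PhiAt g i) :
    phiShift g i j (phiShift g j i z) = x k n ^ ((j - i) + (i - j)) • z := by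
  obtain ⟨z, rfl⟩ := Submodule.mkQ_surjective _ z
  refine congrArg (Submodule.Quotient.mk) (Subtype.ext ?_)
  change x k n ^ (j - i) • x k n ^ (i - j) • (z : Z) = x k n ^ ((j - i) + (i - j)) • (z : Z)
  rw [pow_add, mul_smul]

/-- At both ends of the quiver `x` acts by zero: at the vertex `0` since elements are killed by `x`,
at the last one since `x Z` belongs to the relations. -/
theorem x_smul_phiAt_zero (z : PhiAt g 0) : x k n • z = 0 := by
  obtain ⟨z, rfl⟩ := Submodule.mkQ_surjective _ z
  have : x k n • z = 0 := Subtype.ext (by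
    have := mem_xTorsion.1 z.2
    rw [zero_add, pow_one] at this
    exact this)
  rw [← map_smul, this, map_zero]

theorem x_smul_phiAt_last {i : ℕ} (hi : n ≤ i + 2) (z : PhiAt g i) : x k n • z = 0 := by
  obtain ⟨z, rfl⟩ := Submodule.mkQ_surjective _ z
  rw [← map_smul]
  refine (Submodule.Quotient.mk_eq_zero _).2 ?_
  change x k n • (z : Z) ∈ phiRel g i
  rw [← pow_one (x k n)]
  exact x_pow_smul_mem_phiRel (by omega) _

/-- The underlying `Λ_n`-module of `Phi g`. -/
abbrev PhiFun : Type u := ∀ i : Fin (n - 1), PhiAt g i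

/-- The inclusion of a component. -/
noncomputable abbrev phiSingle (i : Fin (n - 1)) : PhiAt g i →ₗ[TruncPoly k n] PhiFun g :=
  LinearMap.single _ (fun i : Fin (n - 1) => PhiAt g i) i

theorem phiSingle_same (i : Fin (n - 1)) (z : PhiAt g i) : phiSingle g i z i = z :=
  Pi.single_eq_same (M := fun i : Fin (n - 1) => PhiAt g i) i z

theorem phiSingle_of_ne {i j : Fin (n - 1)} (h : j ≠ i) (z : PhiAt g i) : phiSingle g i z j = 0 :=
  Pi.single_eq_of_ne (M := fun i : Fin (n - 1) => PhiAt g i) h z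

theorem sum_phiSingle (μ : PhiFun g) : ∑ i, phiSingle g i (μ i) = μ :=
  Finset.univ_sum_single (M := fun i : Fin (n - 1) => PhiAt g i) μ

/-- The action of the generators of the preprojective algebra. -/
noncomputable def phiGen : DoubleA (n - 1) → Module.End (TruncPoly k n) (PhiFun g)
  | .e i => phiSingle g i ∘ₗ LinearMap.proj i
  | .a i => phiSingle g (DoubleA.tgt i) ∘ₗ
      phiShift g (DoubleA.tgt i) (DoubleA.src i) ∘ₗ LinearMap.proj (DoubleA.src i)
  | .b i => phiSingle g (DoubleA.src i) ∘ₗ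
      phiShift g (DoubleA.src i) (DoubleA.tgt i) ∘ₗ LinearMap.proj (DoubleA.tgt i)

theorem phiGen_e (i : Fin (n - 1)) (μ : PhiFun g) : phiGen g (.e i) μ = phiSingle g i (μ i) := rfl

theorem phiGen_a (i : Fin (n - 1 - 1)) (μ : PhiFun g) : phiGen g (.a i) μ =
    phiSingle g (DoubleA.tgt i) (phiShift g (DoubleA.tgt i) (DoubleA.src i) (μ (DoubleA.src i))) :=
  rfl

theorem phiGen_b (i : Fin (n - 1 - 1)) (μ : PhiFun g) : phiGen g (.b i) μ =
    phiSingle g (DoubleA.src i) (phiShift g (DoubleA.src i) (DoubleA.tgt i) (μ (DoubleA.tgt i))) :=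
  rfl

theorem phiShift_tgt_src (i : Fin (n - 1 - 1)) (z : PhiAt g (DoubleA.tgt i)) :
    phiShift g (DoubleA.tgt i) (DoubleA.src i) (phiShift g (DoubleA.src i) (DoubleA.tgt i) z)
      = x k n • z := by
  rw [phiShift_phiShift, show ((DoubleA.src i : ℕ) - (DoubleA.tgt i : ℕ)) +
    ((DoubleA.tgt i : ℕ) - (DoubleA.src i : ℕ)) = 1 by simp [DoubleA.src, DoubleA.tgt], pow_one]

theorem phiShift_src_tgt (i : Fin (n - 1 - 1)) (z : PhiAt g (DoubleA.src i)) :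
    phiShift g (DoubleA.src i) (DoubleA.tgt i) (phiShift g (DoubleA.tgt i) (DoubleA.src i) z)
      = x k n • z := by
  rw [phiShift_phiShift, show ((DoubleA.tgt i : ℕ) - (DoubleA.src i : ℕ)) +
    ((DoubleA.src i : ℕ) - (DoubleA.tgt i : ℕ)) = 1 by simp [DoubleA.src, DoubleA.tgt], pow_one]

theorem phiGen_a_b (i : Fin (n - 1 - 1)) (μ : PhiFun g) :
    phiGen g (.a i) (phiGen g (.b i) μ) = x k n • phiGen g (.e (DoubleA.tgt i)) μ := by
  rw [phiGen_a, phiGen_b, phiGen_e, phiSingle_same, phiShift_tgt_src, map_smul]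

theorem phiGen_b_a (i : Fin (n - 1 - 1)) (μ : PhiFun g) :
    phiGen g (.b i) (phiGen g (.a i) μ) = x k n • phiGen g (.e (DoubleA.src i)) μ := by
  rw [phiGen_a, phiGen_b, phiGen_e, phiSingle_same, phiShift_src_tgt, map_smul]

theorem x_smul_phiGen_e {i : Fin (n - 1)} (h : (i : ℕ) = 0 ∨ n ≤ i + 2) (μ : PhiFun g) :
    x k n • phiGen g (.e i) μ = 0 := by
  rw [phiGen_e, ← map_smul]
  refine (congrArg _ ?_).trans (map_zero (phiSingle g i))
  rcases h with h | h
  · obtain ⟨i, hi⟩ := i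
    obtain rfl : i = 0 := h
    exact x_smul_phiAt_zero g _
  · exact x_smul_phiAt_last g h _

/-- Both `a b` and `b a` are multiplication by `x`, at neighbouring vertices, so the sum telescopes
to the two ends, where `x` acts by zero. -/
theorem phiGen_preproj (μ : PhiFun g) : ∑ i : Fin (n - 1 - 1),
    (phiGen g (.a i) (phiGen g (.b i) μ) - phiGen g (.b i) (phiGen g (.a i) μ)) = 0 := by
  let E (i : ℕ) : PhiFun g := if h : i < n - 1 then x k n • phiGen g (.e ⟨i, h⟩) μ else 0
  have hE1 (i : Fin (n - 1)) : E i = x k n • phiGen g (.e i) μ := dif_pos i.2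
  have hE (i : Fin (n - 1 - 1)) :
      phiGen g (.a i) (phiGen g (.b i) μ) - phiGen g (.b i) (phiGen g (.a i) μ)
        = E (i + 1) - E i := by
    rw [phiGen_a_b, phiGen_b_a]
    exact congrArg₂ _ (hE1 (DoubleA.tgt i)).symm (hE1 (DoubleA.src i)).symm
  have hE0 {i : ℕ} (h : i = 0 ∨ n ≤ i + 2) : E i = 0 := by
    by_cases hi : i < n - 1
    · exact (hE1 ⟨i, hi⟩).trans (x_smul_phiGen_e g (i := ⟨i, hi⟩) h μ)
    · exact dif_neg hi
  rw [Finset.sum_congr rfl fun i _ => hE i,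
    Fin.sum_univ_eq_sum_range (fun i => E (i + 1) - E i), Finset.sum_range_sub,
    hE0 (by omega), hE0 (by omega), sub_zero]

theorem phiGen_sum (μ : PhiFun g) : ∑ i, phiGen g (.e i) μ = μ := sum_phiSingle g μ

/-- The `k`-algebra structure on the endomorphism ring of a `Λ_n`-module. -/
noncomputable abbrev endAlgebra (k : Type u) [Field k] (n : ℕ) (M : Type u) [AddCommGroup M]
    [Module (TruncPoly k n) M] : Algebra k (Module.End (TruncPoly k n) M) :=
  Algebra.compHom _ (algebraMap k (TruncPoly k n))

/-- The action of the preprojective algebra. -/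
noncomputable def phiAct : PreprojA k (n - 1) →+* Module.End (TruncPoly k n) (PhiFun g) :=
  let _ := endAlgebra k n (PhiFun g)
  (RingQuot.liftAlgHom k ⟨FreeAlgebra.lift k (phiGen g), fun p q h => LinearMap.ext fun μ => by
    cases h with
    | idem i =>
      simp only [map_mul, FreeAlgebra.lift_ι_apply]
      exact congrArg (phiSingle g i) (phiSingle_same g i (μ i))
    | orth i j h =>
      simp only [map_mul, FreeAlgebra.lift_ι_apply, map_zero]
      exact (congrArg _ (phiSingle_of_ne g h (μ j))).trans (map_zero (phiSingle g i))
    | one =>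
      simp only [map_sum, FreeAlgebra.lift_ι_apply, map_one]
      exact (LinearMap.sum_apply _ _ _).trans (phiGen_sum g μ)
    | a_src i =>
      simp only [map_mul, FreeAlgebra.lift_ι_apply]
      change phiGen g (.a i) (phiGen g (.e (DoubleA.src i)) μ) = phiGen g (.a i) μ
      rw [phiGen_a, phiGen_e, phiSingle_same, phiGen_a]
    | a_tgt i =>
      simp only [map_mul, FreeAlgebra.lift_ι_apply]
      change phiGen g (.e (DoubleA.tgt i)) (phiGen g (.a i) μ) = phiGen g (.a i) μ
      rw [phiGen_a, phiGen_e, phiSingle_same]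
    | b_src i =>
      simp only [map_mul, FreeAlgebra.lift_ι_apply]
      change phiGen g (.b i) (phiGen g (.e (DoubleA.tgt i)) μ) = phiGen g (.b i) μ
      rw [phiGen_b, phiGen_e, phiSingle_same, phiGen_b]
    | b_tgt i =>
      simp only [map_mul, FreeAlgebra.lift_ι_apply]
      change phiGen g (.e (DoubleA.src i)) (phiGen g (.b i) μ) = phiGen g (.b i) μ
      rw [phiGen_b, phiGen_e, phiSingle_same]
    | preproj =>
      simp only [map_sum, map_sub, map_mul, FreeAlgebra.lift_ι_apply, map_zero]
      exact (LinearMap.sum_apply _ _ _).trans (phiGen_preproj g μ)⟩).toRingHom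

theorem phiAct_gen (a : DoubleA (n - 1)) : phiAct g (PreprojA.gen k a) = phiGen g a := by
  let _ := endAlgebra k n (PhiFun g)
  exact (RingQuot.liftAlgHom_mkAlgHom_apply k _ _ _).trans (FreeAlgebra.lift_ι_apply _ _)

theorem phiAct_algebraMap (c : k) (μ : PhiFun g) :
    phiAct g (algebraMap k _ c) μ = algebraMap k (TruncPoly k n) c • μ := by
  let _ := endAlgebra k n (PhiFun g)
  exact congrArg (fun f : Module.End (TruncPoly k n) (PhiFun g) => f μ)
    (AlgHom.commutes (RingQuot.liftAlgHom k _) c)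

end Phi

namespace PreprojA

variable {k : Type u} [Field k] {m : ℕ}

/-- Scalars, vertices and the two elements `A` and `B` generate, since each arrow is `A` or `B`
times the vertex where it starts. -/
theorem map_smul_of_forall {M M' : Type*} [AddCommGroup M] [AddCommGroup M']
    [Module (PreprojA k m) M] [Module (PreprojA k m) M'] (f : M →+ M')
    (hc : ∀ (c : k) μ, f (algebraMap k (PreprojA k m) c • μ) = algebraMap k (PreprojA k m) c • f μ)
    (hv : ∀ i μ, f (vert k m i • μ) = vert k m i • f μ)
    (hA : ∀ μ, f (A k m • μ) = A k m • f μ) (hB : ∀ μ, f (B k m • μ) = B k m • f μ)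
    (p : PreprojA k m) (μ : M) : f (p • μ) = p • f μ := by
  induction p using induction generalizing μ with
  | algebraMap c => exact hc c μ
  | gen g =>
    cases g with
    | e i => rw [← vert_fin, hv]
    | a i => rw [← A_mul_vert_fin, mul_smul, mul_smul, hA, hv]
    | b i => rw [← B_mul_vert_fin, mul_smul, mul_smul, hB, hv]
  | mul p q hp hq => rw [mul_smul, mul_smul, hp, hq]
  | add p q hp hq => rw [add_smul, add_smul, map_add, hp, hq]

end PreprojA

section PhiModule

open TruncPoly PreprojA

variable {k : Type u} [Field k] {n : ℕ} {Y Z : Type u} [AddCommGroup Y] [AddCommGroup Z]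
  [Module (TruncPoly k n) Y] [Module (TruncPoly k n) Z] (g : Y →ₗ[TruncPoly k n] Z)

/-- The `Π_{n-1}`-module attached to a linear map `g : Y → Z`.  Its component at the vertex `i` is
the quotient of `{z | x ^ (i + 1) z = 0}` by `x ^ (n - (i + 1)) Z + g {y | x ^ (i + 1) y = 0}`. -/
def Phi : Type u := PhiFun g

noncomputable instance : AddCommGroup (Phi g) := inferInstanceAs (AddCommGroup (PhiFun g))

noncomputable instance : Module (PreprojA k (n - 1)) (Phi g) :=
  Module.compHom (PhiFun g) (phiAct g)

namespace Phi

/-- The identity map from the underlying group. -/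
noncomputable def mk : PhiFun g ≃+ Phi g := AddEquiv.refl _

/-- The class in `Phi g` of an element annihilated by `x ^ (i + 1)`. -/
noncomputable def of (i : ℕ) : xTorsion k n Z i →+ Phi g :=
  if h : i < n - 1 then
    (mk g).toAddMonoidHom.comp
      ((phiSingle g ⟨i, h⟩) ∘ₗ ((phiRel g i).comap (xTorsion k n Z i).subtype).mkQ).toAddMonoidHom
  else 0

theorem of_fin (i : Fin (n - 1)) (z : xTorsion k n Z i) : of g i z =
    mk g (phiSingle g i (((phiRel g i).comap (xTorsion k n Z i).subtype).mkQ z)) :=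
  DFunLike.congr_fun (dif_pos i.2) z

theorem of_of_le {i : ℕ} (h : n ≤ i + 1) (z : xTorsion k n Z i) : of g i z = 0 :=
  DFunLike.congr_fun (dif_neg (by omega)) z

theorem of_eq_zero_iff {i : ℕ} {z : xTorsion k n Z i} : of g i z = 0 ↔ (z : Z) ∈ phiRel g i := by
  by_cases h : i < n - 1
  · rw [of_fin g ⟨i, h⟩, map_eq_zero_iff _ (mk g).injective]
    refine Iff.trans ⟨fun e => ?_, fun e => ?_⟩
      ((Submodule.Quotient.mk_eq_zero ((phiRel g i).comap (xTorsion k n Z i).subtype)).trans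
        (Iff.rfl : _ ↔ (z : Z) ∈ phiRel g i))
    · rw [← phiSingle_same g ⟨i, h⟩ (Submodule.Quotient.mk z)]
      exact congrFun e ⟨i, h⟩
    · exact (congrArg _ e).trans (map_zero (phiSingle g ⟨i, h⟩))
  · exact iff_of_true (of_of_le g (by omega) z) (mem_phiRel_of_le (by omega) _)

theorem exists_eq_sum (μ : Phi g) :
    ∃ z : ∀ i : Fin (n - 1), xTorsion k n Z i, μ = ∑ i : Fin (n - 1), of g i (z i) := by
  obtain ⟨μ, rfl⟩ := (mk g).surjective μ
  choose z hz using fun i : Fin (n - 1) =>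
    Submodule.mkQ_surjective ((phiRel g i).comap (xTorsion k n Z i).subtype) (μ i)
  refine ⟨z, ?_⟩
  conv_lhs => rw [← sum_phiSingle g μ, map_sum]
  exact Finset.sum_congr rfl fun i _ => by rw [of_fin, hz]

theorem gen_smul (a : DoubleA (n - 1)) (μ : PhiFun g) :
    gen k a • mk g μ = mk g (phiGen g a μ) :=
  congrArg (fun f : Module.End (TruncPoly k n) (PhiFun g) => f μ) (phiAct_gen g a)

theorem algebraMap_smul (c : k) (μ : PhiFun g) :
    algebraMap k (PreprojA k (n - 1)) c • mk g μ = mk g (algebraMap k (TruncPoly k n) c • μ) :=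
  phiAct_algebraMap g c μ

theorem algebraMap_smul_of (c : k) (i : ℕ) (z : xTorsion k n Z i) :
    algebraMap k (PreprojA k (n - 1)) c • of g i z =
      of g i (algebraMap k (TruncPoly k n) c • z) := by
  by_cases h : i < n - 1
  · rw [of_fin g ⟨i, h⟩, of_fin g ⟨i, h⟩, algebraMap_smul, ← map_smul, ← map_smul]
  · rw [of_of_le g (by omega), of_of_le g (by omega), smul_zero]

theorem vert_smul_of (i : ℕ) (z : xTorsion k n Z i) :
    vert k (n - 1) i • of g i z = of g i z := by
  by_cases h : i < n - 1
  · rw [of_fin g ⟨i, h⟩, show vert k (n - 1) i = gen k (.e ⟨i, h⟩) from vert_fin ⟨i, h⟩, gen_smul,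
      phiGen_e, phiSingle_same]
  · rw [of_of_le g (by omega), smul_zero]

theorem vert_smul_of_of_ne {i j : ℕ} (h : i ≠ j) (z : xTorsion k n Z j) :
    vert k (n - 1) i • of g j z = 0 := by
  rw [← vert_smul_of, ← mul_smul, vert_mul_of_ne h, zero_smul]

/-- Upward, `xShift (i + 1) i` is the inclusion, as the exponent `i - (i + 1)` truncates to `0`;
downward, `xShift i (i + 1)` is multiplication by `x`. -/
theorem A_smul_of (i : ℕ) (z : xTorsion k n Z i) :
    A k (n - 1) • of g i z = of g (i + 1) (xShift (i + 1) i z) := by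
  by_cases h : i < n - 1 - 1
  · rw [← vert_smul_of, ← mul_smul,
      show A k (n - 1) * vert k (n - 1) i = gen k (.a ⟨i, h⟩) from A_mul_vert_fin ⟨i, h⟩]
    refine (congrArg _ (of_fin g (DoubleA.src ⟨i, h⟩) z)).trans ?_
    rw [gen_smul, phiGen_a, phiSingle_same]
    exact (of_fin g (DoubleA.tgt ⟨i, h⟩) _).symm
  · rw [← vert_smul_of, ← mul_smul, A_mul_vert, vert_of_le (by omega), zero_mul, zero_smul,
      of_of_le g (by omega)]

theorem B_smul_of (i : ℕ) (z : xTorsion k n Z (i + 1)) :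
    B k (n - 1) • of g (i + 1) z = of g i (xShift i (i + 1) z) := by
  by_cases h : i < n - 1 - 1
  · rw [← vert_smul_of, ← mul_smul,
      show B k (n - 1) * vert k (n - 1) (i + 1) = gen k (.b ⟨i, h⟩) from B_mul_vert_fin ⟨i, h⟩]
    refine (congrArg _ (of_fin g (DoubleA.tgt ⟨i, h⟩) z)).trans ?_
    rw [gen_smul, phiGen_b, phiSingle_same]
    exact (of_fin g (DoubleA.src ⟨i, h⟩) _).symm
  · rw [of_of_le g (by omega), smul_zero, eq_comm, of_eq_zero_iff, xShift_val]
    exact x_pow_smul_mem_phiRel (by omega) _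

theorem A_pow_smul_of (s i : ℕ) (z : xTorsion k n Z i) :
    A k (n - 1) ^ s • of g i z = of g (i + s) (xShift (i + s) i z) := by
  induction s with
  | zero =>
    rw [pow_zero, one_smul]
    refine congrArg (of g i) (Subtype.ext ?_)
    rw [xShift_val, add_zero, Nat.sub_self, pow_zero]
    exact (one_smul (TruncPoly k n) _).symm
  | succ s ih =>
    rw [pow_succ', mul_smul, ih, A_smul_of]
    refine congrArg (of g (i + s + 1)) (Subtype.ext ?_)
    rw [xShift_val, xShift_val, xShift_val, smul_smul, ← pow_add]
    congr 2
    omega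

theorem B_pow_smul_of (s i : ℕ) (z : xTorsion k n Z (i + s)) :
    B k (n - 1) ^ s • of g (i + s) z = of g i (xShift i (i + s) z) := by
  induction s with
  | zero =>
    rw [pow_zero, one_smul]
    refine congrArg (of g i) (Subtype.ext ?_)
    rw [xShift_val, show i + 0 - i = 0 by omega, pow_zero]
    exact (one_smul (TruncPoly k n) _).symm
  | succ s ih =>
    rw [pow_succ, mul_smul]
    refine (congrArg _ (B_smul_of g (i + s) z)).trans ?_
    rw [ih]
    refine congrArg (of g i) (Subtype.ext ?_)
    rw [xShift_val, xShift_val, xShift_val, smul_smul, ← pow_add]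
    congr 2
    omega

theorem path_smul_of (i j : ℕ) (z : xTorsion k n Z j) :
    path k (n - 1) i j • of g j z = of g i (xShift i j z) := by
  rcases le_total i j with h | h
  · obtain ⟨s, rfl⟩ := Nat.exists_eq_add_of_le h
    rw [path, Nat.sub_eq_zero_of_le h, pow_zero, one_mul, Nat.add_sub_cancel_left, B_pow_smul_of]
  · obtain ⟨s, rfl⟩ := Nat.exists_eq_add_of_le h
    rw [path, Nat.sub_eq_zero_of_le h, pow_zero, mul_one, Nat.add_sub_cancel_left, A_pow_smul_of]

theorem x_smul_of (i : ℕ) (z : xTorsion k n Z i) :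
    (A k (n - 1) * B k (n - 1)) • of g i z = of g i (x k n • z) := by
  rw [A_mul_B, mul_smul, A_smul_of, B_smul_of]
  refine congrArg (of g i) (Subtype.ext ?_)
  rw [xShift_val, xShift_val, smul_smul, ← pow_add, show i + 1 - i + (i - (i + 1)) = 1 by omega,
    pow_one]
  rfl

theorem ofTrunc_smul_of (c : TruncPoly k n) (i : ℕ) (z : xTorsion k n Z i) :
    ofTrunc k n c • of g i z = of g i (c • z) := by
  obtain ⟨c, rfl⟩ := TruncPoly.mk_surjective c
  induction c using Polynomial.induction_on generalizing z with
  | C a =>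
    have h : Ideal.Quotient.mk (Ideal.span {(Polynomial.X : Polynomial k) ^ n}) (Polynomial.C a)
      = algebraMap k (TruncPoly k n) a := rfl
    rw [h, AlgHom.commutes, algebraMap_smul_of]
  | add p q hp hq =>
    rw [map_add, map_add, add_smul, hp, hq, ← map_add]
    exact congrArg (of g i) (add_smul (R := TruncPoly k n) _ _ z).symm
  | monomial s a h =>
    rw [pow_succ, ← mul_assoc, map_mul, map_mul, mul_smul]
    refine Eq.trans ?_ (congrArg (of g i) (mul_smul (α := TruncPoly k n) _ _ z).symm)
    rw [← h]
    refine congrArg _ ?_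
    rw [show Ideal.Quotient.mk (Ideal.span {(Polynomial.X : Polynomial k) ^ n}) Polynomial.X
      = x k n from rfl, ofTrunc_x, x_smul_of]

section Lift

variable {g} {M : Type*} [AddCommGroup M]

/-- The map on a component induced by a homomorphism vanishing on the relations. -/
noncomputable def atLift {i : ℕ} (φ : xTorsion k n Z i →+ M)
    (h0 : ∀ z : xTorsion k n Z i, (z : Z) ∈ phiRel g i → φ z = 0) : PhiAt g i →+ M :=
  QuotientAddGroup.lift ((phiRel g i).comap (xTorsion k n Z i).subtype).toAddSubgroup φ
    fun z hz => h0 z hz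

/-- The additive map induced by homomorphisms vanishing on the relations. -/
noncomputable def liftAux (φ : ∀ i, xTorsion k n Z i →+ M)
    (h0 : ∀ i (z : xTorsion k n Z i), (z : Z) ∈ phiRel g i → φ i z = 0) : Phi g →+ M :=
  (∑ i : Fin (n - 1), (atLift (φ i) (h0 i)).comp
    (Pi.evalAddMonoidHom (fun i : Fin (n - 1) => PhiAt g i) i)).comp (mk g).symm.toAddMonoidHom

theorem liftAux_of (φ : ∀ i, xTorsion k n Z i →+ M)
    (h0 : ∀ i (z : xTorsion k n Z i), (z : Z) ∈ phiRel g i → φ i z = 0) (i : ℕ)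
    (z : xTorsion k n Z i) : liftAux φ h0 (of g i z) = φ i z := by
  by_cases hi : i < n - 1
  · rw [of_fin g ⟨i, hi⟩]
    refine (AddMonoidHom.finsetSum_apply _ _ _).trans ?_
    rw [Finset.sum_eq_single ⟨i, hi⟩]
    · exact congrArg (atLift (φ i) (h0 i)) (phiSingle_same g ⟨i, hi⟩ _)
    · intro j _ hj
      exact (congrArg (atLift (φ j) (h0 j)) (phiSingle_of_ne g hj _)).trans (map_zero _)
    · simp
  · rw [of_of_le g (by omega), map_zero, h0 i z (mem_phiRel_of_le (by omega) _)]

variable [Module (PreprojA k (n - 1)) M]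

theorem exists_lift (φ : ∀ i, xTorsion k n Z i →+ M)
    (h0 : ∀ i (z : xTorsion k n Z i), (z : Z) ∈ phiRel g i → φ i z = 0)
    (hv : ∀ i z, vert k (n - 1) i • φ i z = φ i z)
    (hp : ∀ i j z, path k (n - 1) i j • φ j z = φ i (xShift i j z))
    (hc : ∀ (c : k) i z, algebraMap k (PreprojA k (n - 1)) c • φ i z =
      φ i (algebraMap k (TruncPoly k n) c • z)) :
    ∃ f : Phi g →ₗ[PreprojA k (n - 1)] M, ∀ i z, f (of g i z) = φ i z := by
  have key (p : PreprojA k (n - 1)) (h : ∀ i z, liftAux φ h0 (p • of g i z) = p • φ i z)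
      (μ : Phi g) : liftAux φ h0 (p • μ) = p • liftAux φ h0 μ := by
    obtain ⟨z, rfl⟩ := exists_eq_sum g μ
    rw [Finset.smul_sum, map_sum, map_sum, Finset.smul_sum]
    exact Finset.sum_congr rfl fun i _ => by rw [h, liftAux_of]
  have hvert (j : ℕ) (μ : Phi g) :
      liftAux φ h0 (vert k (n - 1) j • μ) = vert k (n - 1) j • liftAux φ h0 μ := by
    refine key _ (fun i z => ?_) μ
    by_cases h : j = i
    · subst h
      rw [vert_smul_of, liftAux_of, hv]
    · rw [vert_smul_of_of_ne g h, map_zero, ← hv, ← mul_smul, vert_mul_of_ne h, zero_smul]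
  refine ⟨{ liftAux φ h0 with map_smul' := fun p μ => ?_ }, fun i z => liftAux_of φ h0 i z⟩
  change liftAux φ h0 (p • μ) = p • liftAux φ h0 μ
  exact map_smul_of_forall (liftAux φ h0) (fun c => key _ fun i z => by
      rw [algebraMap_smul_of, liftAux_of, hc]) hvert
    (key _ fun i z => by rw [A_smul_of, liftAux_of, ← hp, path_succ])
    (key _ fun i z => by
      cases i with
      | zero =>
        rw [← vert_smul_of, ← mul_smul, B_mul_vert_zero, zero_smul, map_zero, ← hv, ← mul_smul,
          B_mul_vert_zero, zero_smul]
      | succ i => rw [B_smul_of, liftAux_of, ← hp, path_pred]) p μ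

end Lift

end Phi

end PhiModule

/-! ### Functoriality of `Phi` and lifting of homomorphisms -/

section PhiMap

open TruncPoly PreprojA CyclicMod

variable {k : Type u} [Field k] {n : ℕ} {Y Z Y' Z' Y'' Z'' : Type u} [AddCommGroup Y]
  [AddCommGroup Z] [AddCommGroup Y'] [AddCommGroup Z'] [AddCommGroup Y''] [AddCommGroup Z'']
  [Module (TruncPoly k n) Y] [Module (TruncPoly k n) Z] [Module (TruncPoly k n) Y']
  [Module (TruncPoly k n) Z'] [Module (TruncPoly k n) Y''] [Module (TruncPoly k n) Z'']

theorem map_mem_xTorsion (ζ : Z →ₗ[TruncPoly k n] Z') {i : ℕ} {z : Z} (h : z ∈ xTorsion k n Z i) :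
    ζ z ∈ xTorsion k n Z' i := by
  rw [mem_xTorsion, ← map_smul, mem_xTorsion.1 h, map_zero]

/-- The map induced by a linear map on the elements annihilated by `x ^ (i + 1)`. -/
noncomputable def xTorsionMap (ζ : Z →ₗ[TruncPoly k n] Z') (i : ℕ) :
    xTorsion k n Z i →ₗ[TruncPoly k n] xTorsion k n Z' i :=
  ζ.restrict fun _ h => map_mem_xTorsion ζ h

theorem xTorsionMap_val (ζ : Z →ₗ[TruncPoly k n] Z') (i : ℕ) (z : xTorsion k n Z i) :
    (xTorsionMap ζ i z : Z') = ζ z := rfl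

theorem phiRel_le_comap {g : Y →ₗ[TruncPoly k n] Z} {g' : Y' →ₗ[TruncPoly k n] Z'}
    {ζ : Z →ₗ[TruncPoly k n] Z'} {η : Y →ₗ[TruncPoly k n] Y'} (h : ∀ y, ζ (g y) = g' (η y))
    (i : ℕ) : phiRel g i ≤ (phiRel g' i).comap ζ := by
  intro z hz
  obtain ⟨w, y, hy, rfl⟩ := mem_phiRel.1 hz
  refine mem_phiRel.2 ⟨ζ w, η y, ?_, ?_⟩
  · rw [← map_smul, hy, map_zero]
  · rw [map_add, map_smul, h]

namespace Phi

variable {g : Y →ₗ[TruncPoly k n] Z} {g' : Y' →ₗ[TruncPoly k n] Z'}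
  {g'' : Y'' →ₗ[TruncPoly k n] Z''}

theorem hom_ext {M : Type*} [AddCommGroup M] [Module (PreprojA k (n - 1)) M]
    {f f' : Phi g →ₗ[PreprojA k (n - 1)] M} (h : ∀ i z, f (of g i z) = f' (of g i z)) : f = f' := by
  ext μ
  obtain ⟨z, rfl⟩ := exists_eq_sum g μ
  rw [map_sum, map_sum]
  exact Finset.sum_congr rfl fun i _ => h i _

theorem vert_smul_sum (z : ∀ i : Fin (n - 1), xTorsion k n Z i) (i : Fin (n - 1)) :
    vert k (n - 1) i • ∑ j : Fin (n - 1), of g j (z j) = of g i (z i) := by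
  rw [Finset.smul_sum, Finset.sum_eq_single i, vert_smul_of]
  · intro j _ h
    exact vert_smul_of_of_ne g (fun e => h (Fin.ext e.symm)) _
  · simp

theorem exists_eq_of {i : ℕ} {μ : Phi g} (h : vert k (n - 1) i • μ = μ) : ∃ z, μ = of g i z := by
  by_cases hi : i < n - 1
  · obtain ⟨z, hz⟩ := exists_eq_sum g μ
    refine ⟨z ⟨i, hi⟩, ?_⟩
    rw [← vert_smul_sum z ⟨i, hi⟩, ← hz]
    exact h.symm
  · exact ⟨0, by rw [← h, vert_of_le (by omega), zero_smul, map_zero]⟩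

theorem subsingleton_of_forall (h : ∀ i, ∀ z ∈ xTorsion k n Z i, z ∈ phiRel g i) :
    Subsingleton (Phi g) := by
  refine subsingleton_of_forall_eq 0 fun μ => ?_
  obtain ⟨z, rfl⟩ := exists_eq_sum g μ
  exact Finset.sum_eq_zero fun i _ => (of_eq_zero_iff g).2 (h i _ (z i).2)

theorem injective_of_forall {M : Type*} [AddCommGroup M] [Module (PreprojA k (n - 1)) M]
    {f : Phi g →ₗ[PreprojA k (n - 1)] M}
    (h : ∀ i (z : xTorsion k n Z i), f (of g i z) = 0 → (z : Z) ∈ phiRel g i) :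
    Function.Injective f := by
  rw [injective_iff_map_eq_zero]
  intro μ hμ
  obtain ⟨z, rfl⟩ := exists_eq_sum g μ
  refine Finset.sum_eq_zero fun i _ => (of_eq_zero_iff g).2 (h i _ ?_)
  rw [← vert_smul_sum, map_smul, hμ, smul_zero]

theorem exists_map (ζ : Z →ₗ[TruncPoly k n] Z') (h : ∀ i, phiRel g i ≤ (phiRel g' i).comap ζ) :
    ∃ f : Phi g →ₗ[PreprojA k (n - 1)] Phi g', ∀ i z, f (of g i z) = of g' i (xTorsionMap ζ i z) :=
  exists_lift (fun i => (of g' i).comp (xTorsionMap ζ i).toAddMonoidHom)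
    (fun i _ hz => (of_eq_zero_iff g').2 (h i hz))
    (fun i _ => vert_smul_of g' i _)
    (fun i j z => (path_smul_of g' i j _).trans (congrArg (of g' i) (Subtype.ext
      (map_smul ζ (x k n ^ (j - i)) (z : Z)).symm)))
    fun c i z => (algebraMap_smul_of g' c i _).trans (congrArg (of g' i)
      (map_smul (xTorsionMap ζ i) (algebraMap k (TruncPoly k n) c) z).symm)

/-- The homomorphism induced by a linear map which is compatible with the relations. -/
noncomputable def map (ζ : Z →ₗ[TruncPoly k n] Z') (h : ∀ i, phiRel g i ≤ (phiRel g' i).comap ζ) :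
    Phi g →ₗ[PreprojA k (n - 1)] Phi g' :=
  (exists_map ζ h).choose

theorem map_of (ζ : Z →ₗ[TruncPoly k n] Z') (h : ∀ i, phiRel g i ≤ (phiRel g' i).comap ζ) (i : ℕ)
    (z : xTorsion k n Z i) : map ζ h (of g i z) = of g' i (xTorsionMap ζ i z) :=
  (exists_map ζ h).choose_spec i z

theorem map_id {ζ : Z →ₗ[TruncPoly k n] Z} (hζ : ∀ z, ζ z = z)
    (h : ∀ i, phiRel g i ≤ (phiRel g i).comap ζ) : map ζ h = LinearMap.id :=
  hom_ext fun i z => (map_of ζ h i z).trans (congrArg (of g i) (Subtype.ext (hζ z)))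

theorem map_comp {ζ : Z →ₗ[TruncPoly k n] Z'} {ζ' : Z' →ₗ[TruncPoly k n] Z''}
    {ζ'' : Z →ₗ[TruncPoly k n] Z''} (hζ : ∀ z, ζ'' z = ζ' (ζ z))
    (h : ∀ i, phiRel g i ≤ (phiRel g' i).comap ζ)
    (h' : ∀ i, phiRel g' i ≤ (phiRel g'' i).comap ζ')
    (h'' : ∀ i, phiRel g i ≤ (phiRel g'' i).comap ζ'') :
    map ζ'' h'' = map ζ' h' ∘ₗ map ζ h :=
  hom_ext fun i z => by
    rw [LinearMap.comp_apply, map_of, map_of, map_of]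
    exact congrArg (of g'' i) (Subtype.ext (hζ z))

theorem map_add {ζ ζ' ζ'' : Z →ₗ[TruncPoly k n] Z'} (hζ : ∀ z, ζ'' z = ζ z + ζ' z)
    (h : ∀ i, phiRel g i ≤ (phiRel g' i).comap ζ)
    (h' : ∀ i, phiRel g i ≤ (phiRel g' i).comap ζ')
    (h'' : ∀ i, phiRel g i ≤ (phiRel g' i).comap ζ'') :
    map ζ'' h'' = map ζ h + map ζ' h' :=
  hom_ext fun i z => by
    rw [LinearMap.add_apply, map_of, map_of, map_of, ← AddMonoidHom.map_add]
    exact congrArg (of g' i) (Subtype.ext (hζ z))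

theorem map_eq_zero_iff (ζ : Z →ₗ[TruncPoly k n] Z')
    (h : ∀ i, phiRel g i ≤ (phiRel g' i).comap ζ) :
    map ζ h = 0 ↔ ∀ i, ∀ z ∈ xTorsion k n Z i, ζ z ∈ phiRel g' i := by
  constructor
  · intro h0 i z hz
    have := map_of ζ h i ⟨z, hz⟩
    rw [h0, LinearMap.zero_apply, eq_comm, of_eq_zero_iff] at this
    exact this
  · intro h0
    refine hom_ext fun i z => ?_
    rw [map_of, LinearMap.zero_apply, of_eq_zero_iff]
    exact h0 i z z.2

theorem map_eq_of_forall {ζ : Z →ₗ[TruncPoly k n] Z'} (h : ∀ i, phiRel g i ≤ (phiRel g' i).comap ζ)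
    {f : Phi g →ₗ[PreprojA k (n - 1)] Phi g'} {ζ' : Z →ₗ[TruncPoly k n] Z'}
    (hf : ∀ i z, f (of g i z) = of g' i (xTorsionMap ζ' i z))
    (h0 : ∀ i, ∀ z ∈ xTorsion k n Z i, ζ z - ζ' z ∈ phiRel g' i) : map ζ h = f := by
  refine hom_ext fun i z => ?_
  rw [map_of, hf, ← sub_eq_zero, ← AddMonoidHom.map_sub, of_eq_zero_iff]
  exact h0 i z z.2

theorem map_bijective (ζ : Z →ₗ[TruncPoly k n] Z') (h : ∀ i, phiRel g i ≤ (phiRel g' i).comap ζ)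
    (hinj : ∀ i, ∀ z ∈ xTorsion k n Z i, ζ z ∈ phiRel g' i → z ∈ phiRel g i)
    (hsurj : ∀ i, ∀ z' ∈ xTorsion k n Z' i, ∃ z ∈ xTorsion k n Z i, ζ z = z') :
    Function.Bijective (map ζ h) := by
  refine ⟨injective_of_forall fun i z hz => ?_, fun μ => ?_⟩
  · rw [map_of, of_eq_zero_iff] at hz
    exact hinj i z z.2 hz
  · obtain ⟨z', rfl⟩ := exists_eq_sum g' μ
    choose z hz hz' using fun i : Fin (n - 1) => hsurj i (z' i) (z' i).2
    refine ⟨∑ i : Fin (n - 1), of g i ⟨z i, hz i⟩, ?_⟩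
    rw [_root_.map_sum]
    refine Finset.sum_congr rfl fun i _ => ?_
    rw [map_of]
    exact congrArg (of g' i) (Subtype.ext (hz' i))

/-- With `Λ_n` acting through its central map to `Π_{n-1}`, the module is finite already over `Λ_n`,
hence Noetherian and Artinian. -/
theorem isFiniteLength [Module.Finite (TruncPoly k n) Z] :
    IsFiniteLength (PreprojA k (n - 1)) (Phi g) := by
  let _ : Module (TruncPoly k n) (Phi g) := Module.compHom _ (ofTrunc k n).toRingHom
  let _ : SMul (TruncPoly k n) (PreprojA k (n - 1)) := ⟨fun c p => ofTrunc k n c * p⟩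
  have : IsScalarTower (TruncPoly k n) (PreprojA k (n - 1)) (Phi g) :=
    ⟨fun c p μ => mul_smul (ofTrunc k n c) p μ⟩
  let q (i : Fin (n - 1)) : xTorsion k n Z i →ₗ[TruncPoly k n] Phi g :=
    { of g i with map_smul' := fun c z => (ofTrunc_smul_of g c i z).symm }
  have : Module.Finite (TruncPoly k n) (Phi g) := by
    refine Module.Finite.of_surjective (∑ i, q i ∘ₗ LinearMap.proj i :
      (∀ i : Fin (n - 1), xTorsion k n Z i) →ₗ[TruncPoly k n] Phi g) fun μ => ?_
    obtain ⟨z, rfl⟩ := exists_eq_sum g μ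
    exact ⟨z, LinearMap.sum_apply _ _ _⟩
  exact isFiniteLength_iff_isNoetherian_isArtinian.2
    ⟨isNoetherian_of_tower (TruncPoly k n) inferInstance,
      isArtinian_of_tower (TruncPoly k n) inferInstance⟩

end Phi

/-- The Yoneda argument: for a cyclic summand `[e l]` of `Z` the hypothesis at the vertex `e l - 1`
writes the image of the generator as `x ^ (n - e l) • w + g' y` with `x ^ (e l) • y = 0`. Then `y`
prescribes `s`, and `w` prescribes a map on the free hull `[n]` of `[e l]`. -/
theorem exists_factorization [Module.Finite (TruncPoly k n) Z] (g' : Y' →ₗ[TruncPoly k n] Z')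
    (h : Z →ₗ[TruncPoly k n] Z') (h0 : ∀ i, ∀ z ∈ xTorsion k n Z i, h z ∈ phiRel g' i) :
    ∃ (d : ℕ) (s : Z →ₗ[TruncPoly k n] Y') (v : Z →ₗ[TruncPoly k n] (Fin d → CyclicMod k n n))
      (w : (Fin d → CyclicMod k n n) →ₗ[TruncPoly k n] Z'),
      Function.Injective v ∧ ∀ z, h z = g' (s z) + w (v z) := by
  obtain ⟨d, e, he, ⟨φ⟩⟩ := exists_equiv_pi_cyclicMod (k := k) (n := n) Z
  have key (l : Fin d) : ∃ (w : Z') (y : Y'), x k n ^ e l • y = 0 ∧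
      x k n ^ (n - e l) • w + g' y = h (φ.symm (Pi.single l (gen k n (e l)))) := by
    have hγ : x k n ^ e l • φ.symm (Pi.single l (gen k n (e l))) = 0 := by
      rw [← map_smul, ← Pi.single_smul, x_pow_smul_gen_self, Pi.single_zero, map_zero]
    -- A summand `[0]` has no vertex, but its generator is zero.
    rcases Nat.eq_zero_or_pos (e l) with h1 | h1
    · rw [show x k n ^ e l = 1 by rw [h1, pow_zero], one_smul] at hγ
      exact ⟨0, 0, smul_zero _, by rw [smul_zero, map_zero, hγ, map_zero, add_zero]⟩
    · have := mem_phiRel.1 (h0 (e l - 1) _ (mem_xTorsion.2 (by rwa [Nat.sub_add_cancel h1])))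
      rwa [Nat.sub_add_cancel h1] at this
  choose w y hy hwy using key
  refine ⟨d, CyclicMod.piLift e y hy ∘ₗ φ.toLinearMap,
    LinearMap.pi (fun l => toTop k n (e l) ∘ₗ LinearMap.proj l) ∘ₗ φ.toLinearMap,
    CyclicMod.piLift (fun _ => n) w fun l => x_pow_smul_eq_zero _, fun a b hab =>
      φ.injective (funext fun l => toTop_injective (he l) (congrFun hab l)), fun z => ?_⟩
  have hv (l : Fin d) : LinearMap.pi (fun l => toTop k n (e l) ∘ₗ LinearMap.proj l)
      (Pi.single l (gen k n (e l))) =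
        x k n ^ (n - e l) • (Pi.single l (gen k n n) : Fin d → CyclicMod k n n) := by
    ext l'
    rw [LinearMap.pi_apply, LinearMap.comp_apply, LinearMap.proj_apply, Pi.smul_apply]
    by_cases hl : l' = l
    · subst hl
      rw [Pi.single_eq_same, Pi.single_eq_same, toTop_gen]
    · rw [Pi.single_eq_of_ne hl, Pi.single_eq_of_ne hl, map_zero, smul_zero]
  obtain ⟨z, rfl⟩ := φ.symm.surjective z
  obtain ⟨c, rfl⟩ := pi_exists_sum e z
  simp only [LinearMap.comp_apply, LinearEquiv.coe_coe, LinearEquiv.apply_symm_apply, map_sum,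
    map_smul, piLift_single, hv]
  rw [← Finset.sum_add_distrib]
  refine Finset.sum_congr rfl fun l _ => ?_
  rw [← hwy, smul_add, add_comm]

namespace Phi

variable {g : Y →ₗ[TruncPoly k n] Z} {g' : Y' →ₗ[TruncPoly k n] Z'}

theorem of_eq_smul {i j : ℕ} {z : xTorsion k n Z i} {y : xTorsion k n Z j} {c : TruncPoly k n}
    (h : (z : Z) = (c * x k n ^ (j - i)) • (y : Z)) :
    of g i z = ofTrunc k n c • path k (n - 1) i j • of g j y := by
  rw [path_smul_of, ofTrunc_smul_of]
  exact congrArg (of g i) (Subtype.ext (h.trans (mul_smul (α := TruncPoly k n) _ _ (y : Z))))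

/-- The generator of a summand `[e l]` lies at the vertex `e l - 1`; a representative of its image
under `f` determines `ζ`. Agreement at the other vertices follows because an element killed by `x ^
(i + 1)` is a combination of the generators transported along paths to the vertex `i`. -/
theorem exists_linear_lift [Module.Finite (TruncPoly k n) Z]
    (f : Phi g →ₗ[PreprojA k (n - 1)] Phi g') :
    ∃ ζ : Z →ₗ[TruncPoly k n] Z', ∀ i z, f (of g i z) = of g' i (xTorsionMap ζ i z) := by
  obtain ⟨d, e, he, ⟨φ⟩⟩ := exists_equiv_pi_cyclicMod (k := k) (n := n) Z
  let γ (l : Fin d) : Z := φ.symm (Pi.single l (gen k n (e l)))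
  have hγ (l : Fin d) : x k n ^ e l • γ l = 0 := by
    rw [← map_smul, ← Pi.single_smul, x_pow_smul_gen_self, Pi.single_zero, map_zero]
  have hγ' (l : Fin d) : γ l ∈ xTorsion k n Z (e l - 1) :=
    mem_xTorsion.2 (x_pow_smul_eq_zero_of_le (hγ l) (by omega))
  have key (l : Fin d) : ∃ z' : xTorsion k n Z' (e l - 1), x k n ^ e l • (z' : Z') = 0 ∧
      f (of g (e l - 1) ⟨γ l, hγ' l⟩) = of g' (e l - 1) z' := by
    rcases Nat.eq_zero_or_pos (e l) with h1 | h1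
    · refine ⟨0, smul_zero _, ?_⟩
      have h := hγ l
      rw [h1, pow_zero, one_smul] at h
      rw [show (⟨γ l, hγ' l⟩ : xTorsion k n Z (e l - 1)) = 0 from Subtype.ext h,
        AddMonoidHom.map_zero, AddMonoidHom.map_zero, LinearMap.map_zero]
    · obtain ⟨z', h⟩ := exists_eq_of (g := g') (i := e l - 1)
        (μ := f (of g (e l - 1) ⟨γ l, hγ' l⟩)) (by rw [← map_smul, vert_smul_of])
      refine ⟨z', ?_, h⟩
      have := mem_xTorsion.1 z'.2
      rwa [Nat.sub_add_cancel h1] at this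
  choose z' hz' hfz' using key
  refine ⟨CyclicMod.piLift e (fun l => (z' l : Z')) hz' ∘ₗ φ.toLinearMap, fun i z => ?_⟩
  have hz : x k n ^ (i + 1) • φ (z : Z) = 0 := by
    rw [← map_smul, mem_xTorsion.1 z.2, map_zero]
  obtain ⟨c, hc⟩ := pi_exists_sum_of_x_pow_smul_eq_zero e he hz
  have hmem (l : Fin d) {W : Type u} [AddCommGroup W] [Module (TruncPoly k n) W] {y : W}
      (hy : x k n ^ e l • y = 0) :
      (c l * x k n ^ (e l - 1 - i)) • y ∈ xTorsion k n W i := by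
    rw [mem_xTorsion, smul_smul, mul_left_comm, ← pow_add, mul_smul,
      x_pow_smul_eq_zero_of_le hy (by omega), smul_zero]
  have hsub (l : Fin d) : e l - (i + 1) = e l - 1 - i := by omega
  have h1 : z = ∑ l, ⟨_, hmem l (hγ l)⟩ := Subtype.ext (by
    rw [AddSubmonoidClass.coe_finsetSum]
    refine φ.injective ?_
    rw [hc, map_sum]
    exact Finset.sum_congr rfl fun l _ => by
      rw [map_smul, LinearEquiv.apply_symm_apply, hsub])
  have h2 : xTorsionMap (CyclicMod.piLift e (fun l => (z' l : Z')) hz' ∘ₗ φ.toLinearMap) i z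
      = ∑ l, ⟨_, hmem l (hz' l)⟩ := Subtype.ext (by
    rw [AddSubmonoidClass.coe_finsetSum, xTorsionMap_val, LinearMap.comp_apply,
      LinearEquiv.coe_coe, hc, piLift_sum]
    exact Finset.sum_congr rfl fun l _ => by rw [hsub])
  rw [h2]
  conv_lhs => rw [h1]
  rw [_root_.map_sum, _root_.map_sum, _root_.map_sum]
  refine Finset.sum_congr rfl fun l _ => ?_
  rw [of_eq_smul (g := g) (i := i) (c := c l) (y := ⟨γ l, hγ' l⟩) rfl, map_smul, map_smul, hfz',
    of_eq_smul (g := g') (i := i) (c := c l) (z := ⟨_, hmem l (hz' l)⟩) (y := z' l) rfl]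

/-- `Phi g` kills the elements `g y`, so `ζ g` is zero in `Phi g'` and `exists_factorization`
applies to it. -/
theorem exists_lift_factorization [Module.Finite (TruncPoly k n) Z]
    [Module.Finite (TruncPoly k n) Y] (f : Phi g →ₗ[PreprojA k (n - 1)] Phi g') :
    ∃ (ζ : Z →ₗ[TruncPoly k n] Z') (d : ℕ) (s : Y →ₗ[TruncPoly k n] Y')
      (v : Y →ₗ[TruncPoly k n] (Fin d → CyclicMod k n n))
      (w : (Fin d → CyclicMod k n n) →ₗ[TruncPoly k n] Z'),
      (∀ i z, f (of g i z) = of g' i (xTorsionMap ζ i z)) ∧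
        ∀ y, ζ (g y) = g' (s y) + w (v y) := by
  obtain ⟨ζ, hζ⟩ := exists_linear_lift f
  obtain ⟨d, s, v, w, -, h⟩ := exists_factorization g' (ζ ∘ₗ g) fun i y hy => by
    have h1 := hζ i ⟨g y, map_mem_xTorsion g hy⟩
    rw [(of_eq_zero_iff g).2 (map_mem_phiRel (mem_xTorsion.1 hy)), LinearMap.map_zero, eq_comm,
      of_eq_zero_iff] at h1
    exact h1
  exact ⟨ζ, d, s, v, w, hζ, h⟩

end Phi

end PhiMap

/-! ### Every module of finite length is of the form `Phi g` -/

section Density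

open TruncPoly PreprojA CyclicMod

variable {k : Type u} [Field k] {n : ℕ} {M : Type u} [AddCommGroup M]
  [Module (PreprojA k (n - 1)) M] {ι : Type} [Fintype ι] [DecidableEq ι] {j : ι → ℕ} {m : ι → M}

/-- The relation `x ^ (j + 1) = 0` of `[j + 1]` is matched by the fact that `j + 1` factors `B`
annihilate the vertex `j`. -/
theorem ofTrunc_smul_path_smul_eq_zero {i j : ℕ} (hj : j + 1 ≤ n) {μ : M}
    (hμ : vert k (n - 1) j • μ = μ) {c : TruncPoly k n}
    (h : (c * x k n ^ (j - i)) • gen k n (j + 1) = 0) :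
    ofTrunc k n c • path k (n - 1) i j • μ = 0 := by
  rw [smul_gen_eq_zero, mul_comm] at h
  obtain ⟨d, rfl⟩ := Ideal.mem_span_singleton.1 (mem_span_x_pow_of_mul_mem hj h)
  rw [mul_comm, map_mul, ofTrunc_x_pow, mul_smul, ← hμ, smul_smul, smul_smul, smul_smul,
    mul_assoc (ofTrunc k n d), mul_assoc (ofTrunc k n d), A_mul_B_pow_mul_path_mul_vert (by omega), mul_zero, zero_smul]

theorem sum_ofTrunc_smul_path_smul_eq_zero (hj : ∀ l, j l + 1 ≤ n)
    (hm : ∀ l, vert k (n - 1) (j l) • m l = m l) {i : ℕ} {c : ι → TruncPoly k n}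
    (h : ∑ l, (c l * x k n ^ (j l - i)) • (Pi.single l (gen k n (j l + 1)) :
      ∀ l, CyclicMod k n (j l + 1)) = 0) :
    ∑ l, ofTrunc k n (c l) • path k (n - 1) i (j l) • m l = 0 := by
  rw [← pi_eq_sum_smul_single] at h
  exact Finset.sum_eq_zero fun l _ =>
    ofTrunc_smul_path_smul_eq_zero (hj l) (hm l) (congrFun h l)

/-- An element `m l` at the vertex `j l` corresponds to the generator of `[j l + 1]`. The value at
`z` is read off from coefficients of `z`; they are not unique, but the previous lemma shows that the
value is. -/
theorem exists_torsion_family (hj : ∀ l, j l + 1 ≤ n)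
    (hm : ∀ l, vert k (n - 1) (j l) • m l = m l) :
    ∃ φ : ∀ i, xTorsion k n (∀ l, CyclicMod k n (j l + 1)) i →+ M,
      ∀ i (z : xTorsion k n (∀ l, CyclicMod k n (j l + 1)) i) (c : ι → TruncPoly k n),
        (z : ∀ l, CyclicMod k n (j l + 1)) =
          ∑ l, (c l * x k n ^ (j l - i)) • Pi.single l (gen k n (j l + 1)) →
        φ i z = ∑ l, ofTrunc k n (c l) • path k (n - 1) i (j l) • m l := by
  choose c hc using fun i (z : xTorsion k n (∀ l, CyclicMod k n (j l + 1)) i) =>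
    pi_exists_sum_of_x_pow_smul_eq_zero (fun l => j l + 1) hj (mem_xTorsion.1 z.2)
  have hsub (i : ℕ) (l : ι) : j l + 1 - (i + 1) = j l - i := by omega
  simp only [hsub] at hc
  have huniq (i : ℕ) (z : xTorsion k n (∀ l, CyclicMod k n (j l + 1)) i) (a : ι → TruncPoly k n)
      (ha : (z : ∀ l, CyclicMod k n (j l + 1)) =
          ∑ l, (a l * x k n ^ (j l - i)) • Pi.single l (gen k n (j l + 1))) :
      ∑ l, ofTrunc k n (c i z l) • path k (n - 1) i (j l) • m l =
        ∑ l, ofTrunc k n (a l) • path k (n - 1) i (j l) • m l := by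
    rw [← sub_eq_zero, ← Finset.sum_sub_distrib]
    simp only [← sub_smul, ← map_sub]
    refine sum_ofTrunc_smul_path_smul_eq_zero (i := i) (c := fun l => c i z l - a l) hj hm ?_
    simp only [sub_mul, sub_smul, Finset.sum_sub_distrib]
    rw [← hc, ← ha, sub_self]
  refine ⟨fun i => AddMonoidHom.mk' (fun z =>
    ∑ l, ofTrunc k n (c i z l) • path k (n - 1) i (j l) • m l) fun z z' => ?_, huniq⟩
  rw [huniq i (z + z') (c i z + c i z'), ← Finset.sum_add_distrib]
  · exact Finset.sum_congr rfl fun l _ => by rw [Pi.add_apply, map_add, add_smul]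
  · rw [Submodule.coe_add, hc i z, hc i z', ← Finset.sum_add_distrib]
    exact Finset.sum_congr rfl fun l _ => by rw [Pi.add_apply, add_mul, add_smul]

/-- A family of maps `φ i` from the elements annihilated by `x ^ (i + 1)` to a module over the
preprojective algebra, compatible with all the structure. -/
structure TorsionFamily (k : Type u) [Field k] (n : ℕ) (Z M : Type u) [AddCommGroup Z]
    [Module (TruncPoly k n) Z] [AddCommGroup M] [Module (PreprojA k (n - 1)) M] where
  map : ∀ i, xTorsion k n Z i →+ M
  vert_smul : ∀ i z, vert k (n - 1) i • map i z = map i z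
  path_smul : ∀ i j z, path k (n - 1) i j • map j z = map i (xShift i j z)
  ofTrunc_smul : ∀ c i z, ofTrunc k n c • map i z = map i (c • z)

theorem exists_torsionFamily (hj : ∀ l, j l + 1 ≤ n)
    (hm : ∀ l, vert k (n - 1) (j l) • m l = m l) :
    ∃ φ : TorsionFamily k n (∀ l, CyclicMod k n (j l + 1)) M, ∀ l, ∃ z, φ.map (j l) z = m l := by
  obtain ⟨φ, hφ⟩ := exists_torsion_family hj hm
  have hex (i : ℕ) (z : xTorsion k n (∀ l, CyclicMod k n (j l + 1)) i) :
      ∃ c : ι → TruncPoly k n, (z : ∀ l, CyclicMod k n (j l + 1)) =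
          ∑ l, (c l * x k n ^ (j l - i)) • Pi.single l (gen k n (j l + 1)) := by
    obtain ⟨c, hc⟩ := pi_exists_sum_of_x_pow_smul_eq_zero (fun l => j l + 1) hj
      (mem_xTorsion.1 z.2)
    refine ⟨c, hc.trans (Finset.sum_congr rfl fun l _ => ?_)⟩
    rw [show j l + 1 - (i + 1) = j l - i by omega]
  refine ⟨⟨φ, fun i z => ?_, fun i i' z => ?_, fun c i z => ?_⟩, fun l => ?_⟩
  · obtain ⟨c, hc⟩ := hex i z
    rw [hφ i z c hc, Finset.smul_sum]
    refine Finset.sum_congr rfl fun l _ => ?_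
    rw [smul_smul, ← (ofTrunc_central (c l) _).eq, mul_smul,
      smul_smul (vert k (n - 1) i), ← path_mul_vert, mul_smul, hm]
  · obtain ⟨c, hc⟩ := hex i' z
    rw [hφ i' z c hc, hφ i _ (fun l => c l * x k n ^ ((i' - i) + (j l - i') - (j l - i))),
      Finset.smul_sum]
    · refine Finset.sum_congr rfl fun l _ => ?_
      rw [map_mul, ofTrunc_x_pow, smul_smul, smul_smul, smul_smul,
        ← (ofTrunc_central (c l) _).eq, mul_assoc, path_mul_path, ← mul_assoc]
    · rw [xShift_val, hc, Finset.smul_sum]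
      refine Finset.sum_congr rfl fun l _ => ?_
      refine (smul_smul (M := TruncPoly k n) _ _ _).trans (congrArg (· • _) ?_)
      rw [mul_left_comm, mul_assoc, ← pow_add, ← pow_add]
      congr 2
      omega
  · obtain ⟨a, ha⟩ := hex i z
    rw [hφ i z a ha, hφ i _ (fun l => c * a l), Finset.smul_sum]
    · exact Finset.sum_congr rfl fun l _ => by rw [map_mul, mul_smul]
    · rw [Submodule.coe_smul, ha, Finset.smul_sum]
      exact Finset.sum_congr rfl fun l _ => (smul_smul (M := TruncPoly k n) _ _ _).trans
        (congrArg (· • _) (mul_assoc _ _ _).symm)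
  · have hz : x k n ^ (j l + 1) • (Pi.single l (gen k n (j l + 1)) :
        ∀ l, CyclicMod k n (j l + 1)) = 0 := by
      rw [← Pi.single_smul, x_pow_smul_gen_self, Pi.single_zero]
    refine ⟨⟨_, mem_xTorsion.2 hz⟩, ?_⟩
    rw [hφ _ _ (Pi.single l 1), Finset.sum_eq_single l]
    · rw [Pi.single_eq_same, map_one, one_smul, path_self, one_smul]
    · intro l' _ h
      rw [Pi.single_eq_of_ne h, map_zero, zero_smul]
    · simp
    · rw [Finset.sum_eq_single l]
      · rw [Pi.single_eq_same, one_mul, Nat.sub_self, pow_zero, one_smul]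
      · intro l' _ h
        rw [Pi.single_eq_of_ne h, zero_mul]
        exact zero_smul (TruncPoly k n)
          (Pi.single l' (gen k n (j l' + 1)) : ∀ l, CyclicMod k n (j l + 1))
      · simp

namespace TorsionFamily

variable {Z : Type u} [AddCommGroup Z] [Module (TruncPoly k n) Z] (φ : TorsionFamily k n Z M)

theorem map_eq_zero_of_le {i : ℕ} (h : n ≤ i + 1) (z : xTorsion k n Z i) : φ.map i z = 0 := by
  rw [← φ.vert_smul, vert_of_le (by omega), zero_smul]

/-- The elements of the kernel of `φ i`. -/
noncomputable def ker (i : ℕ) : Submodule (TruncPoly k n) Z :=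
  Submodule.map (xTorsion k n Z i).subtype
    { carrier := {z | φ.map i z = 0}
      zero_mem' := map_zero _
      add_mem' := fun {a b} ha hb => by
        change φ.map i (a + b) = 0
        rw [map_add, show φ.map i a = 0 from ha, show φ.map i b = 0 from hb, add_zero]
      smul_mem' := fun c z hz => by
        change φ.map i (c • z) = 0
        rw [← φ.ofTrunc_smul, show φ.map i z = 0 from hz, smul_zero] }

theorem mem_ker {i : ℕ} {z : Z} : z ∈ φ.ker i ↔ ∃ h : z ∈ xTorsion k n Z i, φ.map i ⟨z, h⟩ = 0 := by
  constructor
  · rintro ⟨z, hz, rfl⟩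
    exact ⟨z.2, hz⟩
  · rintro ⟨h, hz⟩
    exact ⟨⟨z, h⟩, hz, rfl⟩

theorem x_pow_smul_mem_ker {i j : ℕ} {z : Z} (h : z ∈ φ.ker j) : x k n ^ (j - i) • z ∈ φ.ker i := by
  obtain ⟨h1, h2⟩ := φ.mem_ker.1 h
  refine φ.mem_ker.2 ⟨x_pow_smul_mem_xTorsion h1, ?_⟩
  exact (φ.path_smul i j ⟨z, h1⟩).symm.trans (by rw [h2, smul_zero])

theorem mem_ker_last (hn : 1 ≤ n) (z : Z) : z ∈ φ.ker (n - 1) :=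
  φ.mem_ker.2 ⟨mem_xTorsion.2 (x_pow_smul_of_le (by omega) _), φ.map_eq_zero_of_le (by omega) _⟩

/-- For each `i < n` finitely many generators of the kernel of `φ i` are taken, each of them the
image of the generator of a copy of `[i + 1]`. The sum of these copies is `Y`. -/
theorem exists_presentation (hn : 1 ≤ n) [Module.Finite (TruncPoly k n) Z] :
    ∃ (Y : Type u) (_ : AddCommGroup Y) (_ : Module (TruncPoly k n) Y)
      (_ : Module.Finite (TruncPoly k n) Y) (g : Y →ₗ[TruncPoly k n] Z),
      Function.Surjective g ∧ ∀ i (z : xTorsion k n Z i), (z : Z) ∈ phiRel g i ↔ φ.map i z = 0 := by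
  choose d s hs using fun i : Fin n =>
    Module.Finite.exists_fin (R := TruncPoly k n) (M := φ.ker i)
  let e (l : Σ i : Fin n, Fin (d i)) : ℕ := l.1 + 1
  let t (l : Σ i : Fin n, Fin (d i)) : Z := s l.1 l.2
  have ht (l : Σ i : Fin n, Fin (d i)) : x k n ^ e l • t l = 0 :=
    mem_xTorsion.1 (φ.mem_ker.1 (s l.1 l.2).2).1
  have hge (i : Fin n) (z : Z) (hz : z ∈ φ.ker i) :
      ∃ y, x k n ^ ((i : ℕ) + 1) • y = 0 ∧ CyclicMod.piLift e t ht y = z := by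
    have hmem : (⟨z, hz⟩ : φ.ker i) ∈ Submodule.span (TruncPoly k n) (Set.range (s i)) := by
      rw [hs]; trivial
    obtain ⟨c, hc⟩ := (Submodule.mem_span_range_iff_exists_fun _).1 hmem
    refine ⟨∑ l, c l • Pi.single (⟨i, l⟩ : Σ i : Fin n, Fin (d i)) (gen k n (e ⟨i, l⟩)), ?_, ?_⟩
    · rw [Finset.smul_sum]
      refine Finset.sum_eq_zero fun l _ => ?_
      rw [smul_comm, ← Pi.single_smul, show x k n ^ ((i : ℕ) + 1) • gen k n (e ⟨i, l⟩) = 0 from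
        x_pow_smul_gen_self _, Pi.single_zero, smul_zero]
    · rw [map_sum]
      simp only [map_smul, piLift_single]
      have := congrArg Subtype.val hc
      rw [AddSubmonoidClass.coe_finsetSum] at this
      exact this
  refine ⟨∀ l, CyclicMod k n (e l), inferInstance, inferInstance, inferInstance,
    CyclicMod.piLift e t ht, fun z => ?_, fun i z => ⟨fun hz => ?_, fun hz => ?_⟩⟩
  · obtain ⟨y, -, hy⟩ := hge ⟨n - 1, by omega⟩ z (φ.mem_ker_last hn z)
    exact ⟨y, hy⟩
  · by_cases hi : n ≤ i + 1
    · exact φ.map_eq_zero_of_le hi z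
    · suffices (z : Z) ∈ φ.ker i from (φ.mem_ker.1 this).2
      obtain ⟨w, y, hy, h⟩ := mem_phiRel.1 hz
      rw [← h]
      refine add_mem ?_ ?_
      · rw [show n - (i + 1) = n - 1 - i by omega]
        exact φ.x_pow_smul_mem_ker (φ.mem_ker_last hn w)
      · obtain ⟨c, rfl⟩ := pi_exists_sum_of_x_pow_smul_eq_zero e (fun l => l.1.2) hy
        rw [piLift_sum]
        refine sum_mem fun l _ => ?_
        rw [mul_smul, show e l - (i + 1) = (l.1 : ℕ) - i from Nat.add_sub_add_right _ _ _]
        exact Submodule.smul_mem _ _ (φ.x_pow_smul_mem_ker (s l.1 l.2).2)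
  · by_cases hi : n ≤ i + 1
    · exact mem_phiRel_of_le hi _
    · obtain ⟨y, hy, hyz⟩ := hge ⟨i, by omega⟩ z (φ.mem_ker.2 ⟨z.2, hz⟩)
      rw [← hyz]
      exact map_mem_phiRel hy

end TorsionFamily

/-- `Z` is the sum of a copy of `[i + 1]` for each component at a vertex `i` of each generator of
`M`, and `Y` presents the kernel. Surjectivity of `g` is what allows writing it as `Y → Y/X`. -/
theorem Phi.exists_equiv (hn : 1 ≤ n) (hM : IsFiniteLength (PreprojA k (n - 1)) M) :
    ∃ (Y Z : Type u) (_ : AddCommGroup Y) (_ : AddCommGroup Z) (_ : Module (TruncPoly k n) Y)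
      (_ : Module (TruncPoly k n) Z) (_ : Module.Finite (TruncPoly k n) Y)
      (_ : Module.Finite (TruncPoly k n) Z) (g : Y →ₗ[TruncPoly k n] Z),
      Function.Surjective g ∧ Nonempty (Phi g ≃ₗ[PreprojA k (n - 1)] M) := by
  have := (isFiniteLength_iff_isNoetherian_isArtinian.1 hM).1
  obtain ⟨d, s, hs⟩ := Module.Finite.exists_fin (R := PreprojA k (n - 1)) (M := M)
  let ι := Fin d × Fin (n - 1)
  obtain ⟨φ, hφ⟩ := exists_torsionFamily (k := k) (n := n) (ι := ι) (j := fun l => l.2)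
    (m := fun l => vert k (n - 1) l.2 • s l.1) (fun l => by have := l.2.2; omega)
    (fun l => by rw [smul_smul, vert_mul_self])
  obtain ⟨Y, _, _, _, g, hg, hrel⟩ := φ.exists_presentation hn
  refine ⟨Y, _, _, _, _, _, ‹_›, inferInstance, g, hg, ?_⟩
  obtain ⟨f, hf⟩ := Phi.exists_lift (g := g) φ.map (fun i z hz => (hrel i z).1 hz) φ.vert_smul
    φ.path_smul fun c i z => by
      rw [← φ.ofTrunc_smul, AlgHom.commutes]
  refine ⟨LinearEquiv.ofBijective f ⟨Phi.injective_of_forall fun i z hz => ?_, ?_⟩⟩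
  · exact (hrel i z).2 (by rw [← hf, hz])
  · rw [← LinearMap.range_eq_top, eq_top_iff, ← hs, Submodule.span_le]
    rintro _ ⟨a, rfl⟩
    have hsum : s a = ∑ i : Fin (n - 1), vert k (n - 1) i • s a := by
      rw [← Finset.sum_smul, sum_vert, one_smul]
    rw [SetLike.mem_coe, hsum]
    refine sum_mem fun i _ => ?_
    obtain ⟨z, hz⟩ := hφ (a, i)
    exact ⟨Phi.of g i z, (hf i z).trans hz⟩

end Density

/-! ### Factor categories and their equivalences -/

section FactorEquivalence

variable {C D : Type*} [Category C] [Preadditive C] [Category D] [Preadditive D]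

theorem AdditivelyEquivalent.symm (h : AdditivelyEquivalent C D) : AdditivelyEquivalent D C := by
  obtain ⟨e, he⟩ := h
  exact ⟨e.symm, e.inverse_additive⟩

theorem AdditivelyEquivalent.trans {E : Type*} [Category E] [Preadditive E]
    (h : AdditivelyEquivalent C D) (h' : AdditivelyEquivalent D E) : AdditivelyEquivalent C E := by
  obtain ⟨e, he⟩ := h
  obtain ⟨e', he'⟩ := h'
  exact ⟨e.trans e', inferInstanceAs (e.functor ⋙ e'.functor).Additive⟩

theorem additivelyEquivalent_of_map_eq_zero_iff (K : ObjectProperty C) (F : C ⥤ D) [F.Additive]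
    [F.Full] [F.EssSurj] (h : ∀ {X Y : C} (f : X ⟶ Y), F.map f = 0 ↔ f ∈ objIdeal K X Y) :
    AdditivelyEquivalent (FactorCategory K) D := by
  let F' : FactorCategory K ⥤ D := CategoryTheory.Quotient.lift (objIdealRel K) F fun X Y f g hfg => by
    rw [← sub_eq_zero, ← F.map_sub]
    exact (h _).2 hfg
  have hF' {X Y : C} (f : X ⟶ Y) : F'.map ((factorFunctor K).map f) = F.map f := rfl
  have hadd : F'.Additive := ⟨fun {X Y f g} => by
    obtain ⟨f, rfl⟩ := (factorFunctor K).map_surjective (X := X.as) (Y := Y.as) f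
    obtain ⟨g, rfl⟩ := (factorFunctor K).map_surjective (X := X.as) (Y := Y.as) g
    rw [← Functor.map_add, hF', hF', hF', F.map_add]⟩
  have hfaith : F'.Faithful := ⟨fun {X Y f g} hfg => by
    obtain ⟨f, rfl⟩ := (factorFunctor K).map_surjective (X := X.as) (Y := Y.as) f
    obtain ⟨g, rfl⟩ := (factorFunctor K).map_surjective (X := X.as) (Y := Y.as) g
    rw [hF', hF', ← sub_eq_zero, ← F.map_sub, h] at hfg
    exact CategoryTheory.Quotient.sound (objIdealRel K) hfg⟩
  have hfull : F'.Full := ⟨fun {X Y} f => by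
    obtain ⟨f, rfl⟩ := F.map_surjective (X := X.as) (Y := Y.as) f
    exact ⟨(factorFunctor K).map f, hF' f⟩⟩
  have hess : F'.EssSurj := ⟨fun Y => ⟨(factorFunctor K).obj (F.objPreimage Y),
    ⟨F.objObjPreimageIso Y⟩⟩⟩
  have : F'.IsEquivalence := {}
  exact ⟨F'.asEquivalence, hadd⟩

/-- The analogue for ideals of the third isomorphism theorem: morphisms lift along the full
projection, with an ambiguity in the ideal of `P`, which the ideal of `K` contains. -/
theorem map_map_eq_zero_iff {P K : ObjectProperty C} (hPK : ∀ X, P X → K X)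
    {Q : ObjectProperty (FactorCategory P)}
    (hKQ : ∀ X, K X → 𝟙 ((factorFunctor P).obj X) ∈ objIdeal Q _ _)
    (hQK : ∀ Y, Q Y → ∃ X, K X ∧ Y = (factorFunctor P).obj X) {X Y : C} (f : X ⟶ Y) :
    (factorFunctor P ⋙ factorFunctor Q).map f = 0 ↔ f ∈ objIdeal K X Y := by
  rw [Functor.comp_map, StableS.map_eq_zero_iff]
  constructor
  · suffices ∀ f', f' ∈ objIdeal Q ((factorFunctor P).obj X) ((factorFunctor P).obj Y) →
        ∃ f₀ ∈ objIdeal K X Y, (factorFunctor P).map f₀ = f' by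
      intro hf
      obtain ⟨f₀, hf₀, h⟩ := this _ hf
      rw [← sub_eq_zero, ← Functor.map_sub, StableS.map_eq_zero_iff] at h
      rw [← sub_sub_cancel f₀ f]
      exact sub_mem hf₀ (objIdeal_mono hPK h)
    intro f' hf'
    induction hf' using AddSubgroup.closure_induction with
    | mem f' hf' =>
      obtain ⟨W, hW, a, b, rfl⟩ := hf'
      obtain ⟨Z, hZ, rfl⟩ := hQK W hW
      obtain ⟨a, rfl⟩ := (factorFunctor P).map_surjective a
      obtain ⟨b, rfl⟩ := (factorFunctor P).map_surjective b
      exact ⟨a ≫ b, AddSubgroup.subset_closure ⟨Z, hZ, a, b, rfl⟩, Functor.map_comp _ _ _⟩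
    | zero => exact ⟨0, zero_mem _, Functor.map_zero _ _ _⟩
    | add a b _ _ ha hb =>
      obtain ⟨a, ha, rfl⟩ := ha
      obtain ⟨b, hb, rfl⟩ := hb
      exact ⟨a + b, add_mem ha hb, Functor.map_add _⟩
    | neg a _ ha =>
      obtain ⟨a, ha, rfl⟩ := ha
      exact ⟨-a, neg_mem ha, Functor.map_neg _⟩
  · intro hf
    induction hf using AddSubgroup.closure_induction with
    | mem f hf =>
      obtain ⟨Z, hZ, a, b, rfl⟩ := hf
      rw [Functor.map_comp]
      exact mem_objIdeal_of_factor (hKQ Z hZ) _ _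
    | zero => rw [Functor.map_zero]; exact zero_mem _
    | add a b _ _ ha hb => rw [Functor.map_add]; exact add_mem ha hb
    | neg a _ ha => rw [Functor.map_neg]; exact neg_mem ha

theorem map_eq_zero_of_mem {K : ObjectProperty C} {F : C ⥤ D} [F.Additive]
    (h : ∀ X, K X → IsZero (F.obj X)) {X Y : C} {f : X ⟶ Y} (hf : f ∈ objIdeal K X Y) :
    F.map f = 0 := by
  induction hf using AddSubgroup.closure_induction with
  | mem f hf =>
    obtain ⟨Z, hZ, a, b, rfl⟩ := hf
    rw [F.map_comp, (h Z hZ).eq_of_tgt (F.map a) 0, zero_comp]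
  | zero => exact F.map_zero _ _
  | add a b _ _ ha hb => rw [F.map_add, ha, hb, add_zero]
  | neg a _ ha => rw [F.map_neg, ha, neg_zero]

theorem IsAbelianCategory.of_additivelyEquivalent [HasFiniteProducts C]
    (hD : IsAbelianCategory D) (h : AdditivelyEquivalent C D) : IsAbelianCategory C := by
  obtain ⟨A, -⟩ := hD
  obtain ⟨e, -⟩ := h
  exact ⟨abelianOfEquivalence e.functor, rfl⟩

end FactorEquivalence

/-! ### The abelian category `mod R` -/

theorem FinLenMod.isAbelianCategory (R : Type u) [Ring R] : IsAbelianCategory (FinLenMod R) := by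
  let P : ObjectProperty (ModuleCat.{u} R) := fun M => IsFiniteLength R M
  have : P.IsClosedUnderSubobjects := ⟨fun f _ hY =>
    IsFiniteLength.of_injective hY ((ModuleCat.mono_iff_injective f).1 inferInstance)⟩
  have : P.IsClosedUnderQuotients := ⟨fun f _ hX =>
    IsFiniteLength.of_surjective hX ((ModuleCat.epi_iff_surjective f).1 inferInstance)⟩
  have : P.ContainsZero :=
    ⟨⟨ModuleCat.of R PUnit, ModuleCat.isZero_of_subsingleton _, IsFiniteLength.of_subsingleton⟩⟩
  have : P.IsClosedUnderBinaryProducts := ⟨by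
    rintro X ⟨p⟩
    have hm := isFiniteLength_iff_isNoetherian_isArtinian.1 (p.prop_diag_obj ⟨.left⟩)
    have hm' := isFiniteLength_iff_isNoetherian_isArtinian.1 (p.prop_diag_obj ⟨.right⟩)
    have := hm.1
    have := hm.2
    have := hm'.1
    have := hm'.2
    let f : X →ₗ[R] (p.diag.obj ⟨.left⟩ × p.diag.obj ⟨.right⟩) :=
      (p.π.app ⟨.left⟩).hom.prod (p.π.app ⟨.right⟩).hom
    refine IsFiniteLength.of_injective (f := f)
      (isFiniteLength_iff_isNoetherian_isArtinian.2 ⟨inferInstance, inferInstance⟩) ?_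
    rw [injective_iff_map_eq_zero]
    intro x hx
    -- The element is regarded as a map from `R`, and the universal property of the product is
    -- applied to it.
    have h : ModuleCat.ofHom (LinearMap.toSpanSingleton R X x) = 0 := p.isLimit.hom_ext (by
      rintro ⟨_ | _⟩
      · refine ModuleCat.hom_ext (LinearMap.ext_ring ?_)
        exact (congrArg (p.π.app ⟨.left⟩).hom (one_smul R x)).trans 
          ((congrArg Prod.fst hx).trans (map_zero (p.π.app ⟨.left⟩).hom).symm)
      · refine ModuleCat.hom_ext (LinearMap.ext_ring ?_)
        exact (congrArg (p.π.app ⟨.right⟩).hom (one_smul R x)).trans 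
          ((congrArg Prod.snd hx).trans (map_zero (p.π.app ⟨.right⟩).hom).symm))
    rw [← one_smul R x]
    exact LinearMap.congr_fun (ModuleCat.hom_ext_iff.1 h) 1⟩
  have : P.IsClosedUnderFiniteProducts := ObjectProperty.IsClosedUnderFiniteProducts.mk'
  exact ⟨inferInstanceAs (Abelian P.FullSubcategory), rfl⟩

namespace FinLenMod

variable {R : Type u} [Ring R]

/-- A module of finite length as an object of `mod R`. -/
noncomputable abbrev of {M : Type u} [AddCommGroup M] [Module R M] (h : IsFiniteLength R M) :
    FinLenMod R :=
  ⟨ModuleCat.of R M, h⟩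

/-- The morphism of `mod R` given by a linear map. -/
noncomputable def homMk {M N : FinLenMod R} (f : M.obj →ₗ[R] N.obj) : M ⟶ N :=
  ObjectProperty.homMk (ModuleCat.ofHom f)

theorem homMk_surjective {M N : FinLenMod R} (f : M ⟶ N) : ∃ f' : M.obj →ₗ[R] N.obj, homMk f' = f :=
  ⟨f.hom.hom, rfl⟩

theorem homMk_injective {M N : FinLenMod R} {f f' : M.obj →ₗ[R] N.obj} (h : homMk f = homMk f') :
    f = f' :=
  congrArg (fun f : M ⟶ N => f.hom.hom) h

theorem homMk_zero (M N : FinLenMod R) : homMk (0 : M.obj →ₗ[R] N.obj) = 0 := rfl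

theorem homMk_id (M : FinLenMod R) : homMk (LinearMap.id : M.obj →ₗ[R] M.obj) = 𝟙 M := rfl

theorem homMk_comp {L M N : FinLenMod R} (f : L.obj →ₗ[R] M.obj) (f' : M.obj →ₗ[R] N.obj) :
    homMk (f' ∘ₗ f) = homMk f ≫ homMk f' := rfl

theorem isZero_of_subsingleton (M : FinLenMod R) [Subsingleton M.obj] : IsZero M := by
  rw [IsZero.iff_id_eq_zero, ← homMk_id, ← homMk_zero]
  exact congrArg homMk (LinearMap.ext fun _ => Subsingleton.elim _ _)

theorem nonempty_iso {M N : FinLenMod R} (e : M.obj ≃ₗ[R] N.obj) : Nonempty (M ≅ N) :=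
  ⟨{ hom := homMk e.toLinearMap
     inv := homMk e.symm.toLinearMap
     hom_inv_id := by
      rw [← homMk_comp, ← homMk_id]
      exact congrArg homMk (LinearMap.ext e.symm_apply_apply)
     inv_hom_id := by
      rw [← homMk_comp, ← homMk_id]
      exact congrArg homMk (LinearMap.ext e.apply_symm_apply) }⟩

end FinLenMod

namespace SubmodPair

open TruncPoly CyclicMod

variable {k : Type u} [Field k] {n : ℕ} {A B : SubmodPair k n}

/-! ### The functor given by `Y → Y / X`, with kernel the ideal of `𝒱` -/

section QuotientFunctor

/-- The map `Y / X → Y' / X'` induced by a morphism of pairs. -/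
noncomputable def quotMap (f : A ⟶ B) : (A.Y ⧸ A.X) →ₗ[TruncPoly k n] (B.Y ⧸ B.X) :=
  Submodule.mapQ A.X B.X (toLin f) f.2

theorem quotMap_mkQ (f : A ⟶ B) (y : A.Y) : quotMap f (A.X.mkQ y) = B.X.mkQ (toLin f y) := rfl

theorem quotMap_le (f : A ⟶ B) (i : ℕ) :
    phiRel A.X.mkQ i ≤ (phiRel B.X.mkQ i).comap (quotMap f) :=
  phiRel_le_comap (quotMap_mkQ f) i

/-- The functor to `mod Π_{n-1}` which maps `(X, Y)` to `Phi (Y → Y / X)`. -/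
noncomputable def quotFunctor (k : Type u) [Field k] (n : ℕ) :
    SubmodPair k n ⥤ FinLenMod (PreprojA k (n - 1)) where
  obj A := FinLenMod.of (Phi.isFiniteLength (g := A.X.mkQ))
  map f := FinLenMod.homMk (Phi.map (quotMap f) (quotMap_le f))
  map_id A := congrArg FinLenMod.homMk (Phi.map_id (fun z => by
    obtain ⟨y, rfl⟩ := A.X.mkQ_surjective z
    rfl) _)
  map_comp f f' := congrArg FinLenMod.homMk (Phi.map_comp (fun z => by
    obtain ⟨y, rfl⟩ := Submodule.mkQ_surjective _ z
    rfl) (quotMap_le f) (quotMap_le f') _)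

instance : (quotFunctor k n).Additive where
  map_add {A _ f f'} := congrArg FinLenMod.homMk (Phi.map_add (fun z => by
    obtain ⟨y, rfl⟩ := A.X.mkQ_surjective z
    rfl) (quotMap_le f) (quotMap_le f') _)

theorem quotFunctor_map_eq_zero_iff (f : A ⟶ B) : (quotFunctor k n).map f = 0 ↔
    ∀ i, ∀ z ∈ xTorsion k n (A.Y ⧸ A.X) i, quotMap f z ∈ phiRel B.X.mkQ i :=
  Iff.trans ⟨fun h => FinLenMod.homMk_injective h, fun h => congrArg FinLenMod.homMk h⟩
    (Phi.map_eq_zero_iff (quotMap f) (quotMap_le f))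

/-- The map `w` out of a free module lifts to `B.Y`, so the map of quotients lifts to a map of the
big modules, which then preserves the submodules. -/
instance : (quotFunctor k n).Full where
  map_surjective {A B} f := by
    obtain ⟨f, rfl⟩ := FinLenMod.homMk_surjective f
    obtain ⟨ζ, d, s, v, w, hf, hs⟩ := Phi.exists_lift_factorization (g := A.X.mkQ) (g' := B.X.mkQ) f
    obtain ⟨w', hw'⟩ := exists_lift_pi B.X.mkQ B.X.mkQ_surjective w
    let η : A.Y →ₗ[TruncPoly k n] B.Y := s + w' ∘ₗ v
    have hη (y : A.Y) : B.X.mkQ (η y) = ζ (A.X.mkQ y) := by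
      rw [hs, ← hw', LinearMap.add_apply, map_add]
      rfl
    let h : A ⟶ B := homMk η fun y hy => by
      rw [← B.X.ker_mkQ, LinearMap.mem_ker, hη]
      rw [← A.X.ker_mkQ, LinearMap.mem_ker] at hy
      rw [hy, map_zero]
    refine ⟨h, congrArg FinLenMod.homMk (Phi.map_eq_of_forall (quotMap_le h) hf fun i z _ => ?_)⟩
    obtain ⟨y, rfl⟩ := A.X.mkQ_surjective z
    rw [show quotMap h (A.X.mkQ y) = ζ (A.X.mkQ y) from hη y, sub_self]
    exact zero_mem _

/-- A surjection `g : Y → Z` is replaced by the isomorphic one onto `Y` modulo the kernel of `g`. -/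
theorem quotFunctor_essSurj (hn : 1 ≤ n) : (quotFunctor k n).EssSurj where
  mem_essImage N := by
    obtain ⟨Y, Z, _, _, _, _, _, _, g, hg, ⟨e⟩⟩ := Phi.exists_equiv hn N.property
    let φ := g.quotKerEquivOfSurjective hg
    have hφ (y : Y) : φ ((LinearMap.ker g).mkQ y) = g y := rfl
    have hle (i : ℕ) : phiRel (LinearMap.ker g).mkQ i ≤ (phiRel g i).comap φ.toLinearMap :=
      phiRel_le_comap (η := LinearMap.id) hφ i
    have hle' (i : ℕ) : phiRel g i ≤ (phiRel (LinearMap.ker g).mkQ i).comap φ.symm.toLinearMap :=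
      phiRel_le_comap (η := LinearMap.id) (fun y => by
        rw [← hφ]; exact φ.symm_apply_apply _) i
    refine ⟨of (LinearMap.ker g), FinLenMod.nonempty_iso ((LinearEquiv.ofBijective
      (Phi.map φ.toLinearMap hle) (Phi.map_bijective _ _ (fun i z _ hz' => ?_)
        fun i z' hz' => ⟨φ.symm z', map_mem_xTorsion φ.symm.toLinearMap hz',
          φ.apply_symm_apply z'⟩)).trans e)⟩
    have := hle' i hz'
    rw [Submodule.mem_comap] at this
    rwa [← φ.symm_apply_apply z]

/-- If `f` is killed, its map of quotients lifts to `t : Y/X → Y'`. Thus `f` is the sum of a map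
through `(0, Y/X)` and of the remainder, which has values in `X'` and passes through `(Y, Y)`. -/
theorem quotFunctor_map_eq_zero_iff_mem (f : A ⟶ B) :
    (quotFunctor k n).map f = 0 ↔ f ∈ objIdeal (classV k n) A B := by
  constructor
  · rw [quotFunctor_map_eq_zero_iff]
    intro h
    obtain ⟨d, s, v, w, -, hs⟩ := exists_factorization B.X.mkQ (quotMap f) h
    obtain ⟨w', hw'⟩ := exists_lift_pi B.X.mkQ B.X.mkQ_surjective w
    let t : (A.Y ⧸ A.X) →ₗ[TruncPoly k n] B.Y := s + w' ∘ₗ v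
    have ht (y : A.Y) : B.X.mkQ (t (A.X.mkQ y)) = B.X.mkQ (toLin f y) := by
      rw [← quotMap_mkQ, hs, ← hw', LinearMap.add_apply, map_add]
      rfl
    have hr (y : A.Y) : (toLin f - t ∘ₗ A.X.mkQ) y ∈ B.X := by
      rw [← B.X.ker_mkQ, LinearMap.mem_ker, LinearMap.sub_apply, map_sub, LinearMap.comp_apply, ht,
        sub_self]
    let P : SubmodPair k n := of (⊥ : Submodule (TruncPoly k n) (A.Y ⧸ A.X))
    let Q : SubmodPair k n := of (⊤ : Submodule (TruncPoly k n) A.Y)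
    have hP : 𝟙 P ∈ objIdeal (classV k n) P P :=
      id_mem_of_X_eq_bot (fun j hj => ⟨0, j, j.zero_le, hj, Or.inr rfl, rfl⟩) rfl
    have hQ : 𝟙 Q ∈ objIdeal (classV k n) Q Q :=
      id_mem_of_X_eq_top (fun j hj => ⟨j, j, le_rfl, hj, Or.inl rfl, rfl⟩) rfl
    let a : A ⟶ P := homMk (B := P) A.X.mkQ fun y hy =>
      (Submodule.mem_bot _).2 ((Submodule.Quotient.mk_eq_zero _).2 hy)
    let b : P ⟶ B := homMk (A := P) t fun y hy => by
      rw [(Submodule.mem_bot _).1 hy, map_zero]; exact zero_mem _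
    let c : A ⟶ Q := homMk (B := Q) LinearMap.id fun _ _ => trivial
    let r : Q ⟶ B := homMk (A := Q) (toLin f - t ∘ₗ A.X.mkQ) fun y _ => hr y
    rw [show f = a ≫ b + c ≫ r from hom_ext fun y => (add_sub_cancel (t (A.X.mkQ y)) _).symm]
    exact add_mem (mem_objIdeal_of_factor hP a b) (mem_objIdeal_of_factor hQ c r)
  · refine map_eq_zero_of_mem ?_
    rintro _ ⟨i, j, hij, hj, h | h, rfl⟩
    · subst h
      have : Subsingleton (Phi (pair k n i i).X.mkQ) := Phi.subsingleton_of_forall fun l z _ => by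
        obtain ⟨y, rfl⟩ := Submodule.mkQ_surjective _ z
        rw [show (pair k n i i).X.mkQ y = 0 from
          (Submodule.Quotient.mk_eq_zero _).2 (mem_pair_X_self y)]
        exact zero_mem _
      exact FinLenMod.isZero_of_subsingleton (FinLenMod.of Phi.isFiniteLength)
    · subst h
      have : Subsingleton (Phi (pair k n 0 j).X.mkQ) := Phi.subsingleton_of_forall fun l z hz => by
        obtain ⟨y, rfl⟩ := Submodule.mkQ_surjective _ z
        refine map_mem_phiRel (mem_pair_X_zero.1 ?_)
        rw [mem_xTorsion, ← map_smul] at hz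
        exact (Submodule.Quotient.mk_eq_zero _).1 hz
      exact FinLenMod.isZero_of_subsingleton (FinLenMod.of Phi.isFiniteLength)

end QuotientFunctor

/-! ### The functor given by `X → Y`, with kernel the ideal of `𝒰` -/

section SubFunctor

theorem toLin_subtype_le (f : A ⟶ B) (i : ℕ) :
    phiRel A.X.subtype i ≤ (phiRel B.X.subtype i).comap (toLin f) :=
  phiRel_le_comap (g := A.X.subtype) (g' := B.X.subtype) (ζ := toLin f)
    (η := (toLin f).restrict f.2) (fun _ => rfl) i

/-- The functor to `mod Π_{n-1}` which maps `(X, Y)` to `Phi (X → Y)`. -/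
noncomputable def subFunctor (k : Type u) [Field k] (n : ℕ) :
    SubmodPair k n ⥤ FinLenMod (PreprojA k (n - 1)) where
  obj A := FinLenMod.of (Phi.isFiniteLength (g := A.X.subtype))
  map f := FinLenMod.homMk (Phi.map (toLin f) (toLin_subtype_le f))
  map_id _ := congrArg FinLenMod.homMk (Phi.map_id (fun _ => rfl) _)
  map_comp f f' := congrArg FinLenMod.homMk
    (Phi.map_comp (fun _ => rfl) (toLin_subtype_le f) (toLin_subtype_le f') _)

instance : (subFunctor k n).Additive where
  map_add {_ _ f f'} := congrArg FinLenMod.homMk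
    (Phi.map_add (fun _ => rfl) (toLin_subtype_le f) (toLin_subtype_le f') _)

theorem subFunctor_map_eq_zero_iff (f : A ⟶ B) : (subFunctor k n).map f = 0 ↔
    ∀ i, ∀ z ∈ xTorsion k n A.Y i, toLin f z ∈ phiRel B.X.subtype i :=
  Iff.trans ⟨fun h => FinLenMod.homMk_injective h, fun h => congrArg FinLenMod.homMk h⟩
    (Phi.map_eq_zero_iff (toLin f) (toLin_subtype_le f))

/-- In a free module every element at the vertex `i` is a relation, so `Phi` does not see maps which
factor through free modules. -/
theorem exists_x_pow_smul_of_mem_xTorsion {i : ℕ} (hi : i + 1 ≤ n) {q : CyclicMod k n n}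
    (hq : q ∈ xTorsion k n (CyclicMod k n n) i) : ∃ q', q = x k n ^ (n - (i + 1)) • q' :=
  exists_x_pow_smul_of_eq_zero (Nat.sub_le n (i + 1)) (by
    rw [Nat.sub_sub_self hi]
    exact mem_xTorsion.1 hq)

theorem pi_exists_x_pow_smul_of_mem_xTorsion {ι : Type} {i : ℕ} (hi : i + 1 ≤ n)
    {q : ι → CyclicMod k n n} (hq : q ∈ xTorsion k n (ι → CyclicMod k n n) i) :
    ∃ q', q = x k n ^ (n - (i + 1)) • q' := by
  choose q' hq' using fun l => exists_x_pow_smul_of_mem_xTorsion hi (q := q l)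
    (mem_xTorsion.2 (congrFun (mem_xTorsion.1 hq) l))
  exact ⟨q', funext hq'⟩

/-- On `X` one has `ζ = s + w v`. By self-injectivity `v` extends to `v'` on `Y`; then `ζ - w v'`
maps `X` into `X'` and differs from `ζ` by a map through a free module, which `Phi` ignores. -/
instance : (subFunctor k n).Full where
  map_surjective {A B} f := by
    obtain ⟨f, rfl⟩ := FinLenMod.homMk_surjective f
    obtain ⟨ζ, d, s, v, w, hf, hs⟩ :=
      Phi.exists_lift_factorization (g := A.X.subtype) (g' := B.X.subtype) f
    obtain ⟨v', hv'⟩ := exists_extension_pi A.X.subtype A.X.injective_subtype v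
    have hη (y : A.X) : (ζ - w ∘ₗ v') y = s y := by
      have h1 : ζ y = s y + w (v y) := hs y
      rw [LinearMap.sub_apply, h1, ← hv']
      exact add_sub_cancel_right _ _
    let h : A ⟶ B := homMk (ζ - w ∘ₗ v') fun y hy => by
      rw [hη ⟨y, hy⟩]; exact (s ⟨y, hy⟩).2
    refine ⟨h, congrArg FinLenMod.homMk
      (Phi.map_eq_of_forall (toLin_subtype_le h) hf fun i z hz => ?_)⟩
    rw [show toLin h z - ζ z = -w (v' z) from sub_sub_cancel_left (ζ z) (w (v' z))]
    refine neg_mem ?_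
    by_cases hi : i + 1 ≤ n
    · obtain ⟨q, hq⟩ := pi_exists_x_pow_smul_of_mem_xTorsion hi (map_mem_xTorsion v' hz)
      rw [hq, map_smul]
      exact x_pow_smul_mem_phiRel (by omega) _
    · exact mem_phiRel_of_le (by omega) _

/-- An arbitrary `g` is made injective by adding an embedding of `Y` into a free module to its
target; the free summand does not change `Phi`. -/
theorem nonempty_phi_subtype_equiv {Y Z : Type u} [AddCommGroup Y] [AddCommGroup Z]
    [Module (TruncPoly k n) Y] [Module (TruncPoly k n) Z] (g : Y →ₗ[TruncPoly k n] Z) {d : ℕ}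
    (ι : Y →ₗ[TruncPoly k n] (Fin d → CyclicMod k n n)) (hι : Function.Injective ι) :
    Nonempty (Phi (LinearMap.range (g.prod ι)).subtype ≃ₗ[PreprojA k (n - 1)] Phi g) := by
  have hW {i : ℕ} (p : LinearMap.range (g.prod ι)) (hp : x k n ^ (i + 1) • p = 0) :
      ∃ y, x k n ^ (i + 1) • y = 0 ∧ g.prod ι y = p.1 := by
    obtain ⟨_, y, rfl⟩ := p
    refine ⟨y, hι ?_, rfl⟩
    rw [map_smul, map_zero]
    exact congrArg Prod.snd (congrArg Subtype.val hp)
  have hle (i : ℕ) : phiRel (LinearMap.range (g.prod ι)).subtype i ≤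
      (phiRel g i).comap (LinearMap.fst (TruncPoly k n) Z (Fin d → CyclicMod k n n)) := by
    intro z hz
    obtain ⟨w, p, hp, rfl⟩ := mem_phiRel.1 hz
    obtain ⟨y, hy, hyp⟩ := hW p hp
    refine mem_phiRel.2 ⟨w.1, y, hy, ?_⟩
    rw [map_add, map_smul, Submodule.subtype_apply, ← hyp]
    rfl
  refine ⟨LinearEquiv.ofBijective (Phi.map (LinearMap.fst _ _ _) hle)
    (Phi.map_bijective _ _ (fun i z hz hz' => ?_) fun i z' hz' =>
      ⟨(z', 0), mem_xTorsion.2 (Prod.ext (mem_xTorsion.1 hz') (smul_zero _)), rfl⟩)⟩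
  by_cases hi : i + 1 ≤ n
  · obtain ⟨w, y, hy, h⟩ := mem_phiRel.1 hz'
    have hq : z.2 - ι y ∈ xTorsion k n (Fin d → CyclicMod k n n) i :=
      sub_mem (map_mem_xTorsion (LinearMap.snd _ _ _) hz)
        (map_mem_xTorsion ι (mem_xTorsion.2 hy))
    obtain ⟨q, hq⟩ := pi_exists_x_pow_smul_of_mem_xTorsion hi hq
    refine mem_phiRel.2 ⟨(w, q), ⟨_, y, rfl⟩, Subtype.ext ?_, Prod.ext h ?_⟩
    · exact (map_smul (g.prod ι) _ y).symm.trans (by rw [hy, map_zero]; rfl)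
    · change x k n ^ (n - (i + 1)) • q + ι y = z.2
      rw [← hq, sub_add_cancel]
  · exact mem_phiRel_of_le (by omega) _

theorem subFunctor_essSurj (hn : 1 ≤ n) : (subFunctor k n).EssSurj where
  mem_essImage N := by
    obtain ⟨Y, Z, _, _, _, _, _, _, g, -, ⟨e⟩⟩ := Phi.exists_equiv hn N.property
    obtain ⟨d, ι, hι⟩ := exists_embedding_pi (k := k) (n := n) Y
    obtain ⟨e'⟩ := nonempty_phi_subtype_equiv g ι hι
    exact ⟨of (LinearMap.range (g.prod ι)), FinLenMod.nonempty_iso (e'.trans e)⟩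

theorem subsingleton_phi_subtype (X : Submodule (TruncPoly k n) (CyclicMod k n n)) :
    Subsingleton (Phi X.subtype) :=
  Phi.subsingleton_of_forall fun l z hz => by
    by_cases hl : l + 1 ≤ n
    · obtain ⟨z', rfl⟩ := exists_x_pow_smul_of_mem_xTorsion hl hz
      exact x_pow_smul_mem_phiRel (by omega) z'
    · exact mem_phiRel_of_le (by omega) _

/-- If `f` is killed, then `f = s + w v` with `s : Y → X'` and `v` into a free module: the first
term passes through `(Y, Y)`, the second through `v(X)` in the free module, a pair covered by
`id_mem_of_free`. -/
theorem subFunctor_map_eq_zero_iff_mem (f : A ⟶ B) :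
    (subFunctor k n).map f = 0 ↔ f ∈ objIdeal (classU k n) A B := by
  constructor
  · rw [subFunctor_map_eq_zero_iff]
    intro h
    obtain ⟨d, s, v, w, -, hs⟩ := exists_factorization B.X.subtype (toLin f) h
    let P : SubmodPair k n := of (⊤ : Submodule (TruncPoly k n) A.Y)
    let Q : SubmodPair k n := of (A.X.map v)
    have hP : 𝟙 P ∈ objIdeal (classU k n) P P :=
      id_mem_of_X_eq_top (fun j hj => ⟨j, j, le_rfl, hj, Or.inl rfl, rfl⟩) rfl
    have hQ : 𝟙 Q ∈ objIdeal (classU k n) Q Q :=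
      id_mem_of_free (fun i hi => ⟨i, n, hi, le_rfl, Or.inr rfl, rfl⟩) (A.X.map v)
    let a : A ⟶ P := homMk (B := P) LinearMap.id fun _ _ => trivial
    let b : P ⟶ B := homMk (A := P) (B.X.subtype ∘ₗ s) fun y _ => (s y).2
    let c : A ⟶ Q := homMk (B := Q) v fun y hy => ⟨y, hy, rfl⟩
    let r : Q ⟶ B := homMk (A := Q) w (by
      rintro _ ⟨y, hy, rfl⟩
      rw [show w (v y) = toLin f y - B.X.subtype (s y) by rw [hs, add_sub_cancel_left]]
      exact sub_mem (toLin_mem f hy) (s y).2)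
    rw [show f = a ≫ b + c ≫ r from hom_ext hs]
    exact add_mem (mem_objIdeal_of_factor hP a b) (mem_objIdeal_of_factor hQ c r)
  · refine map_eq_zero_of_mem ?_
    rintro _ ⟨i, j, hij, hj, h | h, rfl⟩
    · subst h
      have : Subsingleton (Phi (pair k n i i).X.subtype) :=
        Phi.subsingleton_of_forall fun l z hz => map_mem_phiRel
          (g := (pair k n i i).X.subtype) (y := ⟨z, mem_pair_X_self z⟩)
          (Subtype.ext (mem_xTorsion.1 hz))
      exact FinLenMod.isZero_of_subsingleton (FinLenMod.of Phi.isFiniteLength)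
    · subst h
      -- The substitution has renamed `n` to `j`, so the big module is the free module of rank one.
      have : Subsingleton (Phi (pair k j i j).X.subtype) :=
        subsingleton_phi_subtype (k := k) (n := j) (pair k j i j).X
      exact FinLenMod.isZero_of_subsingleton (FinLenMod.of Phi.isFiniteLength)

end SubFunctor

end SubmodPair

/-! ### The ideals of the stable category compared with those of `𝒮(n)` -/

namespace StableS

variable {k : Type u} [Field k] {n : ℕ}

theorem id_proj_mem_of_projInj {A : SubmodPair k n} (hA : SubmodPair.projInj k n A)
    (Q : ObjectProperty (StableS k n)) : 𝟙 ((proj k n).obj A) ∈ objIdeal Q _ _ := by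
  rw [← CategoryTheory.Functor.map_id,
    (map_eq_zero_iff (SubmodPair.projInj k n) _).2 (id_mem_objIdeal hA)]
  exact zero_mem _

theorem id_proj_pair_zero_mem (Q : ObjectProperty (StableS k n)) :
    𝟙 ((proj k n).obj (SubmodPair.pair k n 0 0)) ∈ objIdeal Q _ _ := by
  have h : (1 : TruncPoly k n) • SubmodPair.pairGen k n 0 0 = 0 :=
    SubmodPair.smul_pairGen_eq_zero.2 (by rw [pow_zero]; exact Ideal.mem_span_singleton_self _)
  rw [one_smul] at h
  rw [← CategoryTheory.Functor.map_id, show 𝟙 (SubmodPair.pair k n 0 0) = 0 from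
    SubmodPair.pair_hom_ext (by rw [h, map_zero, map_zero]), Functor.map_zero]
  exact zero_mem _

/-- Besides the pairs indexed by `indexI`, the class `𝒰` contains only the two projective-injective
pairs and the zero object `([0],[0])`, all of them zero in `𝒯`. The same holds for `𝒱` and `indexJ`.
-/
theorem factor_I_map_eq_zero_iff {A B : SubmodPair k n} (f : A ⟶ B) :
    (proj k n ⋙ factorFunctor (pairs k n (indexI n))).map f = 0 ↔
      f ∈ objIdeal (SubmodPair.classU k n) A B := by
  refine map_map_eq_zero_iff ?_ ?_ ?_ f
  · rintro _ (rfl | rfl)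
    · exact ⟨0, n, n.zero_le, le_rfl, Or.inr rfl, rfl⟩
    · exact ⟨n, n, le_rfl, le_rfl, Or.inr rfl, rfl⟩
  · rintro _ ⟨i, j, hij, hj, h, rfl⟩
    by_cases h0 : i = 0
    · rcases h with rfl | rfl
      · subst h0
        exact id_proj_pair_zero_mem _
      · subst h0
        exact id_proj_mem_of_projInj (Or.inl rfl) _
    · by_cases hi : i ≤ n - 1
      · exact id_mem_objIdeal ⟨(i, j), ⟨Nat.one_le_iff_ne_zero.2 h0, hi, h⟩, rfl⟩
      · obtain rfl : i = n := by omega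
        obtain rfl : j = i := by omega
        exact id_proj_mem_of_projInj (Or.inr rfl) _
  · rintro _ ⟨⟨i, j⟩, ⟨h1, h2, h3⟩, rfl⟩
    refine ⟨_, ⟨i, j, ?_, ?_, h3, rfl⟩, rfl⟩ <;> dsimp only at h1 h2 h3 <;> omega

theorem factor_J_map_eq_zero_iff {A B : SubmodPair k n} (f : A ⟶ B) :
    (proj k n ⋙ factorFunctor (pairs k n (indexJ n))).map f = 0 ↔
      f ∈ objIdeal (SubmodPair.classV k n) A B := by
  refine map_map_eq_zero_iff ?_ ?_ ?_ f
  · rintro _ (rfl | rfl)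
    · exact ⟨0, n, n.zero_le, le_rfl, Or.inr rfl, rfl⟩
    · exact ⟨n, n, le_rfl, le_rfl, Or.inl rfl, rfl⟩
  · rintro _ ⟨i, j, hij, hj, h, rfl⟩
    by_cases h0 : j = 0
    · obtain rfl : i = 0 := by omega
      subst h0
      exact id_proj_pair_zero_mem _
    · by_cases hi : j ≤ n - 1
      · exact id_mem_objIdeal ⟨(i, j), ⟨Nat.one_le_iff_ne_zero.2 h0, hi, h⟩, rfl⟩
      · obtain rfl : j = n := by omega
        rcases h with rfl | rfl
        · exact id_proj_mem_of_projInj (Or.inr rfl) _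
        · exact id_proj_mem_of_projInj (Or.inl rfl) _
  · rintro _ ⟨⟨i, j⟩, ⟨h1, h2, h3⟩, rfl⟩
    refine ⟨_, ⟨i, j, ?_, ?_, h3, rfl⟩, rfl⟩ <;> dsimp only at h1 h2 h3 <;> omega

theorem indexI_properties (n : ℕ) : (indexI n).ncard = 2 * n - 2 ∧
    (∀ p ∈ indexI n, Indecomposable (pair k n p)) ∧
    (indexI n).Pairwise fun p q => IsEmpty (pair k n p ≅ pair k n q) := by
  refine ⟨indexI_ncard n, fun p hp => ?_, fun p hp q hq hpq => ⟨fun e => hpq ?_⟩⟩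
  · obtain ⟨h0, h1, h2, h3, h4⟩ := indexI_bounds hp
    exact pair_indecomposable h0 h1 h2 h3 h4
  · obtain ⟨h0, h1, h2, h3, h4⟩ := indexI_bounds hp
    obtain ⟨-, hq1, hq2, -, -⟩ := indexI_bounds hq
    exact eq_of_pair_iso h0 h1 h2 h3 h4 hq1 hq2 e

theorem indexJ_properties (n : ℕ) : (indexJ n).ncard = 2 * n - 2 ∧
    (∀ p ∈ indexJ n, Indecomposable (pair k n p)) ∧
    (indexJ n).Pairwise fun p q => IsEmpty (pair k n p ≅ pair k n q) := by
  refine ⟨indexJ_ncard n, fun p hp => ?_, fun p hp q hq hpq => ⟨fun e => hpq ?_⟩⟩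
  · obtain ⟨h0, h1, h2, h3, h4⟩ := indexJ_bounds hp
    exact pair_indecomposable h0 h1 h2 h3 h4
  · obtain ⟨h0, h1, h2, h3, h4⟩ := indexJ_bounds hp
    obtain ⟨-, hq1, hq2, -, -⟩ := indexJ_bounds hq
    exact eq_of_pair_iso h0 h1 h2 h3 h4 hq1 hq2 e

end StableS

/-- Two full and dense additive functors on `C` that kill the same ideal have equivalent targets,
both equivalent to `C` modulo this ideal. -/
theorem FactorCategory.equivalences_and_isAbelian {C T : Type*} [Category C] [Preadditive C]
    [Category T] [Preadditive T] [HasFiniteBiproducts T] {R : Type u} [Ring R]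
    {K : ObjectProperty C} {Q : ObjectProperty T} (P : C ⥤ T) [P.Additive] [P.Full] [P.EssSurj]
    (F : C ⥤ FinLenMod R) [F.Additive] [F.Full] [F.EssSurj]
    (hP : ∀ {X Y : C} (f : X ⟶ Y), (P ⋙ factorFunctor Q).map f = 0 ↔ f ∈ objIdeal K X Y)
    (hF : ∀ {X Y : C} (f : X ⟶ Y), F.map f = 0 ↔ f ∈ objIdeal K X Y) :
    AdditivelyEquivalent (FactorCategory Q) (FactorCategory K) ∧
      AdditivelyEquivalent (FactorCategory Q) (FinLenMod R) ∧
      IsAbelianCategory (FactorCategory Q) := by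
  have h1 := (additivelyEquivalent_of_map_eq_zero_iff K (P ⋙ factorFunctor Q) hP).symm
  have h2 := h1.trans (additivelyEquivalent_of_map_eq_zero_iff K F hF)
  exact ⟨h1, h2, (FinLenMod.isAbelianCategory R).of_additivelyEquivalent h2⟩

theorem mainTheorem9 {k : Type u} [Field k] (n : ℕ) (hn : 1 ≤ n) :
    -- `𝒮(n)` is a Frobenius category
    IsFrobeniusStructure (SubmodPair.conflations k n) ∧
    -- with `([0],[n])` and `([n],[n])` as its only indecomposable projective-injective objects
    (∀ A : SubmodPair k n,
      (Indecomposable A ∧ IsExactProjective (SubmodPair.conflations k n) A ∧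
        IsExactInjective (SubmodPair.conflations k n) A) ↔
      (Nonempty (A ≅ SubmodPair.pair k n 0 n) ∨ Nonempty (A ≅ SubmodPair.pair k n n n))) ∧
    -- its stable category `𝒯` is triangulated, conflations giving distinguished triangles
    (∃ (_ : HasShift (StableS k n) ℤ)
       (_ : ∀ m : ℤ, (shiftFunctor (StableS k n) m).Additive)
       (_ : Pretriangulated (StableS k n)),
      IsTriangulated (StableS k n) ∧
      ∀ S : ShortComplex (SubmodPair k n), SubmodPair.conflations k n S →
        ∃ h : (StableS.proj k n).obj S.X₃ ⟶
            (shiftFunctor (StableS k n) (1 : ℤ)).obj ((StableS.proj k n).obj S.X₁),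
          Pretriangulated.Triangle.mk ((StableS.proj k n).map S.f) ((StableS.proj k n).map S.g) h ∈
            Pretriangulated.distinguishedTriangles) ∧
    -- the generators of `ℐ`: `2n - 2` pairwise non-isomorphic indecomposable objects of `𝒯`
    ((indexI n).ncard = 2 * n - 2 ∧
      (∀ p ∈ indexI n, Indecomposable (StableS.pair k n p)) ∧
      (indexI n).Pairwise fun p q => IsEmpty (StableS.pair k n p ≅ StableS.pair k n q)) ∧
    -- the generators of `𝒥`: `2n - 2` pairwise non-isomorphic indecomposable objects of `𝒯`
    ((indexJ n).ncard = 2 * n - 2 ∧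
      (∀ p ∈ indexJ n, Indecomposable (StableS.pair k n p)) ∧
      (indexJ n).Pairwise fun p q => IsEmpty (StableS.pair k n p ≅ StableS.pair k n q)) ∧
    -- `𝒯/ℐ ≃ 𝒮(n)/𝒰 ≃ mod Π_{n-1}`, and `𝒯/ℐ` is abelian
    (AdditivelyEquivalent (FactorCategory (StableS.pairs k n (indexI n)))
        (FactorCategory (SubmodPair.classU k n)) ∧
      AdditivelyEquivalent (FactorCategory (StableS.pairs k n (indexI n)))
        (FinLenMod (PreprojA k (n - 1))) ∧
      IsAbelianCategory (FactorCategory (StableS.pairs k n (indexI n)))) ∧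
    -- `𝒯/𝒥 ≃ 𝒮(n)/𝒱 ≃ mod Π_{n-1}`, and `𝒯/𝒥` is abelian
    (AdditivelyEquivalent (FactorCategory (StableS.pairs k n (indexJ n)))
        (FactorCategory (SubmodPair.classV k n)) ∧
      AdditivelyEquivalent (FactorCategory (StableS.pairs k n (indexJ n)))
        (FinLenMod (PreprojA k (n - 1))) ∧
      IsAbelianCategory (FactorCategory (StableS.pairs k n (indexJ n)))) := by
  have := SubmodPair.subFunctor_essSurj (k := k) hn
  have := SubmodPair.quotFunctor_essSurj (k := k) hn
  exact ⟨SubmodPair.isFrobeniusStructure k n,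
    SubmodPair.indecomposable_projective_injective_iff hn,
    SubmodPair.stable_triangulated k n,
    StableS.indexI_properties n,
    StableS.indexJ_properties n,
    FactorCategory.equivalences_and_isAbelian (StableS.proj k n) (SubmodPair.subFunctor k n)
      StableS.factor_I_map_eq_zero_iff SubmodPair.subFunctor_map_eq_zero_iff_mem,
    FactorCategory.equivalences_and_isAbelian (StableS.proj k n) (SubmodPair.quotFunctor k n)
      StableS.factor_J_map_eq_zero_iff SubmodPair.quotFunctor_map_eq_zero_iff_mem⟩
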